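/- Let $F_v$ be a finite extension of $\mathbf R$ or $\mathbf Q_p$, with the absolute value $|\cdot|_v$ extending the usual one of $\mathbf Q_v=\mathbf R$ or $\mathbf Q_p$, and let $m_v=[F_v:\mathbf Q_v]$. Let $X$ be a proper smooth variety of dimension $d$ over $F_v$, and let $(\mathscr L_\alpha)_\alpha$ be a finite family of line bundles on $X$, each equipped with a (continuous) metric on the set $X(F_v)$, together with global sections $\mathsf s_\alpha$ of $\mathscr L_\alpha$. Assume that the divisors $\operatorname{div}(\mathsf s_\alpha)$ are smooth over $F_v$ and that their sum $D$ is a divisor with normal crossings (in particular reduced), and let $U=X\setminus D$. Let $\omega\in\Gamma(U,\Omega^d_{X/F_v})$ be a differential form of top degree, meromorphic on $X$, and assume that there are integers $\lambda_\alpha$ such that the divisor of $\omega$ on $X$ equals $-\sum_\alpha\lambda_\alpha\operatorname{div}(\mathsf s_\alpha)$. Denote by $\mathrm d\omega$ the associated measure on $U(F_v)$: if $\omega=g\,dx_1\wedge\dots\wedge dx_d$ in local coordinates, then $\mathrm d\omega=|g|_v^{m_v}\,\mathrm dx_1\cdots\mathrm dx_d$, where $\mathrm dx_i$ is a fixed Haar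 measure on $F_v$. Then for all real numbers $r_\alpha$ the integral $$\int_{U(F_v)}\prod_\alpha\|\mathsf s_\alpha\|^{m_vr_\alpha}(x)\,\mathrm d\omega$$ converges if and only if $r_\alpha>\lambda_\alpha-1$ for every $\alpha$ such that $\operatorname{div}(\mathsf s_\alpha)$ has an $F_v$-rational point. In particular, if every $\operatorname{div}(\mathsf s_\alpha)$ has an $F_v$-rational point, the integral converges if and only if $r_\alpha>\lambda_\alpha-1$ for all $\alpha$. -/

import Mathlib

open AlgebraicGeometry CategoryTheory TopologicalSpace MeasureTheory
open scoped KaehlerDifferential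

universe u v

noncomputable section

namespace LocalIntegral

/-- A normed field that is (isometrically) the field of real numbers or a field of `p`-adic numbers,
with the absolute value normalized by `|2| = 2`, respectively by `|p| = 1 / p`. -/
def IsRealOrPadic (k : Type v) [NormedField k] : Prop :=
  (∃ e : k ≃+* ℝ, ∀ x, ‖e x‖ = ‖x‖) ∨
    ∃ (p : ℕ) (_ : Fact p.Prime) (e : k ≃+* ℚ_[p]), ∀ x, ‖e x‖ = ‖x‖

/-! ### Line bundles, divisors of sections -/

section LineBundles

variable {X : Scheme.{u}}

/-- Restriction of sections of a sheaf of modules. -/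
def resSec (L : X.Modules) {V W : X.Opens} (h : W ≤ V) (s : Γ(L, V)) : Γ(L, W) :=
  L.presheaf.map (homOfLE h).op s

/-- Restriction of regular functions. -/
def resFun {V W : X.Opens} (h : W ≤ V) (f : Γ(X, V)) : Γ(X, W) :=
  X.presheaf.map (homOfLE h).op f

/-- The section `e` of `L` over `V` is a frame: `a ↦ a • e` is an isomorphism from the structure
sheaf of `V` to `L` restricted to `V`. -/
def IsFrame (L : X.Modules) (V : X.Opens) (e : Γ(L, V)) : Prop :=
  ∀ (W : X.Opens) (h : W ≤ V), Function.Bijective fun a : Γ(X, W) => a • resSec L h e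

/-- A line bundle is an `𝒪_X`-module that is locally isomorphic to `𝒪_X`. -/
def IsLineBundle (L : X.Modules) : Prop :=
  ∀ p : X, ∃ (V : X.Opens) (_ : p ∈ V) (e : Γ(L, V)), IsFrame L V e

/-- `f` is an equation on `V` of the divisor of the global section `s` of `L`,
with respect to the frame `e` of `L` on `V`. -/
def IsLocalEquation (L : X.Modules) (s : Γ(L, (⊤ : X.Opens))) (V : X.Opens) (e : Γ(L, V))
    (f : Γ(X, V)) : Prop :=
  IsFrame L V e ∧ resSec L le_top s = f • e

/-- The open set where the section `s` of a line bundle does not vanish, that is, the complement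
of the divisor of `s`. -/
def nonvanishing (L : X.Modules) (s : Γ(L, (⊤ : X.Opens))) : X.Opens :=
  sSup {V | IsFrame L V (resSec L le_top s)}

/-- The ideal of the divisor of `s` in the local ring at `p`: it is generated by any
equation of the divisor near `p` (two of them differ by a unit). -/
def divIdeal (L : X.Modules) (s : Γ(L, (⊤ : X.Opens))) (p : X) : Ideal (X.presheaf.stalk p) :=
  Ideal.span {a | ∃ (V : X.Opens) (hp : p ∈ V) (e : Γ(L, V)) (f : Γ(X, V)),
    IsLocalEquation L s V e f ∧ a = X.presheaf.germ V p hp f}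

/-- `x` is a regular system of parameters of the local ring `R`
(in particular, if `R` is noetherian, it is a regular local ring of dimension `n`). -/
def IsRegularSystemOfParameters {R : Type u} [CommRing R] [IsLocalRing R] {n : ℕ}
    (x : Fin n → R) : Prop :=
  ringKrullDim R = n ∧ Ideal.span (Set.range x) = IsLocalRing.maximalIdeal R

/-- The sum of the divisors of the sections `s α` is a divisor with normal crossings: étale locally
around each point of `X`, it has an equation `x₁ ⋯ xᵣ = 0` where `x₁, …, xᵣ` are part of a
regular system of parameters (with `r = 0` off the support). In particular it is reduced. -/
def HasNormalCrossings {ι : Type v} [Fintype ι] (L : ι → X.Modules)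
    (s : ∀ α, Γ(L α, (⊤ : X.Opens))) : Prop :=
  ∀ p : X, ∃ (W : Scheme.{u}) (φ : W ⟶ X) (_ : Etale φ) (w : W), φ w = p ∧
    ∃ (n : ℕ) (x : Fin n → W.presheaf.stalk w), IsRegularSystemOfParameters x ∧
      ∃ r : Finset (Fin n),
        Ideal.map (φ.stalkMap w).hom (∏ α, divIdeal (L α) (s α) (φ w)) =
          Ideal.span {∏ i ∈ r, x i}

end LineBundles

/-! ### Schemes over a field: regular functions, top forms -/

section Forms

variable {F : Type u} [Field F]

/-- The pull-back of differential forms of degree `d` along a homomorphism of `F`-algebras. -/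
def formsMap (d : ℕ) {A B : Type u} [CommRing A] [CommRing B] [Algebra F A] [Algebra F B]
    (φ : A →ₐ[F] B) : (⋀[A]^d Ω[A⁄F]) →+ (⋀[B]^d Ω[B⁄F]) :=
  letI := φ.toRingHom.toAlgebra
  haveI : IsScalarTower F A B := IsScalarTower.of_algebraMap_eq fun x => (φ.commutes x).symm
  letI ι : Ω[B⁄F] [⋀^Fin d]→ₗ[A] (⋀[B]^d Ω[B⁄F]) :=
    { (exteriorPower.ιMulti B d (M := Ω[B⁄F])).toMultilinearMap.restrictScalars A with
      map_eq_zero_of_eq' := (exteriorPower.ιMulti B d (M := Ω[B⁄F])).map_eq_zero_of_eq }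
  (exteriorPower.alternatingMapLinearEquiv
    (ι.compLinearMap (KaehlerDifferential.map F F A B))).toAddMonoidHom

variable {X : Scheme.{u}} [X.Over (Spec (.of F))]

/-- The `F`-algebra structure on regular functions of an `F`-scheme. -/
instance algebraSections (V : X.Opens) : Algebra F Γ(X, V) :=
  RingHom.toAlgebra ((Scheme.ΓSpecIso (.of F)).inv ≫ (X ↘ Spec (.of F)).appTop ≫
    X.presheaf.map (homOfLE le_top).op).hom

/-- Restriction of regular functions, as a homomorphism of `F`-algebras. -/
def resAlg {V W : X.Opens} (h : W ≤ V) : Γ(X, V) →ₐ[F] Γ(X, W) :=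
  { (X.presheaf.map (homOfLE h).op).hom with
    commutes' := fun a => by
      have : X.presheaf.map (homOfLE (le_top : V ≤ ⊤)).op ≫ X.presheaf.map (homOfLE h).op =
          X.presheaf.map (homOfLE (le_top : W ≤ ⊤)).op := by
        rw [← Functor.map_comp]; rfl
      exact congr($(this).hom ((X ↘ Spec (.of F)).appTop.hom
        ((Scheme.ΓSpecIso (.of F)).inv.hom a))) }

variable (F) in
/-- The sections over an affine open set `V` of the sheaf of differential forms of degree `d`. -/
abbrev Forms (d : ℕ) (V : X.Opens) : Type u := ⋀[Γ(X, V)]^d Ω[Γ(X, V)⁄F]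

variable (F) in
/-- The form `dx₁ ∧ ⋯ ∧ dx_d`. -/
def wedge {d : ℕ} {V : X.Opens} (x : Fin d → Γ(X, V)) : Forms F d V :=
  exteriorPower.ιMulti Γ(X, V) d fun i => KaehlerDifferential.D F Γ(X, V) (x i)

variable (F) in
/-- A differential form of degree `d` on the open set `U`, i.e. a section over `U` of the sheaf
`Ω^d` of `X` over `F`: a compatible family of forms on the affine open subsets of `U`. -/
structure DForm (d : ℕ) (U : X.Opens) where
  val : ∀ V : X.Opens, IsAffineOpen V → V ≤ U → Forms F d V
  map_val : ∀ (V W : X.Opens) (hV : IsAffineOpen V) (hW : IsAffineOpen W) (hVU : V ≤ U)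
    (h : W ≤ V), formsMap d (resAlg (F := F) h) (val V hV hVU) = val W hW (h.trans hVU)

/-- `ω`, a form of top degree `d` on the open set `U` of the smooth scheme `X` of dimension `d`,
is a meromorphic form on `X` whose divisor is `∑ m_α div(s_α)`: near every point of `X`,
one has `ω = (∏ f_α ^ m_α) η`, where `f_α` is an equation of `div(s_α)` and `η` is a
generator of `Ω^d`. Negative powers are moved to the other side. -/
def DForm.HasDivisor {d : ℕ} {U : X.Opens} (ω : DForm F d U) {ι : Type v} [Fintype ι]
    (L : ι → X.Modules) (s : ∀ α, Γ(L α, (⊤ : X.Opens))) (m : ι → ℤ) : Prop :=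
  ∀ p : X, ∃ (V : X.Opens) (_ : p ∈ V) (_ : IsAffineOpen V)
    (e : ∀ α, Γ(L α, V)) (f : ι → Γ(X, V)) (η : Forms F d V),
    (∀ α, IsLocalEquation (L α) (s α) V (e α) (f α)) ∧
    Submodule.span Γ(X, V) {η} = ⊤ ∧
    ∀ (W : X.Opens) (hW : IsAffineOpen W) (hWV : W ≤ V) (hWU : W ≤ U),
      (∏ α, resFun hWV (f α) ^ (-m α).toNat) • ω.val W hW hWU =
        (∏ α, resFun hWV (f α) ^ (m α).toNat) • formsMap d (resAlg (F := F) hWV) η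

variable (F) in
/-- The divisor of `s` (the closed subscheme with local equations `f = 0`) is smooth over `F`. -/
def IsSmoothDivisor (L : X.Modules) (s : Γ(L, (⊤ : X.Opens))) : Prop :=
  ∀ (V : X.Opens) (_ : IsAffineOpen V) (e : Γ(L, V)) (f : Γ(X, V)),
    IsLocalEquation L s V e f → Algebra.Smooth F (Γ(X, V) ⧸ Ideal.span {f})

end Forms

/-! ### Rational points, metrics -/

section Points

/-- The set `X(F)` of `F`-rational points of the `F`-scheme `X`. -/
structure Points (F : Type u) [Field F] (X : Scheme.{u}) [X.Over (Spec (.of F))] where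
  hom : Spec (.of F) ⟶ X
  isSection : hom ≫ (X ↘ Spec (.of F)) = 𝟙 _

variable {F : Type u} [Field F] {X : Scheme.{u}} [X.Over (Spec (.of F))]

/-- The set `V(F)`, as a subset of `X(F)`: the rational points that factor through `V`. -/
def ratPoints (F : Type u) [Field F] [X.Over (Spec (.of F))] (V : X.Opens) : Set (Points F X) :=
  {x | ⊤ ≤ x.hom ⁻¹ᵁ V}

open Classical in
/-- The value at `x ∈ V(F)` of a regular function `f` on `V` (and zero if `x ∉ V(F)`). -/
def value {V : X.Opens} (f : Γ(X, V)) (x : Points F X) : F :=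
  if h : ⊤ ≤ x.hom ⁻¹ᵁ V then (x.hom.appLE V ⊤ h ≫ (Scheme.ΓSpecIso (.of F)).hom).hom f else 0

end Points

section Metrics

variable {F : Type u} [NormedField F] {X : Scheme.{u}} [X.Over (Spec (.of F))]

/-- The topology of `X(F)` defined by the topology of `F`: it is the coarsest one for which `V(F)`
is open and regular functions on `V` are continuous on `V(F)`, for all Zariski-open `V`. -/
instance : TopologicalSpace (Points F X) :=
  generateFrom {B | ∃ (V : X.Opens) (f : Γ(X, V)) (O : Set F), IsOpen O ∧
    B = {x | x ∈ ratPoints F V ∧ value f x ∈ O}}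

instance : MeasurableSpace (Points F X) := borel _

instance : BorelSpace (Points F X) := ⟨rfl⟩

variable (F) in
/-- A (continuous) metric on a line bundle `L`: a norm on each line `L(x)`, for `x ∈ X(F)`, given
through the norms `‖s‖(x)` of the local sections `s` of `L`, depending continuously on `x`.
The value of `norm V s x` is only meaningful if `x ∈ V(F)`. -/
structure Metric (L : X.Modules) where
  norm : ∀ V : X.Opens, Γ(L, V) → Points F X → ℝ
  norm_res : ∀ (V W : X.Opens) (h : W ≤ V) (s : Γ(L, V)), ∀ x ∈ ratPoints F W,
    norm W (resSec L h s) x = norm V s x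
  norm_smul : ∀ (V : X.Opens) (f : Γ(X, V)) (s : Γ(L, V)), ∀ x ∈ ratPoints F V,
    norm V (f • s) x = ‖value f x‖ * norm V s x
  norm_pos : ∀ (V : X.Opens) (e : Γ(L, V)), IsFrame L V e → ∀ x ∈ ratPoints F V, 0 < norm V e x
  continuousOn : ∀ (V : X.Opens) (s : Γ(L, V)), ContinuousOn (norm V s) (ratPoints F V)

end Metrics

/-! ### The measure associated with a form of top degree -/

section FormMeasure

variable {F : Type u} [NormedField F] {X : Scheme.{u}} [X.Over (Spec (.of F))]
  {d : ℕ} {U : X.Opens}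

/-- Local analytic coordinates on `U(F)` adapted to a top form `ω`: regular functions
`x₁, …, x_d` on an affine open set `V ⊆ U` with `dx₁ ∧ ⋯ ∧ dx_d` generating `Ω^d`, and an open
subset of `V(F)` which they map homeomorphically to an open subset of `F^d`, together with the
function `g` such that `ω = g dx₁ ∧ ⋯ ∧ dx_d`. -/
structure Coordinates (ω : DForm F d U) where
  V : X.Opens
  isAffineOpen : IsAffineOpen V
  le : V ≤ U
  x : Fin d → Γ(X, V)
  span_wedge : Submodule.span Γ(X, V) {wedge F x} = ⊤
  chart : OpenPartialHomeomorph (Points F X) (Fin d → F)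
  source_subset : chart.source ⊆ ratPoints F V
  chart_apply : ∀ p ∈ chart.source, chart p = fun i => value (x i) p
  g : Γ(X, V)
  val_eq : ω.val V isAffineOpen le = g • wedge F x

variable [MeasurableSpace F]

/-- The measure `|g|^m dx₁ ⋯ dx_d` on the domain of local coordinates (extended by zero),
where `dx` is the measure `μ` on `F`. -/
def Coordinates.measure {ω : DForm F d U} (c : Coordinates ω) (m : ℕ) (μ : Measure F) :
    Measure (Points F X) :=
  (((Measure.pi fun _ : Fin d => μ).restrict c.chart.target).withDensity
    fun y => ENNReal.ofReal (‖value c.g (c.chart.symm y)‖ ^ m)).map c.chart.symm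

/-- The measure `dω` on `U(F)` (seen as a measure on `X(F)` supported by `U(F)`) associated with a
top form `ω` on `U`, a Haar measure `μ` on `F` and the exponent `m` for which `|a|^m` is the factor
by which multiplication by `a` scales `μ`. It is the measure which on
the domain of any local coordinates is `|g|^m dx₁ ⋯ dx_d` if `ω = g dx₁ ∧ ⋯ ∧ dx_d`.
By the change of variables formula the latter measures agree on overlaps,
so they are glued by taking their supremum. -/
def DForm.measure (ω : DForm F d U) (m : ℕ) (μ : Measure F) : Measure (Points F X) :=
  ⨆ c : Coordinates ω, c.measure m μ

end FormMeasure

end LocalIntegral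

end

/-!
The proof reduces the integral to integrals of monomials in local coordinates.

*Local fields.* Multiplication by `a` scales a Haar measure on `F` by `|a|^m`, where `m` is the
degree of `F` over `ℝ` or `ℚ_p` (`hasHaarScaling`). Decomposing a punctured ball into annuli, one
finds a geometric series, so that `∫ |t|^s dt` converges near `0` if and only if `s > -m`. By
Fubini, a monomial `∏ |y_j|^{s_j}` is integrable near a point with coordinates `y_j = 0` if and
only if `s_j > -m` for all `j` (`HasHaarScaling.lintegral_monomial_lt_top_iff`).

*Adapted coordinates.* Let `p` be a rational point of `X`, and let `f_α` be equations near `p` of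
the divisors passing through `p`. As these divisors are smooth and their sum has normal crossings,
the differentials of the `f_α` at `p` are independent (`exists_isTangent_of_hasNormalCrossings`).
In an étale neighbourhood, `∏ f_α` is a unit times a product of distinct members of a regular system
of parameters. Each factor `f_α` has a non-zero differential by smoothness, hence lies outside of
`𝔪²`. As parameters are prime, the `f_α` are, up to units, distinct members of the system. So
the `f_α` can be completed to functions `x₁, …, x_d` with independent differentials
(`exists_completion`), and these are analytic coordinates by the inverse function theorem
(`exists_chart`). In these coordinates, the integrand times the density of `dω` is the product
of a positive continuous function and of `∏ |f_α|^{m (r_α - λ_α)}`. Hence the integral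
converges near `p` if and only if `r_α > λ_α - 1` for all `α` such that `p` lies on `div(s_α)`
(`DForm.HasDivisor.exists_coordinates_lintegral_lt_top_iff`).

*Globalization.* The space `X(F)` is compact: the limit of an ultrafilter is provided by the
valuative criterion, applied to the ring of bounded elements of an ultrapower of `F`, followed by
the standard part map (`isCompact_univ_points`). So finitely many of the coordinate neighbourhoods
cover `X(F)`. The measure `dω` is defined as the supremum of the measures `|g|^m dx₁ ⋯ dx_d` over
all coordinate systems. The precise change of variables formula is not needed for
convergence: it suffices that two of these measures agree, on the common domain, up to a factor
bounded in terms of the Haar measure and of `d` only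
(`HasHaarScaling.exists_coordinates_measure_le`). Indeed, locally the change of coordinates is the
composite of a linear map, whose effect on the measure is known exactly, and of a `2`-Lipschitz
map, which increases the measure at most by a constant factor. Hence `dω` is at least the measure
defined by any coordinate system, and at most a constant times the sum of those defined by finitely
many systems covering `U(F)` (`HasHaarScaling.exists_measure_le`); both implications of the theorem
follow.
-/

noncomputable section

namespace LocalIntegral

/-! ### Scaling of Haar measures on local fields -/

section Haar

open _root_.Metric Set Filter Topology ENNReal Pointwise NNReal

/-- Multiplication by `a` scales the measure `μ` by the factor `|a|^m`. -/
def HasHaarScaling {F : Type*} [NormedField F] [MeasurableSpace F] (m : ℕ) (μ : Measure F) : Prop :=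
  ∀ a : F, a ≠ 0 → ∀ s : Set F, μ (a • s) = ‖a‖ₑ ^ m * μ s

theorem properSpace_of_isometric_ringEquiv {k K : Type*} [NormedField k] [NormedField K]
    [ProperSpace K] (e : k ≃+* K) (he : ∀ x, ‖e x‖ = ‖x‖) : ProperSpace k := by
  have hi : Isometry e.symm := AddMonoidHomClass.isometry_of_norm e.symm fun x => by
    rw [← he, e.apply_symm_apply]
  exact hi.antilipschitz.properSpace hi.continuous e.symm.surjective

theorem IsRealOrPadic.properSpace {k : Type*} [NormedField k] (hk : IsRealOrPadic k) :
    ProperSpace k := by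
  rcases hk with ⟨e, he⟩ | ⟨p, hp, e, he⟩
  · exact properSpace_of_isometric_ringEquiv e he
  · exact properSpace_of_isometric_ringEquiv e he

/-- The unit ball of `ℚ_p` is the disjoint union of `p` translates of `p` times itself. -/
theorem padic_measure_smul_closedBall (p : ℕ) [hp : Fact p.Prime] [MeasurableSpace ℚ_[p]]
    [BorelSpace ℚ_[p]] (μ : Measure ℚ_[p]) [μ.IsAddHaarMeasure] :
    μ ((p : ℚ_[p]) • closedBall (0 : ℚ_[p]) 1) = ‖(p : ℚ_[p])‖ₑ * μ (closedBall 0 1) := by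
  have hp0 : (p : ℚ_[p]) ≠ 0 := by exact_mod_cast hp.out.ne_zero
  have hpn : ‖(p : ℚ_[p])‖ = (p : ℝ)⁻¹ := by simp
  have hp1 : (0 : ℝ) < p := by exact_mod_cast hp.out.pos
  set B : Set ℚ_[p] := (p : ℚ_[p]) • closedBall (0 : ℚ_[p]) 1 with hB
  have hB' : B = closedBall 0 (p : ℝ)⁻¹ := by rw [hB, smul_closedBall' hp0]; simp
  have hmem (x : ℚ_[p]) (i : ℕ) : x ∈ (i : ℚ_[p]) +ᵥ B ↔ ‖x - (i : ℚ_[p])‖ ≤ (p : ℝ)⁻¹ := by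
    rw [hB', mem_vadd_set_iff_neg_vadd_mem, mem_closedBall_zero_iff, vadd_eq_add, neg_add_eq_sub]
  have hdvd (x : ℤ_[p]) (i : ℕ) :
      ‖x - (i : ℤ_[p])‖ ≤ (p : ℝ)⁻¹ ↔ x - (i : ℤ_[p]) ∈ Ideal.span {(p : ℤ_[p])} := by
    have := PadicInt.norm_le_pow_iff_mem_span_pow (x - (i : ℤ_[p])) 1
    simpa using this
  have hunion : closedBall (0 : ℚ_[p]) 1 = ⋃ i ∈ Finset.range p, ((i : ℚ_[p]) +ᵥ B) := by
    ext x
    simp only [mem_iUnion, exists_prop, hmem, mem_closedBall_zero_iff]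
    constructor
    · intro hx
      have h1 := PadicInt.sub_zmodRepr_mem (⟨x, hx⟩ : ℤ_[p])
      refine ⟨PadicInt.zmodRepr ⟨x, hx⟩, Finset.mem_range.2 (PadicInt.zmodRepr_lt_p _), ?_⟩
      rw [PadicInt.maximalIdeal_eq_span_p] at h1
      exact (hdvd ⟨x, hx⟩ _).2 h1
    · rintro ⟨i, -, hi⟩
      have h2 : ‖(i : ℚ_[p])‖ ≤ 1 := by exact_mod_cast Padic.norm_int_le_one (p := p) i
      have h3 : (p : ℝ)⁻¹ ≤ 1 := inv_le_one_of_one_le₀ (by exact_mod_cast hp.out.one_lt.le)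
      calc ‖x‖ = ‖(x - i) + i‖ := by simp
        _ ≤ max ‖x - (i : ℚ_[p])‖ ‖(i : ℚ_[p])‖ := Padic.nonarchimedean _ _
        _ ≤ 1 := max_le (hi.trans h3) h2
  have hdisj : (Finset.range p : Set ℕ).PairwiseDisjoint fun i => ((i : ℚ_[p]) +ᵥ B) := by
    intro i hi j hj hij
    refine Set.disjoint_left.2 fun x hx hx' => hij ?_
    rw [hmem] at hx hx'
    have h1 : ‖((i : ℤ) - (j : ℤ) : ℤ) • (1 : ℚ_[p])‖ ≤ (p : ℝ)⁻¹ := by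
      have : ((i : ℤ) - (j : ℤ) : ℤ) • (1 : ℚ_[p]) = (x - j) + -(x - i) := by simp
      rw [this]
      exact (Padic.nonarchimedean _ _).trans (max_le hx' (by rwa [norm_neg]))
    have h2 := (Padic.norm_int_le_pow_iff_dvd (p := p) ((i : ℤ) - j) 1).1 (by simpa using h1)
    have h3 : i % p = j % p := (Nat.modEq_iff_dvd.2 (by simpa using h2)).symm
    rwa [Nat.mod_eq_of_lt (Finset.mem_range.1 hi), Nat.mod_eq_of_lt (Finset.mem_range.1 hj)] at h3
  have hmeas : μ (closedBall 0 1) = p * μ B := by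
    rw [hunion, measure_biUnion_finset hdisj]
    · simp only [measure_vadd, Finset.sum_const, Finset.card_range, nsmul_eq_mul]
    · intro i _
      refine IsClosed.measurableSet ?_
      have : ((i : ℚ_[p]) +ᵥ B) = {x | ‖x - (i : ℚ_[p])‖ ≤ (p : ℝ)⁻¹} := by ext x; exact hmem x i
      rw [this]
      exact isClosed_le (by fun_prop) continuous_const
  have hpe : ‖(p : ℚ_[p])‖ₑ = (p : ℝ≥0∞)⁻¹ := by
    rw [← ofReal_norm, hpn, ENNReal.ofReal_inv_of_pos hp1, ENNReal.ofReal_natCast]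
  rw [hmeas, hpe, ← mul_assoc, ENNReal.inv_mul_cancel (by simpa using hp.out.ne_zero) (by simp),
    one_mul]

/-- The Haar measure on a field isometric to `ℝ` or `ℚ_p` is scaled by `|c|` under multiplication
by `c`, for at least one `c` with `0 < |c| < 1`. -/
theorem IsRealOrPadic.exists_measure_smul {k : Type*} [NormedField k] (hk : IsRealOrPadic k)
    [MeasurableSpace k] [BorelSpace k] (μ : Measure k) [μ.IsAddHaarMeasure] :
    ∃ c : k, 0 < ‖c‖ ∧ ‖c‖ < 1 ∧ μ (c • closedBall 0 1) = ‖c‖ₑ * μ (closedBall 0 1) := by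
  suffices H : ∀ (K : Type) [NormedField K] [MeasurableSpace K] [BorelSpace K] (e : k ≃+* K)
      (_ : ∀ x, ‖e x‖ = ‖x‖) (c : K), 0 < ‖c‖ → ‖c‖ < 1 → (∀ (ν : Measure K) [ν.IsAddHaarMeasure],
        ν (c • closedBall 0 1) = ‖c‖ₑ * ν (closedBall 0 1)) →
      ∃ c : k, 0 < ‖c‖ ∧ ‖c‖ < 1 ∧ μ (c • closedBall 0 1) = ‖c‖ₑ * μ (closedBall 0 1) by
    rcases hk with ⟨e, he⟩ | ⟨p, hp, e, he⟩
    · refine H ℝ e he (1 / 2) (by norm_num) (by norm_num) fun ν _ => ?_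
      rw [Measure.addHaar_smul]
      simp [Real.enorm_eq_ofReal_abs]
    · let : MeasurableSpace ℚ_[p] := borel _
      have : BorelSpace ℚ_[p] := ⟨rfl⟩
      have h1 : ‖(p : ℚ_[p])‖ = (p : ℝ)⁻¹ := by simp
      refine H ℚ_[p] e he p ?_ ?_ fun ν _ => padic_measure_smul_closedBall p ν
      · rw [h1]; exact inv_pos.2 (by exact_mod_cast hp.out.pos)
      · rw [h1]; exact inv_lt_one_of_one_lt₀ (by exact_mod_cast hp.out.one_lt)
  intro K _ _ _ e he c hc0 hc1 hν
  have hi : Isometry e := AddMonoidHomClass.isometry_of_norm e he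
  let E : k ≃ᵢ K := ⟨e.toEquiv, hi⟩
  have hE (x : k) : E x = e x := rfl
  have hhaar : (μ.map E).IsAddHaarMeasure :=
    (e.toAddEquiv).isAddHaarMeasure_map μ E.continuous E.symm.continuous
  have hs : ∀ x, ‖e.symm x‖ = ‖x‖ := fun x => by rw [← he, e.apply_symm_apply]
  have hmap (S : Set K) : μ.map E S = μ (E ⁻¹' S) := E.toHomeomorph.toMeasurableEquiv.map_apply S
  have hball : E ⁻¹' closedBall 0 1 = closedBall 0 1 := by
    ext x; rw [mem_preimage, hE, mem_closedBall_zero_iff, he, mem_closedBall_zero_iff]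
  refine ⟨e.symm c, by rwa [hs], by rwa [hs], ?_⟩
  have h1 := hν (μ.map E)
  rw [hmap, hmap, hball] at h1
  have h2 : E ⁻¹' (c • closedBall 0 1) = e.symm c • closedBall 0 1 := by
    have hc : c ≠ 0 := norm_pos_iff.1 hc0
    rw [smul_closedBall' hc, smul_closedBall' (by simpa using hc)]
    ext x
    simp only [smul_zero, mem_preimage, hE, mem_closedBall_zero_iff, he, hs]
  have h3 : ‖e.symm c‖ₑ = ‖c‖ₑ := by rw [← ofReal_norm, hs, ofReal_norm]
  rw [← h2, h1, h3]

/-- On a finite extension `F` of `ℝ` or `ℚ_p` of degree `m`, multiplication by `a` scales Haar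
measures by the factor `|a|^m`. The modulus of `a` is monotone in `|a|` and multiplicative, and has
the expected value at some `c` of the base field with `0 < |c| < 1`; comparing powers of `a`
with powers of `c` determines it. -/
theorem hasHaarScaling {k : Type*} [NontriviallyNormedField k] (hk : IsRealOrPadic k)
    {F : Type*} [NormedField F] [NormedAlgebra k F] [FiniteDimensional k F]
    [MeasurableSpace F] [BorelSpace F] (μ : Measure F) [μ.IsAddHaarMeasure] :
    HasHaarScaling (Module.finrank k F) μ := by
  have := hk.properSpace
  have : ProperSpace F := FiniteDimensional.proper k F
  let : MeasurableSpace k := borel _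
  have : BorelSpace k := ⟨rfl⟩
  set m := Module.finrank k F with hm
  obtain ⟨c, hc0, hc1, hc⟩ := hk.exists_measure_smul (Measure.addHaar (G := k))
  have hcne : c ≠ 0 := norm_pos_iff.1 hc0
  have hcF : algebraMap k F c ≠ 0 := by simpa using hcne
  have hcn : ‖algebraMap k F c‖₊ = ‖c‖₊ := by ext; simp
  -- the scaling factor at `c`
  have hδc : distribHaarChar F (Units.mk0 _ hcF) = ‖c‖₊ ^ m := by
    let ψ : F ≃L[k] (Fin m → k) := (Module.finBasis k F).equivFunL
    let ν : Measure (Fin m → k) := Measure.pi fun _ => Measure.addHaar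
    have : (ν.map ψ.symm).IsAddHaarMeasure := ψ.symm.isAddHaarMeasure_map ν
    have hmap (S : Set F) : ν.map ψ.symm S = ν (ψ.symm ⁻¹' S) :=
      ψ.symm.toHomeomorph.toMeasurableEquiv.map_apply S
    let B : Set (Fin m → k) := closedBall 0 1
    have hB : B = univ.pi fun _ : Fin m => closedBall (0 : k) 1 := by
      simp [B, closedBall_pi (0 : Fin m → k) zero_le_one]
    have hpre (S : Set (Fin m → k)) : ψ.symm ⁻¹' (ψ ⁻¹' S) = S := by
      rw [← preimage_comp]; simp
    have hcB : c • B = univ.pi fun _ : Fin m => c • closedBall (0 : k) 1 := by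
      rw [hB, smul_univ_pi]; rfl
    have hbf : (Measure.addHaar : Measure k) (closedBall 0 1) ≠ ∞ :=
      (isCompact_closedBall _ _).measure_ne_top
    have hb0 : (Measure.addHaar : Measure k) (closedBall 0 1) ≠ 0 :=
      (measure_closedBall_pos _ _ zero_lt_one).ne'
    refine distribHaarChar_eq_of_measure_smul_eq_mul (μ := ν.map ψ.symm) (s := ψ ⁻¹' B) ?_ ?_ ?_
    · rw [hmap, hpre, hB, Measure.pi_pi]; simp [hb0]
    · rw [hmap, hpre, hB, Measure.pi_pi]; exact ENNReal.prod_ne_top fun _ _ => hbf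
    · have : (Units.mk0 _ hcF : Fˣ) • (ψ ⁻¹' B) = ψ ⁻¹' (c • B) := by
        have h1 : (Units.mk0 _ hcF : Fˣ) • (ψ ⁻¹' B) = c • (ψ ⁻¹' B) := by
          ext x
          simp only [mem_smul_set, Units.smul_def, Units.val_mk0, algebraMap_smul]
        rw [h1, ← ψ.image_symm_eq_preimage, ← ψ.image_symm_eq_preimage]
        exact (image_smul_comm ψ.symm c B fun b => map_smul ψ.symm c b).symm
      rw [this, hmap, hmap, hpre, hpre, hcB, hB, Measure.pi_pi, Measure.pi_pi]
      simp only [hc, Finset.prod_mul_distrib, Finset.prod_const, Finset.card_univ,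
        Fintype.card_fin]
      simp [enorm_eq_nnnorm]
  -- monotonicity of the scaling factor
  have hmono (a b : Fˣ) (hab : ‖(a : F)‖ ≤ ‖(b : F)‖) :
      distribHaarChar F a ≤ distribHaarChar F b := by
    have hbf : μ (closedBall 0 1) ≠ ∞ := (isCompact_closedBall _ _).measure_ne_top
    have hb0 : μ (closedBall 0 1) ≠ 0 := (measure_closedBall_pos _ _ zero_lt_one).ne'
    rw [← ENNReal.coe_le_coe, ← ENNReal.mul_le_mul_iff_left hb0 hbf, distribHaarChar_mul,
      distribHaarChar_mul]
    refine measure_mono ?_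
    simp only [Units.smul_def]
    rw [show (a : F) • closedBall (0 : F) 1 = _ from smul_closedBall' a.ne_zero 0 1,
      show (b : F) • closedBall (0 : F) 1 = _ from smul_closedBall' b.ne_zero 0 1]
    simpa using closedBall_subset_closedBall hab
  -- `a ^ n` lies between consecutive powers of `c`, so that the `n`-th power of the left side is
  -- at most `‖c‖ ^ (-m)` times that of the right side
  have hle (a : Fˣ) : distribHaarChar F a ≤ ‖(a : F)‖₊ ^ m := by
    by_contra! hlt
    have ha0 : 0 < ‖(a : F)‖₊ := by simp
    have hcp : 0 < ‖c‖₊ := hc0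
    obtain ⟨n, hn⟩ := pow_unbounded_of_one_lt ((‖c‖₊ ^ m)⁻¹)
      ((one_lt_div (pow_pos ha0 m)).2 hlt)
    obtain ⟨j, hj1, hj2⟩ := exists_mem_Ico_zpow (pow_pos ha0 n)
      ((one_lt_inv₀ hcp).2 hc1 : 1 < ‖c‖₊⁻¹)
    have h1 : distribHaarChar F a ^ n ≤ (‖c‖₊⁻¹ ^ (j + 1)) ^ m := by
      have := hmono (a ^ n) ((Units.mk0 _ hcF)⁻¹ ^ (j + 1)) (by
        have h2 : ‖(a : F)‖₊ ^ n ≤ ‖c‖₊⁻¹ ^ (j + 1) := hj2.le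
        simpa [← NNReal.coe_le_coe] using h2)
      rw [map_pow, map_zpow, map_inv, hδc] at this
      calc _ ≤ _ := this
        _ = _ := by rw [← inv_pow, ← zpow_natCast, ← zpow_natCast, ← zpow_mul, ← zpow_mul, mul_comm]
    have h3 : (‖c‖₊⁻¹ ^ (j + 1)) ^ m ≤ (‖c‖₊ ^ m)⁻¹ * (‖(a : F)‖₊ ^ m) ^ n := by
      rw [zpow_add_one₀ (inv_ne_zero hcp.ne'), mul_pow, mul_comm, inv_pow, ← pow_mul, mul_comm m n,
        pow_mul]
      gcongr
    have h4 := h1.trans h3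
    rw [div_pow, lt_div_iff₀ (by positivity)] at hn
    exact absurd h4 (not_le.2 hn)
  intro a ha s
  -- the inequality for `a⁻¹` is the opposite one for `a`
  have h1 := hle (Units.mk0 a ha)
  have h2 := hle (Units.mk0 a ha)⁻¹
  have h3 : distribHaarChar F (Units.mk0 a ha) = ‖a‖₊ ^ m := by
    refine le_antisymm h1 ?_
    rw [map_inv] at h2
    have h4 : 0 < ‖a‖₊ ^ m := pow_pos (nnnorm_pos.2 ha) m
    have h5 : ‖((Units.mk0 a ha)⁻¹ : Fˣ).val‖₊ ^ m = (‖a‖₊ ^ m)⁻¹ := by simp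
    rw [h5] at h2
    exact (inv_le_inv₀ (distribHaarChar_pos ..) h4).1 h2
  have h6 := distribHaarChar_mul μ (Units.mk0 a ha) s
  rw [h3] at h6
  have h7 : (Units.mk0 a ha) • s = a • s := rfl
  rw [← h7, ← h6]
  simp [enorm_eq_nnnorm]

end Haar

/-! ### Linear and Lipschitz images of sets in `F^d` -/

section Images

open _root_.Metric Set Filter Topology ENNReal Pointwise NNReal

/-- A measure for which balls satisfy a uniform doubling bound increases by at most a constant
factor under `2`-Lipschitz maps: cover the set by balls whose shrinkings are disjoint. -/
theorem measure_image_le_of_lipschitzOnWith {E : Type*} [MetricSpace E]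
    [SecondCountableTopology E] [MeasurableSpace E] [BorelSpace E] (μ : Measure E)
    [μ.OuterRegular] {C : ℝ≥0∞}
    (hC : ∀ (x y : E) (r : ℝ), 0 < r → μ (closedBall y (20 * r)) ≤ C * μ (closedBall x r))
    {f : E → E} {T : Set E} (hf : LipschitzOnWith 2 f T) (hC0 : C ≠ 0) (hC1 : C ≠ ∞) :
    μ (f '' T) ≤ C * μ T := by
  rw [Set.measure_eq_iInf_isOpen T, ENNReal.mul_iInf_of_ne hC0 hC1]
  refine le_iInf fun O => ?_
  rw [ENNReal.mul_iInf_of_ne hC0 hC1]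
  refine le_iInf fun hTO => ?_
  rw [ENNReal.mul_iInf_of_ne hC0 hC1]
  refine le_iInf fun hO => ?_
  have hr : ∀ x : T, ∃ r : ℝ, 0 < r ∧ r ≤ 1 ∧ closedBall (x : E) r ⊆ O := by
    intro x
    obtain ⟨ε, hε, hεO⟩ := Metric.isOpen_iff.1 hO x (hTO x.2)
    exact ⟨min (ε / 2) 1, by positivity, min_le_right _ _,
      (closedBall_subset_ball ((min_le_left _ _).trans_lt (by linarith))).trans hεO⟩
  choose r hr0 hr1 hrO using hr
  obtain ⟨u, -, hu, hcov⟩ := Vitali.exists_disjoint_subfamily_covering_enlargement_closedBall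
    (univ : Set T) (fun x => (x : E)) r 1 (fun x _ => hr1 x) 5 (by norm_num)
  have huc : u.Countable := by
    refine hu.countable_of_nonempty_interior fun x _ => ?_
    exact ⟨x, ball_subset_interior_closedBall (mem_ball_self (hr0 x))⟩
  have hsub : f '' T ⊆ ⋃ b ∈ u, f '' (T ∩ closedBall (b : E) (5 * r b)) := by
    rintro _ ⟨x, hx, rfl⟩
    obtain ⟨b, hb, hxb⟩ := hcov ⟨x, hx⟩ (mem_univ _)
    exact mem_biUnion hb ⟨x, ⟨hx, hxb (mem_closedBall_self (hr0 ⟨x, hx⟩).le)⟩, rfl⟩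
  have hone (b : T) : μ (f '' (T ∩ closedBall (b : E) (5 * r b))) ≤ C * μ (closedBall b (r b)) := by
    refine (measure_mono ?_).trans (hC b (f b) (r b) (hr0 b))
    rintro _ ⟨z, ⟨hzT, hz⟩, rfl⟩
    -- the image lies in the ball of radius `2 * (5 * r b)` around `f b`
    have h1 := hf.dist_le_mul z hzT b b.2
    rw [mem_closedBall] at hz ⊢
    have h2 := (hr0 b)
    norm_num at h1
    linarith
  calc μ (f '' T) ≤ ∑' b : u, μ (f '' (T ∩ closedBall (b : E) (5 * r b))) :=
        (measure_mono hsub).trans (measure_biUnion_le μ huc _)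
    _ ≤ ∑' b : u, C * μ (closedBall ((b : T) : E) (r b)) := ENNReal.tsum_le_tsum fun b => hone b
    _ = C * ∑' b : u, μ (closedBall ((b : T) : E) (r b)) := ENNReal.tsum_mul_left
    _ = C * μ (⋃ b ∈ u, closedBall ((b : T) : E) (r b)) := by
        rw [measure_biUnion huc hu fun b _ => isClosed_closedBall.measurableSet]
    _ ≤ C * μ O := by gcongr; exact iUnion₂_subset fun b _ => hrO b

theorem HasHaarScaling.preimage_mul_left {F : Type*} [NormedField F] [MeasurableSpace F]
    {μ : Measure F} {m : ℕ} (hμ : HasHaarScaling m μ) {a : F} (ha : a ≠ 0)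
    (s : Set F) : μ ((a * ·) ⁻¹' s) = (‖a‖ₑ ^ m)⁻¹ * μ s := by
  have h : (a * ·) ⁻¹' s = a⁻¹ • s := by
    ext x; rw [mem_smul_set_iff_inv_smul_mem₀ (inv_ne_zero ha)]; simp
  have h1 : ‖a⁻¹‖ₑ ^ m = (‖a‖ₑ ^ m)⁻¹ := by
    rw [enorm_inv ha, ENNReal.inv_pow]
  rw [h, hμ _ (inv_ne_zero ha), h1]

variable {F : Type*} [NontriviallyNormedField F] [ProperSpace F] [MeasurableSpace F]
  [BorelSpace F] {μ : Measure F} [μ.IsAddHaarMeasure] {m : ℕ}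

/-- The effect of an invertible matrix on the product measure. Such matrices are products of
diagonal matrices and transvections. -/
theorem HasHaarScaling.map_toLin' (hμ : HasHaarScaling m μ) {d : ℕ}
    {M : Matrix (Fin d) (Fin d) F} (hM : M.det ≠ 0) :
    (Measure.pi fun _ : Fin d => μ).map (Matrix.toLin' M) =
      (‖M.det‖ₑ ^ m)⁻¹ • Measure.pi fun _ : Fin d => μ := by
  have hmeas (M : Matrix (Fin d) (Fin d) F) : Measurable (Matrix.toLin' M) :=
    (LinearMap.continuous_on_pi _).measurable
  apply Matrix.diagonal_transvection_induction_of_det_ne_zero _ M hM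
  · intro D hD
    have hDi : ∀ i, D i ≠ 0 := fun i => by
      simp only [Matrix.det_diagonal, Ne] at hD
      exact Finset.prod_ne_zero_iff.1 hD i (Finset.mem_univ i)
    have hc0 : ‖(Matrix.diagonal D).det‖ₑ ^ m ≠ 0 := pow_ne_zero _ (enorm_ne_zero.2 hD)
    have hc1 : ‖(Matrix.diagonal D).det‖ₑ ^ m ≠ ∞ := by simp
    have key : Measure.pi (fun _ : Fin d => μ) =
        (‖(Matrix.diagonal D).det‖ₑ ^ m) •
          (Measure.pi fun _ : Fin d => μ).map (Matrix.toLin' (Matrix.diagonal D)) := by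
      refine Measure.pi_eq fun s hs => ?_
      simp only [Measure.coe_smul, smul_eq_mul, Pi.smul_apply]
      rw [Measure.map_apply (hmeas _) (MeasurableSet.univ_pi hs)]
      have : (Matrix.toLin' (Matrix.diagonal D) ⁻¹' Set.pi Set.univ fun i => s i) =
          Set.pi Set.univ fun i => (D i * ·) ⁻¹' s i := by
        ext f
        simp [Matrix.mulVec_diagonal]
      rw [this, Measure.pi_pi, Matrix.det_diagonal]
      simp only [hμ.preimage_mul_left (hDi _), Finset.prod_mul_distrib]
      have h2 : ‖∏ i, D i‖ₑ ^ m = ∏ i, ‖D i‖ₑ ^ m := by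
        rw [Finset.prod_pow]; congr 1
        simp only [enorm_eq_nnnorm, nnnorm_prod]; push_cast; rfl
      rw [h2, ← mul_assoc, ← Finset.prod_mul_distrib]
      have h3 : ∀ i, ‖D i‖ₑ ^ m * (‖D i‖ₑ ^ m)⁻¹ = 1 := fun i =>
        ENNReal.mul_inv_cancel (by simpa using fun h => absurd h (hDi i)) (by simp)
      simp [h3]
    conv_rhs => rw [key]
    rw [smul_smul, ENNReal.inv_mul_cancel hc0 hc1, one_smul]
  · intro t
    rw [Matrix.TransvectionStruct.det]
    simp only [enorm_one, one_pow, inv_one, one_smul]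
    refine (Measure.pi_eq fun s hs ↦ ?_).symm
    have h2s : MeasurableSet (univ.pi s) := .pi countable_univ fun i _ ↦ hs i
    have ht := hmeas t.toMatrix
    simp_rw [← Measure.pi_pi, ← lintegral_indicator_one h2s]
    rw [lintegral_map (measurable_one.indicator h2s) ht]
    refine lintegral_eq_of_lmarginal_eq {t.i} ((measurable_one.indicator h2s).comp ht)
      (measurable_one.indicator h2s) ?_
    simp_rw [lmarginal_singleton]
    ext x
    cases t with | mk t_i t_j t_hij t_c =>
    simp [Matrix.transvection, Matrix.single_mulVec, t_hij.symm, ← Function.update_add,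
      lintegral_add_right_eq_self fun xᵢ ↦ indicator (univ.pi s) 1 (Function.update x t_i xᵢ)]
  · intro A B hA hB IHA IHB
    rw [Matrix.toLin'_mul, Matrix.det_mul, LinearMap.coe_comp,
      ← Measure.map_map (hmeas _) (hmeas _), IHB, Measure.map_smul, IHA, smul_smul, enorm_mul,
      mul_pow, ENNReal.mul_inv (Or.inr (by simp)) (Or.inl (by simp)), mul_comm]

/-- The change of variables formula for an invertible linear map: it scales the product measure
by `|det|^m`. -/
theorem HasHaarScaling.measure_image (hμ : HasHaarScaling m μ) {d : ℕ}
    (A : (Fin d → F) →ₗ[F] (Fin d → F)) (hA : LinearMap.det A ≠ 0) (s : Set (Fin d → F)) :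
    Measure.pi (fun _ : Fin d => μ) (A '' s) =
      ‖LinearMap.det A‖ₑ ^ m * Measure.pi (fun _ : Fin d => μ) s := by
  set M := LinearMap.toMatrix' A
  have hMA : Matrix.toLin' M = A := Matrix.toLin'_toMatrix' A
  have hdet : M.det = LinearMap.det A := LinearMap.det_toMatrix' A
  have h0 : ‖LinearMap.det A‖ₑ ^ m ≠ 0 := by simpa using fun h => absurd h hA
  have h1 : ‖LinearMap.det A‖ₑ ^ m ≠ ∞ := by simp
  have h := hμ.map_toLin' (M := M) (by rwa [hdet])
  rw [hMA, hdet] at h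
  let e := LinearEquiv.ofIsUnitDet (f := A) (v := Pi.basisFun F (Fin d))
    (v' := Pi.basisFun F (Fin d)) (by rw [LinearMap.det_toMatrix]; exact hA.isUnit)
  let E := e.toContinuousLinearEquiv.toHomeomorph.toMeasurableEquiv
  have hE : (E : (Fin d → F) → (Fin d → F)) = A := rfl
  have h2 := E.map_apply (μ := Measure.pi fun _ : Fin d => μ) (A '' s)
  rw [hE, h, preimage_image_eq _ (by rw [← hE]; exact E.injective)] at h2
  rw [← h2, Measure.smul_apply, smul_eq_mul, ← mul_assoc, ENNReal.mul_inv_cancel h0 h1, one_mul]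

/-- Images under `2`-Lipschitz maps in `F^d` have measure at most a constant times that of the
original set. -/
theorem HasHaarScaling.exists_lipschitz_bound (hμ : HasHaarScaling m μ) (d : ℕ) :
    ∃ C : ℝ≥0∞, C ≠ 0 ∧ C ≠ ∞ ∧ ∀ (f : (Fin d → F) → (Fin d → F)) (T : Set (Fin d → F)),
      LipschitzOnWith 2 f T → Measure.pi (fun _ : Fin d => μ) (f '' T) ≤
        C * Measure.pi (fun _ : Fin d => μ) T := by
  -- a ball of radius `20 * r` is contained in a translate of `c` times any ball of radius `r`
  obtain ⟨c, hc⟩ := NormedField.exists_lt_norm F 20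
  have hc0 : c ≠ 0 := by rintro rfl; norm_num at hc
  let A : (Fin d → F) →ₗ[F] (Fin d → F) := c • LinearMap.id
  have hA : LinearMap.det A ≠ 0 := by simp [A, LinearMap.det_smul, hc0]
  refine ⟨‖LinearMap.det A‖ₑ ^ m, by simpa using fun h => absurd h hA, by simp, fun f T hf =>
    measure_image_le_of_lipschitzOnWith _ (fun x y r hr => ?_) hf
      (by simpa using fun h => absurd h hA) (by simp)⟩
  rw [← hμ.measure_image A hA]
  have h1 : A '' closedBall x r = (c • x - y) +ᵥ closedBall y (‖c‖ * r) := by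
    have : A '' closedBall x r = c • closedBall x r := rfl
    rw [this, smul_closedBall' hc0, vadd_closedBall]; simp
  rw [h1, measure_vadd]
  exact measure_mono (closedBall_subset_closedBall (by gcongr))

end Images

/-! ### Comparison of the measures defined by two charts -/

section Comparison

open _root_.Metric Set Filter Topology ENNReal Pointwise NNReal

/-- An inequality between two measures that holds locally on a set holds for all its
measurable subsets. -/
theorem measure_le_of_locally_le {X : Type*} [TopologicalSpace X] [SecondCountableTopology X]
    [MeasurableSpace X] [BorelSpace X] {ν₁ ν₂ : Measure X} {U : Set X}
    (h : ∀ x ∈ U, ∃ N ∈ 𝓝 x, ∀ S ⊆ N, MeasurableSet S → S ⊆ U → ν₁ S ≤ ν₂ S) {S : Set X}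
    (hSU : S ⊆ U) (hS : MeasurableSet S) : ν₁ S ≤ ν₂ S := by
  classical
  choose! N hN hle using h
  obtain ⟨t, htU, htc, hcov⟩ := TopologicalSpace.countable_cover_nhdsWithin
    (f := fun x => interior (N x)) (s := U)
    fun x hx => mem_nhdsWithin_of_mem_nhds (interior_mem_nhds.2 (hN x hx))
  rcases t.eq_empty_or_nonempty with rfl | hne
  · have : S = ∅ := by simpa using hSU.trans hcov
    simp [this]
  obtain ⟨g, rfl⟩ := htc.exists_eq_range hne
  set D : ℕ → Set X := disjointed fun n => interior (N (g n)) with hD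
  have hDm (n : ℕ) : MeasurableSet (D n) :=
    MeasurableSet.disjointed (fun n => isOpen_interior.measurableSet) n
  have hSD : S = ⋃ n, S ∩ D n := by
    rw [← inter_iUnion, hD, iUnion_disjointed]
    refine (inter_eq_left.2 (hSU.trans (hcov.trans ?_))).symm
    simp
  have hdisj : Pairwise (Function.onFun Disjoint fun n => S ∩ D n) := fun i j hij =>
    ((disjoint_disjointed _) hij).mono inter_subset_right inter_subset_right
  rw [hSD, measure_iUnion hdisj fun n => hS.inter (hDm n),
    measure_iUnion hdisj fun n => hS.inter (hDm n)]
  refine ENNReal.tsum_le_tsum fun n => hle (g n) (htU (mem_range_self n)) _ ?_ (hS.inter (hDm n))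
    (inter_subset_left.trans hSU)
  exact inter_subset_right.trans ((disjointed_subset _ n).trans interior_subset)

variable {F : Type*} [NontriviallyNormedField F] [ProperSpace F] [MeasurableSpace F]
  [BorelSpace F] {μ : Measure F} [μ.IsAddHaarMeasure] {m : ℕ} {d : ℕ}
  {X : Type*} [TopologicalSpace X] [MeasurableSpace X] [BorelSpace X]

/-- The measure `ρ dx₁ ⋯ dx_d` on the domain of a chart. -/
def chartMeasure (μ : Measure F) (E : OpenPartialHomeomorph X (Fin d → F)) (ρ : X → ℝ) :
    Measure X :=
  (((Measure.pi fun _ : Fin d => μ).restrict E.target).withDensity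
    fun y => ENNReal.ofReal (ρ (E.symm y))).map E.symm

omit [μ.IsAddHaarMeasure] in
theorem aemeasurable_symm (E : OpenPartialHomeomorph X (Fin d → F))
    (g : (Fin d → F) → ℝ≥0∞) : AEMeasurable E.symm
      (((Measure.pi fun _ : Fin d => μ).restrict E.target).withDensity g) :=
  (E.continuousOn_symm.aemeasurable E.open_target.measurableSet).mono_ac
    (withDensity_absolutelyContinuous _ _)

theorem measurableSet_target_inter (E : OpenPartialHomeomorph X (Fin d → F)) {S : Set X}
    (hS : MeasurableSet S) : MeasurableSet (E.target ∩ E.symm ⁻¹' S) := by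
  have h : Measurable (E.target.domRestrict E.symm) :=
    (continuousOn_iff_continuous_domRestrict.1 E.continuousOn_symm).measurable
  have := E.open_target.measurableSet.subtype_image (h hS)
  convert this using 1
  ext y
  simp [Set.domRestrict, and_comm]

omit [μ.IsAddHaarMeasure] in
theorem chartMeasure_apply (E : OpenPartialHomeomorph X (Fin d → F)) (ρ : X → ℝ) {S : Set X}
    (hS : MeasurableSet S) : chartMeasure μ E ρ S =
      ∫⁻ y in E.target ∩ E.symm ⁻¹' S, ENNReal.ofReal (ρ (E.symm y)) ∂Measure.pi fun _ => μ := by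
  have h := measurableSet_target_inter E hS
  obtain ⟨f, hf⟩ := aemeasurable_symm (μ := μ) E fun y => ENNReal.ofReal (ρ (E.symm y))
  rw [chartMeasure, Measure.map_apply_of_aemeasurable (aemeasurable_symm E _) hS]
  have h1 : ((Measure.pi fun _ : Fin d => μ).restrict E.target).withDensity
      (fun y => ENNReal.ofReal (ρ (E.symm y))) (E.symm ⁻¹' S) =
    ((Measure.pi fun _ : Fin d => μ).restrict E.target).withDensity
      (fun y => ENNReal.ofReal (ρ (E.symm y))) (E.target ∩ E.symm ⁻¹' S) := by
    refine measure_congr ?_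
    have : ∀ᵐ y ∂((Measure.pi fun _ : Fin d => μ).restrict E.target).withDensity
        (fun y => ENNReal.ofReal (ρ (E.symm y))), y ∈ E.target :=
      (withDensity_absolutelyContinuous _ _).ae_le
        (ae_restrict_mem E.open_target.measurableSet)
    filter_upwards [this] with y hy
    exact propext ⟨fun h => ⟨hy, h⟩, fun h => h.2⟩
  rw [h1, withDensity_apply _ h, Measure.restrict_restrict h, inter_assoc, inter_comm _ E.target,
    ← inter_assoc, inter_self]

omit [μ.IsAddHaarMeasure] in
theorem chartMeasure_restrict_source (E : OpenPartialHomeomorph X (Fin d → F)) (ρ : X → ℝ) :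
    (chartMeasure μ E ρ).restrict E.source = chartMeasure μ E ρ := by
  refine Measure.restrict_eq_self_of_ae_mem ?_
  rw [ae_iff, show {x | x ∉ E.source} = E.sourceᶜ from rfl, chartMeasure_apply E ρ
    E.open_source.measurableSet.compl]
  have : E.target ∩ E.symm ⁻¹' E.sourceᶜ = ∅ := by
    ext y
    simp only [mem_inter_iff, mem_preimage, mem_compl_iff, mem_empty_iff_false, iff_false,
      not_and, not_not]
    exact fun hy => E.map_target hy
  rw [this]; simp

omit [μ.IsAddHaarMeasure] in
theorem lintegral_chartMeasure (E : OpenPartialHomeomorph X (Fin d → F)) {ρ : X → ℝ}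
    (hρ : ContinuousOn ρ E.source) {g : X → ℝ≥0∞} (hg : ContinuousOn g E.source) :
    ∫⁻ x, g x ∂chartMeasure μ E ρ =
      ∫⁻ y in E.target, ENNReal.ofReal (ρ (E.symm y)) * g (E.symm y) ∂Measure.pi fun _ => μ := by
  have hsupp := chartMeasure_restrict_source (μ := μ) E ρ
  have hga : AEMeasurable g (chartMeasure μ E ρ) := by
    rw [← hsupp]; exact hg.aemeasurable E.open_source.measurableSet
  have hρa : AEMeasurable (fun y => ENNReal.ofReal (ρ (E.symm y)))
      ((Measure.pi fun _ : Fin d => μ).restrict E.target) := by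
    refine AEMeasurable.ennreal_ofReal (ContinuousOn.aemeasurable ?_ E.open_target.measurableSet)
    exact hρ.comp E.continuousOn_symm fun y hy => E.map_target hy
  have hgs : AEMeasurable (fun y => g (E.symm y))
      ((Measure.pi fun _ : Fin d => μ).restrict E.target) :=
    ContinuousOn.aemeasurable (hg.comp E.continuousOn_symm fun y hy => E.map_target hy)
      E.open_target.measurableSet
  rw [chartMeasure, lintegral_map' hga (aemeasurable_symm E _),
    lintegral_withDensity_eq_lintegral_mul₀ hρa hgs]
  rfl

/-- Two measures given by densities in two charts are comparable, up to a constant that only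
depends on the measure `μ` and the dimension, on the intersection of the domains, if the densities
correspond to each other under the change of coordinates. Near a given point, the change of
coordinates differs by a linear map from a map close to the identity. -/
theorem HasHaarScaling.exists_chartMeasure_le (hμ : HasHaarScaling m μ) (d : ℕ) :
    ∃ C : ℝ≥0∞, C ≠ 0 ∧ C ≠ ∞ ∧ ∀ {X : Type u} [TopologicalSpace X] [SecondCountableTopology X]
      [MeasurableSpace X] [BorelSpace X] (E E' : OpenPartialHomeomorph X (Fin d → F))
      (ρ ρ' : X → ℝ), ContinuousOn ρ E.source → ContinuousOn ρ' E'.source →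
      (∀ x ∈ E.source, 0 < ρ x) →
      (∀ x ∈ E.source ∩ E'.source, ∃ A : (Fin d → F) →L[F] (Fin d → F),
        HasStrictFDerivAt (fun y => E (E'.symm y)) A (E' x) ∧ LinearMap.det A.toLinearMap ≠ 0 ∧
          ρ' x = ρ x * ‖LinearMap.det A.toLinearMap‖ ^ m) →
      ∀ S ⊆ E.source ∩ E'.source, MeasurableSet S →
        chartMeasure μ E ρ S ≤ C * chartMeasure μ E' ρ' S := by
  obtain ⟨C, hC0, hC1, hC⟩ := hμ.exists_lipschitz_bound d
  -- near a point, each of the two densities varies by a factor of at most `2`, whence the `4`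
  refine ⟨4 * C, mul_ne_zero (by norm_num) hC0, ENNReal.mul_ne_top (by norm_num) hC1, ?_⟩
  intro X _ _ _ _ E E' ρ ρ' hρ hρ' hpos hA S hSU hS
  refine measure_le_of_locally_le (ν₂ := (4 * C) • chartMeasure μ E' ρ') (fun x hx => ?_) hSU hS
  obtain ⟨A, hAd, hdet, hρA⟩ := hA x hx
  set δ := LinearMap.det A.toLinearMap
  let e := LinearEquiv.ofIsUnitDet (f := A.toLinearMap) (v := Pi.basisFun F (Fin d))
    (v' := Pi.basisFun F (Fin d)) (by rw [LinearMap.det_toMatrix]; exact hdet.isUnit)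
  let B : (Fin d → F) →L[F] (Fin d → F) := e.symm.toContinuousLinearEquiv
  have hAB (y : Fin d → F) : A (B y) = y := e.apply_symm_apply y
  have hBA : B.comp A = ContinuousLinearMap.id F _ := by
    ext1 y; exact e.symm_apply_apply y
  -- `A⁻¹ ∘ E ∘ E'⁻¹` has the identity as derivative, so it is `2`-Lipschitz near `E' x`
  have hf : HasStrictFDerivAt (fun y => B (E (E'.symm y))) (ContinuousLinearMap.id F _) (E' x) := by
    rw [← hBA]; exact B.hasStrictFDerivAt.comp (E' x) hAd
  obtain ⟨T, hT, hLip⟩ := hf.exists_lipschitzOnWith_of_nnnorm_lt 2 (by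
    refine lt_of_le_of_lt (b := (1 : ℝ≥0)) ?_ (by norm_num)
    exact_mod_cast ContinuousLinearMap.norm_id_le)
  have hρ0 := hpos x hx.1
  have hρ'0 : 0 < ρ' x := by rw [hρA]; have := norm_pos_iff.2 hdet; positivity
  have hN1 : ∀ᶠ z in 𝓝 x, ρ z < 2 * ρ x :=
    (hρ.continuousAt (E.open_source.mem_nhds hx.1)).eventually_lt_const (by linarith)
  have hN2 : ∀ᶠ z in 𝓝 x, ρ' x / 2 < ρ' z :=
    (hρ'.continuousAt (E'.open_source.mem_nhds hx.2)).eventually_const_lt (by linarith)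
  have hN3 : ∀ᶠ z in 𝓝 x, E' z ∈ T := (E'.continuousAt hx.2).eventually hT
  refine ⟨_, (hN1.and (hN2.and hN3)), fun S hSN hS hSU => ?_⟩
  have hSE : S ⊆ E.source := hSU.trans inter_subset_left
  have hSE' : S ⊆ E'.source := hSU.trans inter_subset_right
  have him : E.target ∩ E.symm ⁻¹' S = E '' S := (E.image_eq_target_inter_inv_preimage hSE).symm
  have him' : E'.target ∩ E'.symm ⁻¹' S = E' '' S :=
    (E'.image_eq_target_inter_inv_preimage hSE').symm
  have hms := measurableSet_target_inter E hS
  have hms' := measurableSet_target_inter E' hS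
  rw [him] at hms
  rw [him'] at hms'
  set vol := Measure.pi fun _ : Fin d => μ with hvol
  have himA : E '' S = A '' ((fun y => B (E (E'.symm y))) '' (E' '' S)) := by
    rw [image_image, image_image]
    refine image_congr fun z hz => ?_
    rw [hAB, E'.left_inv (hSE' hz)]
  have h1 : vol (E '' S) ≤ ‖δ‖ₑ ^ m * (C * vol (E' '' S)) := by
    have h2 := hμ.measure_image A.toLinearMap hdet ((fun y => B (E (E'.symm y))) '' (E' '' S))
    rw [himA]
    refine h2.le.trans ?_
    gcongr
    refine hC _ _ (hLip.mono ?_)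
    rintro _ ⟨z, hz, rfl⟩
    exact (hSN hz).2.2
  have h3 : chartMeasure μ E ρ S ≤ ENNReal.ofReal (2 * ρ x) * vol (E '' S) := by
    rw [chartMeasure_apply E ρ hS, him, ← setLIntegral_const]
    refine setLIntegral_mono' hms ?_
    rintro _ ⟨z, hz, rfl⟩
    rw [E.left_inv (hSE hz)]
    exact ENNReal.ofReal_le_ofReal (hSN hz).1.le
  have h4 : ENNReal.ofReal (ρ' x / 2) * vol (E' '' S) ≤ chartMeasure μ E' ρ' S := by
    rw [chartMeasure_apply E' ρ' hS, him', ← setLIntegral_const]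
    refine setLIntegral_mono' hms' ?_
    rintro _ ⟨z, hz, rfl⟩
    rw [E'.left_inv (hSE' hz)]
    exact ENNReal.ofReal_le_ofReal (hSN hz).2.1.le
  have h5 : ENNReal.ofReal (2 * ρ x) * ‖δ‖ₑ ^ m = 4 * ENNReal.ofReal (ρ' x / 2) := by
    rw [← ofReal_norm, ← ENNReal.ofReal_pow (norm_nonneg _), ← ENNReal.ofReal_mul (by positivity),
      show (4 : ℝ≥0∞) = ENNReal.ofReal 4 by simp, ← ENNReal.ofReal_mul (by norm_num), hρA]
    congr 1; ring
  calc chartMeasure μ E ρ S ≤ ENNReal.ofReal (2 * ρ x) * (‖δ‖ₑ ^ m * (C * vol (E' '' S))) :=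
        h3.trans (by gcongr)
    _ = (ENNReal.ofReal (2 * ρ x) * ‖δ‖ₑ ^ m) * C * vol (E' '' S) := by ring
    _ = 4 * C * (ENNReal.ofReal (ρ' x / 2) * vol (E' '' S)) := by rw [h5]; ring
    _ ≤ 4 * C * chartMeasure μ E' ρ' S := by gcongr
    _ = ((4 * C) • chartMeasure μ E' ρ') S := by simp

end Comparison

/-! ### Integrals of monomials over boxes -/

section Monomials

open _root_.Metric Set Filter Topology ENNReal Pointwise NNReal

theorem lintegral_pi_prod {d : ℕ} {α : Type*} [MeasurableSpace α] (μ : Fin d → Measure α)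
    [∀ i, SigmaFinite (μ i)] (f : Fin d → α → ℝ≥0∞) (hf : ∀ i, Measurable (f i)) :
    ∫⁻ y, ∏ i, f i (y i) ∂Measure.pi μ = ∏ i, ∫⁻ t, f i t ∂μ i := by
  induction d with
  | zero => simp
  | succ n ih =>
    have h := (measurePreserving_piFinSuccAbove (fun i => μ i) 0).symm
    rw [← h.lintegral_comp_emb (MeasurableEquiv.measurableEmbedding _)]
    simp only [MeasurableEquiv.piFinSuccAbove_symm_apply, Fin.prod_univ_succ, Fin.insertNthEquiv,
      Equiv.coe_fn_mk, Fin.insertNth_zero, Fin.cons_zero, Fin.cons_succ]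
    have h1 : Measurable fun y : Fin n → α => ∏ i, f i.succ (y i) :=
      Finset.measurable_fun_prod _ fun i _ => (hf i.succ).comp (measurable_pi_apply i)
    refine (lintegral_prod_mul (μ := μ 0) (ν := Measure.pi fun j : Fin n => μ (Fin.succAbove 0 j))
      (f := f 0) (g := fun y : Fin n → α => ∏ i, f i.succ (y i))
      (hf 0).aemeasurable h1.aemeasurable).trans ?_
    congr 1
    exact ih (fun i => μ i.succ) (fun i => f i.succ) (fun i => hf i.succ)

variable {F : Type*} [NontriviallyNormedField F] [ProperSpace F] [MeasurableSpace F]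
  [BorelSpace F] {μ : Measure F} [μ.IsAddHaarMeasure] {m : ℕ}

omit [μ.IsAddHaarMeasure] in
theorem HasHaarScaling.setLIntegral_smul (hμ : HasHaarScaling m μ) {c : F} (hc : c ≠ 0)
    {A : Set F} (hA : MeasurableSet A) {f : F → ℝ≥0∞} (hf : Measurable f) :
    ∫⁻ t in c • A, f t ∂μ = ‖c‖ₑ ^ m * ∫⁻ t in A, f (c * t) ∂μ := by
  have hmap : μ = ‖c‖ₑ ^ m • μ.map (c * ·) := by
    ext s hs
    rw [Measure.smul_apply, Measure.map_apply (by fun_prop) hs, hμ.preimage_mul_left hc,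
      smul_eq_mul, ← mul_assoc, ENNReal.mul_inv_cancel (pow_ne_zero _ (enorm_ne_zero.2 hc))
      (by simp), one_mul]
  have hpre : (c * ·) ⁻¹' (c • A) = A := by
    have : (c * ·) ⁻¹' (c • A) = c⁻¹ • (c • A) := by
      rw [← preimage_smul₀ hc]; rfl
    rw [this, inv_smul_smul₀ hc]
  have hcA : MeasurableSet (c • A) := hA.const_smul₀ c
  conv_lhs => rw [hmap]
  rw [Measure.restrict_smul, lintegral_smul_measure, smul_eq_mul,
    setLIntegral_map hcA hf (by fun_prop), hpre]

/-- The integral of `|t|^s` over a punctured ball: the annuli `c^n A` contribute a geometric series,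
of ratio `|c|^(m + s)`. -/
theorem HasHaarScaling.lintegral_norm_rpow_lt_top_iff (hμ : HasHaarScaling m μ) (hm : m ≠ 0)
    {ε : ℝ} (hε : 0 < ε) (s : ℝ) :
    ∫⁻ t in ball (0 : F) ε \ {0}, ENNReal.ofReal (‖t‖ ^ s) ∂μ < ∞ ↔ -(m : ℝ) < s := by
  obtain ⟨c, hc0, hc1⟩ := NormedField.exists_norm_lt_one F
  have hcne : c ≠ 0 := norm_pos_iff.1 hc0
  set q := ‖c‖ with hq
  let f : F → ℝ≥0∞ := fun t => ENNReal.ofReal (‖t‖ ^ s)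
  have hf : Measurable f := by fun_prop
  let A : Set F := ball 0 ε \ ball 0 (q * ε)
  have hA : MeasurableSet A := isOpen_ball.measurableSet.diff isOpen_ball.measurableSet
  have hmem (n : ℕ) (t : F) : t ∈ c ^ n • A ↔ q ^ (n + 1) * ε ≤ ‖t‖ ∧ ‖t‖ < q ^ n * ε := by
    have hqn : 0 < q ^ n := pow_pos hc0 n
    rw [mem_smul_set_iff_inv_smul_mem₀ (pow_ne_zero n hcne)]
    simp only [A, Set.mem_sdiff, mem_ball_zero_iff, smul_eq_mul, norm_mul, norm_inv, norm_pow, ← hq,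
      not_lt]
    rw [inv_mul_lt_iff₀ hqn, le_inv_mul_iff₀ hqn, and_comm, pow_succ, mul_assoc]
  have hun : ball (0 : F) ε \ {0} = ⋃ n : ℕ, c ^ n • A := by
    ext t
    simp only [mem_iUnion, hmem, Set.mem_sdiff, mem_ball_zero_iff, mem_singleton_iff]
    constructor
    · rintro ⟨h1, h2⟩
      have hex : ∃ n : ℕ, q ^ (n + 1) * ε ≤ ‖t‖ := by
        obtain ⟨n, hn⟩ := exists_pow_lt_of_lt_one (div_pos (norm_pos_iff.2 h2) hε) hc1
        refine ⟨n, ?_⟩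
        rw [lt_div_iff₀ hε] at hn
        refine le_trans ?_ hn.le
        gcongr ?_ * ε
        exact pow_le_pow_of_le_one hc0.le hc1.le n.le_succ
      classical
      refine ⟨Nat.find hex, Nat.find_spec hex, ?_⟩
      rcases hk : Nat.find hex with _ | k
      · simpa using h1
      · exact not_le.1 (Nat.find_min hex (by omega))
    · rintro ⟨n, h1, h2⟩
      refine ⟨h2.trans_le (mul_le_of_le_one_left hε.le (pow_le_one₀ hc0.le hc1.le)), ?_⟩
      rintro rfl
      have : 0 < q ^ (n + 1) * ε := by positivity
      simp at h1; linarith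
  have hdisj : Pairwise (Function.onFun Disjoint fun n : ℕ => c ^ n • A) := by
    refine (pairwise_disjoint_on _).2 fun i j hij => ?_
    refine Set.disjoint_left.2 fun t ht ht' => ?_
    rw [hmem] at ht ht'
    have : q ^ j ≤ q ^ (i + 1) := pow_le_pow_of_le_one hc0.le hc1.le hij
    nlinarith [ht.1, ht'.2]
  have hstep (n : ℕ) : ∫⁻ t in c ^ n • A, f t ∂μ =
      ENNReal.ofReal (q ^ ((m : ℝ) + s)) ^ n * ∫⁻ t in A, f t ∂μ := by
    rw [hμ.setLIntegral_smul (pow_ne_zero n hcne) hA hf]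
    have h1 (t : F) : f (c ^ n * t) = ENNReal.ofReal ((q ^ n) ^ s) * f t := by
      simp only [f]
      rw [norm_mul, norm_pow, Real.mul_rpow (by positivity) (norm_nonneg _),
        ENNReal.ofReal_mul (by positivity)]
    simp only [h1]
    rw [lintegral_const_mul _ hf, ← mul_assoc]
    congr 1
    rw [← ofReal_norm, norm_pow, ← hq, ← ENNReal.ofReal_pow (by positivity),
      ← ENNReal.ofReal_mul (by positivity), ← ENNReal.ofReal_pow (by positivity)]
    congr 1
    rw [← Real.rpow_natCast, ← Real.rpow_natCast, ← Real.rpow_natCast, ← Real.rpow_mul hc0.le,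
      ← Real.rpow_mul hc0.le, ← Real.rpow_mul hc0.le, ← Real.rpow_add hc0]
    congr 1; ring
  have hμB0 : μ (ball 0 ε) ≠ 0 := (measure_ball_pos _ _ hε).ne'
  have hμB1 : μ (ball 0 ε) ≠ ∞ := measure_ball_lt_top.ne
  -- otherwise the ball and its multiple by `c` would have the same measure
  have hμA : μ A ≠ 0 := by
    intro h0
    have h1 : μ (ball 0 (q * ε)) = ‖c‖ₑ ^ m * μ (ball 0 ε) := by
      rw [← hμ c hcne, _root_.smul_ball hcne, smul_zero]
    have h2 : μ (ball 0 ε) ≤ ‖c‖ₑ ^ m * μ (ball 0 ε) := by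
      have := le_measure_sdiff (μ := μ) (s₁ := ball 0 ε) (s₂ := ball (0 : F) (q * ε))
      rw [show ball (0 : F) ε \ ball 0 (q * ε) = A from rfl, h0] at this
      rw [← h1]
      exact tsub_eq_zero_iff_le.1 (le_antisymm this bot_le)
    have h3 : ‖c‖ₑ ^ m < 1 := pow_lt_one₀ (by simp) (by
      rw [← ofReal_norm]; exact ENNReal.ofReal_lt_one.2 hc1) hm
    have h4 : ‖c‖ₑ ^ m * μ (ball 0 ε) < 1 * μ (ball 0 ε) :=
      (ENNReal.mul_lt_mul_iff_left hμB0 hμB1).2 h3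
    rw [one_mul] at h4
    exact absurd h2 (not_le.2 h4)
  have hI0 : ∫⁻ t in A, f t ∂μ ≠ 0 := by
    refine (setLIntegral_pos_iff hf).2 ?_ |>.ne'
    have : Function.support f ∩ A = A := by
      refine inter_eq_right.2 fun t ht => ?_
      have h1 : 0 < ‖t‖ := by
        have := ht.2
        simp only [mem_ball_zero_iff, not_lt] at this
        exact (by positivity : 0 < q * ε).trans_le this
      have h2 : 0 < ‖t‖ ^ s := by positivity
      simpa [f] using h2
    rw [this]
    exact pos_iff_ne_zero.2 hμA
  have hI1 : ∫⁻ t in A, f t ∂μ ≠ ∞ := by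
    refine ((setLIntegral_mono' hA (g := fun _ => ENNReal.ofReal (max (ε ^ s) ((q * ε) ^ s)))
      fun t ht => ?_).trans_lt ?_).ne
    · refine ENNReal.ofReal_le_ofReal ?_
      have h1 : ‖t‖ < ε := by simpa using ht.1
      have h2 : q * ε ≤ ‖t‖ := by simpa using ht.2
      have h3 : 0 < q * ε := by positivity
      rcases le_total 0 s with hs | hs
      · exact le_max_of_le_left (Real.rpow_le_rpow (norm_nonneg _) h1.le hs)
      · exact le_max_of_le_right (Real.rpow_le_rpow_of_nonpos h3 h2 hs)
    · rw [setLIntegral_const]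
      exact ENNReal.mul_lt_top ENNReal.ofReal_lt_top
        ((measure_mono sdiff_subset).trans_lt hμB1.lt_top)
  have htot : ∫⁻ t in ball (0 : F) ε \ {0}, f t ∂μ =
      (1 - ENNReal.ofReal (q ^ ((m : ℝ) + s)))⁻¹ * ∫⁻ t in A, f t ∂μ := by
    rw [hun, lintegral_iUnion (fun n => hA.const_smul₀ _) hdisj]
    simp only [hstep]
    rw [ENNReal.tsum_mul_right, ENNReal.tsum_geometric]
  change ∫⁻ t in ball (0 : F) ε \ {0}, f t ∂μ < ∞ ↔ _
  rw [htot]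
  have h1 : (1 - ENNReal.ofReal (q ^ ((m : ℝ) + s)))⁻¹ * ∫⁻ t in A, f t ∂μ < ∞ ↔
      q ^ ((m : ℝ) + s) < 1 := by
    rw [ENNReal.mul_lt_top_iff]
    have : ¬ (1 - ENNReal.ofReal (q ^ ((m : ℝ) + s)))⁻¹ = 0 := by
      simp
    simp [hI0, hI1.lt_top, this]
  rw [h1]
  constructor
  · intro h
    by_contra! h2
    exact absurd (Real.one_le_rpow_of_pos_of_le_one_of_nonpos hc0 hc1.le
      (by linarith : (m : ℝ) + s ≤ 0)) (not_le.2 h)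
  · intro h
    exact Real.rpow_lt_one hc0.le hc1 (by linarith)

omit [ProperSpace F] in
theorem HasHaarScaling.lintegral_norm_rpow_ne_zero (hμ : HasHaarScaling m μ) (hm : m ≠ 0)
    {ε : ℝ} (hε : 0 < ε) (s : ℝ) :
    ∫⁻ t in ball (0 : F) ε \ {0}, ENNReal.ofReal (‖t‖ ^ s) ∂μ ≠ 0 := by
  have hμ0 : μ {(0 : F)} = 0 := by
    obtain ⟨c, hc0, hc1⟩ := NormedField.exists_norm_lt_one F
    have h1 := hμ c (norm_pos_iff.1 hc0) {0}
    have h2 : c • ({0} : Set F) = {0} := by simp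
    rw [h2] at h1
    by_contra h0
    have hf : μ {(0 : F)} ≠ ∞ := isCompact_singleton.measure_ne_top
    have h3 : ‖c‖ₑ ^ m < 1 := pow_lt_one₀ (by simp) (by
      rw [← ofReal_norm]; exact ENNReal.ofReal_lt_one.2 hc1) hm
    have h4 := (ENNReal.mul_lt_mul_iff_left h0 hf).2 h3
    rw [← h1, one_mul] at h4
    exact lt_irrefl _ h4
  refine (setLIntegral_pos_iff (by fun_prop)).2 ?_ |>.ne'
  have : Function.support (fun t : F => ENNReal.ofReal (‖t‖ ^ s)) ∩ (ball 0 ε \ {0}) =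
      ball 0 ε \ {0} := by
    refine inter_eq_right.2 fun t ht => ?_
    have h1 : 0 < ‖t‖ := norm_pos_iff.2 ht.2
    have h2 : 0 < ‖t‖ ^ s := by positivity
    simpa using h2
  rw [this, measure_sdiff_null hμ0]
  exact measure_ball_pos _ _ hε

theorem prod_lt_top_iff {ι : Type*} {t : Finset ι} {a : ι → ℝ≥0∞} (ha : ∀ i ∈ t, a i ≠ 0) :
    ∏ i ∈ t, a i < ∞ ↔ ∀ i ∈ t, a i < ∞ := by
  classical
  refine ⟨fun h i hi => ?_, ENNReal.prod_lt_top⟩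
  rw [← Finset.mul_prod_erase t a hi] at h
  by_contra htop
  rw [not_lt, top_le_iff] at htop
  rw [htop, ENNReal.top_mul] at h
  · exact lt_irrefl _ h
  · exact Finset.prod_ne_zero_iff.2 fun j hj => ha j (Finset.mem_of_mem_erase hj)

/-- The integral of a monomial `∏ |y_i|^{s_i}` over a box, outside of the coordinate hyperplanes
concerned. -/
theorem HasHaarScaling.lintegral_monomial_lt_top_iff (hμ : HasHaarScaling m μ) (hm : m ≠ 0)
    {d : ℕ} {J : Finset (Fin d)} {y₀ : Fin d → F} (hy₀ : ∀ i ∈ J, y₀ i = 0) (s : Fin d → ℝ)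
    {ε : ℝ} (hε : 0 < ε) :
    ∫⁻ y in {y | y ∈ ball y₀ ε ∧ ∀ i ∈ J, y i ≠ 0}, ∏ i ∈ J, ENNReal.ofReal (‖y i‖ ^ s i)
      ∂Measure.pi (fun _ => μ) < ∞ ↔ ∀ i ∈ J, -(m : ℝ) < s i := by
  classical
  let T : Fin d → Set F := fun i => if i ∈ J then ball 0 ε \ {0} else ball (y₀ i) ε
  let f : Fin d → F → ℝ≥0∞ := fun i t => if i ∈ J then ENNReal.ofReal (‖t‖ ^ s i) else 1
  have hT : {y | y ∈ ball y₀ ε ∧ ∀ i ∈ J, y i ≠ 0} = univ.pi T := by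
    ext y
    simp only [ball_pi y₀ hε, Set.mem_pi, mem_univ, true_implies, mem_ofPred_eq, T]
    constructor
    · rintro ⟨h1, h2⟩ i
      split_ifs with hi
      · exact ⟨hy₀ i hi ▸ h1 i, h2 i hi⟩
      · exact h1 i
    · intro h
      refine ⟨fun i => ?_, fun i hi => ?_⟩
      · have := h i
        split_ifs at this with hi
        · rw [hy₀ i hi]; exact this.1
        · exact this
      · have := h i
        rw [if_pos hi] at this
        exact this.2
  have hf (i : Fin d) : Measurable (f i) := by
    by_cases hi : i ∈ J
    · simp only [f, hi, if_true]; fun_prop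
    · simp only [f, hi, if_false]; fun_prop
  have hfp (y : Fin d → F) : ∏ i ∈ J, ENNReal.ofReal (‖y i‖ ^ s i) = ∏ i, f i (y i) := by
    simp only [f]
    rw [Finset.prod_ite_mem, Finset.univ_inter]
  simp only [hfp]
  rw [hT, Measure.restrict_pi_pi (fun _ => μ) T, lintegral_pi_prod _ f hf, prod_lt_top_iff]
  · constructor
    · intro h i hi
      have := h i (Finset.mem_univ i)
      simp only [f, T, hi, if_true] at this
      exact (hμ.lintegral_norm_rpow_lt_top_iff hm hε _).1 this
    · intro h i _
      by_cases hi : i ∈ J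
      · simp only [f, T, hi, if_true]
        exact (hμ.lintegral_norm_rpow_lt_top_iff hm hε _).2 (h i hi)
      · simp only [f, T, hi, if_false, lintegral_const, one_mul, Measure.restrict_apply_univ]
        exact measure_ball_lt_top
  · intro i _
    by_cases hi : i ∈ J
    · simp only [f, T, hi, if_true]
      exact hμ.lintegral_norm_rpow_ne_zero hm hε _
    · simp only [f, T, hi, if_false, lintegral_const, one_mul, Measure.restrict_apply_univ]
      exact (measure_ball_pos _ _ hε).ne'

end Monomials

/-! ### Regular systems of parameters -/

section Regular

open IsLocalRing

variable {R : Type*} [CommRing R] [IsLocalRing R]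

/-- Exchange: in a system of generators of `𝔪`, a generator `x_i` can be replaced by a combination
`y = ∑ a_j x_j` such that `a_i` is a unit. -/
theorem maximalIdeal_le_span_succAbove {n : ℕ} {x : Fin (n + 1) → R}
    (hx : Ideal.span (Set.range x) = maximalIdeal R) (i : Fin (n + 1)) {y : R} {a : Fin (n + 1) → R}
    (hy : y = ∑ j, a j * x j) (ha : IsUnit (a i)) :
    maximalIdeal R ≤ Ideal.span {y} ⊔ Ideal.span (Set.range fun j => x (i.succAbove j)) := by
  have hj (j : Fin n) : x (i.succAbove j) ∈
      Ideal.span {y} ⊔ Ideal.span (Set.range fun j => x (i.succAbove j)) :=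
    Ideal.mem_sup_right (Ideal.subset_span ⟨j, rfl⟩)
  rw [← hx, Ideal.span_le]
  rintro _ ⟨k, rfl⟩
  rcases Fin.eq_self_or_eq_succAbove i k with rfl | ⟨j, rfl⟩
  · rw [Fin.sum_univ_succAbove _ k] at hy
    obtain ⟨u, hu⟩ := ha
    have : x k = u⁻¹.1 * (y - ∑ j, a (k.succAbove j) * x (k.succAbove j)) := by
      rw [hy, ← hu]; simp
    rw [this]
    exact Ideal.mul_mem_left _ _ (Ideal.sub_mem _
      (Ideal.mem_sup_left (Ideal.mem_span_singleton_self y))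
      (Ideal.sum_mem _ fun j _ => Ideal.mul_mem_left _ _ (hj j)))
  · exact hj j

variable [IsNoetherianRing R]

theorem ringKrullDim_le_of_span_range {n : ℕ} {x : Fin n → R}
    (hx : Ideal.span (Set.range x) = maximalIdeal R) : ringKrullDim R ≤ n := by
  refine (ringKrullDim_le_spanFinrank_maximalIdeal R).trans ?_
  have h := Submodule.spanFinrank_span_le_ncard_of_finite (R := R) (Set.finite_range x)
  have h2 : (Set.range x).ncard ≤ n := by
    rw [← Set.image_univ]
    refine (Set.ncard_image_le Set.finite_univ).trans ?_
    simp
  rw [← hx]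
  exact_mod_cast h.trans h2

/-- The elements of a regular system of parameters are independent in `𝔪 / 𝔪²`. -/
theorem mem_maximalIdeal_of_sum_mem_sq {n : ℕ} {x : Fin n → R}
    (hdim : (n : WithBot ℕ∞) ≤ ringKrullDim R)
    (hx : Ideal.span (Set.range x) = maximalIdeal R) {a : Fin n → R}
    (ha : ∑ i, a i * x i ∈ maximalIdeal R ^ 2) (i : Fin n) : a i ∈ maximalIdeal R := by
  obtain _ | n := n
  · exact i.elim0
  by_contra hi
  have hu : IsUnit (a i) := by simpa using hi
  have h1 := maximalIdeal_le_span_succAbove hx i rfl hu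
  have h2 : Ideal.span (Set.range fun j => x (i.succAbove j)) = maximalIdeal R := by
    refine le_antisymm ?_ ?_
    · rw [← hx]
      exact Ideal.span_mono (Set.range_comp_subset_range i.succAbove x)
    · refine Submodule.le_of_le_smul_of_le_jacobson_bot (I := maximalIdeal R)
        (IsNoetherian.noetherian _) (IsLocalRing.jacobson_eq_maximalIdeal ⊥ bot_ne_top).ge ?_
      rw [smul_eq_mul, ← pow_two]
      refine h1.trans ?_
      rw [sup_comm]
      gcongr
      rwa [Ideal.span_singleton_le_iff_mem]
  have h3 := hdim.trans (ringKrullDim_le_of_span_range h2)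
  have h4 : n + 1 ≤ n := by exact_mod_cast h3
  omega

/-- The inductive step for the next statement: if `y = ∑ a_j x_j` with a unit among the `a_j`, then
`R / y` is a ring of the same kind, with one parameter less. -/
theorem isPrime_span_singleton_of_isUnit_coeff {R : Type u} [CommRing R] [IsLocalRing R]
    [IsNoetherianRing R] {n : ℕ}
    (IH : ∀ (S : Type u) [CommRing S] [IsLocalRing S] [IsNoetherianRing S] (x : Fin n → S),
      (n : WithBot ℕ∞) ≤ ringKrullDim S → Ideal.span (Set.range x) = maximalIdeal S → IsDomain S)
    {x : Fin (n + 1) → R} (hdim : ((n + 1 : ℕ) : WithBot ℕ∞) ≤ ringKrullDim R)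
    (hx : Ideal.span (Set.range x) = maximalIdeal R) (i : Fin (n + 1)) {y : R}
    (hym : y ∈ maximalIdeal R) {a : Fin (n + 1) → R}
    (hy : y = ∑ j, a j * x j) (ha : IsUnit (a i)) : (Ideal.span {y}).IsPrime := by
  rw [← Ideal.Quotient.isDomain_iff_prime]
  have hne : Ideal.span {y} ≠ ⊤ := by
    rw [Ne, Ideal.span_singleton_eq_top]; simpa using hym
  have : Nontrivial (R ⧸ Ideal.span {y}) := Ideal.Quotient.nontrivial_iff.2 hne
  have hsurj : Function.Surjective (Ideal.Quotient.mk (Ideal.span {y})) :=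
    Ideal.Quotient.mk_surjective
  have : IsLocalRing (R ⧸ Ideal.span {y}) := IsLocalRing.of_surjective' _ hsurj
  refine IH (R ⧸ Ideal.span {y}) (fun j => Ideal.Quotient.mk _ (x (i.succAbove j))) ?_ ?_
  · have h1 := ringKrullDim_le_ringKrullDim_quotient_add_card {y} (R := R) (by
      simpa [IsLocalRing.ringJacobson_eq_maximalIdeal] using hym)
    rw [Finset.card_singleton, Finset.coe_singleton] at h1
    have h2 := hdim.trans h1
    push_cast at h2
    by_contra! hlt
    have h3 := h2.trans (ENat.WithBot.add_one_le_natCast_iff.2 hlt)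
    have h4 : n + 1 ≤ n := by exact_mod_cast h3
    omega
  · have h1 : maximalIdeal (R ⧸ Ideal.span {y}) =
        (maximalIdeal R).map (Ideal.Quotient.mk (Ideal.span {y})) :=
      (IsLocalRing.map_maximalIdeal_of_surjective _ hsurj).symm
    rw [h1]
    refine le_antisymm ?_ ?_
    · rw [Ideal.span_le]
      rintro _ ⟨j, rfl⟩
      refine Ideal.mem_map_of_mem _ ?_
      rw [← hx]
      exact Ideal.subset_span ⟨_, rfl⟩
    · refine (Ideal.map_mono (maximalIdeal_le_span_succAbove hx i hy ha)).trans ?_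
      rw [Ideal.map_sup, Ideal.map_span, Ideal.map_span, sup_le_iff, ← Set.range_comp]
      refine ⟨?_, le_rfl⟩
      rw [Set.image_singleton, Ideal.span_singleton_le_iff_mem]
      simp

/-- A noetherian local ring whose maximal ideal is generated by `n` elements, where `n` is at most
the dimension of the ring, is a domain. The quotient by a suitable element `y` of `𝔪 \ 𝔪²` is a ring
of the same kind, hence `y` is prime; a minimal prime contained in `(y)` and not containing `y`
vanishes by Nakayama's lemma. -/
theorem isDomain_of_span_range_eq_maximalIdeal (n : ℕ) : ∀ (R : Type u) [CommRing R]
    [IsLocalRing R] [IsNoetherianRing R] (x : Fin n → R), (n : WithBot ℕ∞) ≤ ringKrullDim R →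
      Ideal.span (Set.range x) = maximalIdeal R → IsDomain R := by
  induction n with
  | zero =>
    intro R _ _ _ x _ hx
    have h : maximalIdeal R = ⊥ := by rw [← hx]; simp
    exact ((IsLocalRing.isField_iff_maximalIdeal_eq).2 h).isDomain
  | succ n IH =>
    intro R _ _ _ x hdim hx
    have hht : (maximalIdeal R).height ≠ 0 := by
      intro h0
      rw [← IsLocalRing.maximalIdeal_height_eq_ringKrullDim, h0] at hdim
      have : n + 1 ≤ 0 := by exact_mod_cast hdim
      omega
    have hnotmin : maximalIdeal R ∉ minimalPrimes R := by
      intro h; exact hht (Ideal.height_eq_zero_iff.2 h)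
    have hsq : ¬ maximalIdeal R ≤ maximalIdeal R ^ 2 := by
      intro h
      have hbot : maximalIdeal R = ⊥ := by
        refine Submodule.eq_bot_of_le_smul_of_le_jacobson_bot (maximalIdeal R) _
          (IsNoetherian.noetherian _) ?_ (IsLocalRing.jacobson_eq_maximalIdeal ⊥ bot_ne_top).ge
        rwa [smul_eq_mul, ← pow_two]
      exact hnotmin ⟨⟨inferInstance, bot_le⟩, fun q _ _ => hbot ▸ bot_le⟩
    -- prime avoidance, where the ideal `𝔪²` may be added to the minimal primes
    classical
    have hfin := minimalPrimes.finite_of_isNoetherianRing R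
    obtain ⟨y, hym, hy⟩ : ∃ y ∈ maximalIdeal R, y ∉ maximalIdeal R ^ 2 ∧
        ∀ P ∈ minimalPrimes R, y ∉ P := by
      by_contra! hcon
      have hsub : (maximalIdeal R : Set R) ⊆
          ⋃ I ∈ (↑(insert (maximalIdeal R ^ 2) hfin.toFinset) : Set (Ideal R)),
            (id I : Ideal R) := by
        intro y hy
        simp only [Finset.coe_insert, Set.Finite.coe_toFinset, Set.mem_iUnion, id]
        by_cases h : y ∈ maximalIdeal R ^ 2
        · exact ⟨_, Set.mem_insert _ _, h⟩
        · obtain ⟨P, hP, hyP⟩ := hcon y hy h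
          exact ⟨P, Set.mem_insert_of_mem _ hP, hyP⟩
      rw [Ideal.subset_union_prime (maximalIdeal R ^ 2) (maximalIdeal R ^ 2)] at hsub
      · obtain ⟨I, hI, hle⟩ := hsub
        rcases Finset.mem_insert.1 hI with rfl | hI
        · exact hsq hle
        · have hImin := hfin.mem_toFinset.1 hI
          have := hImin.1.1
          have : I = maximalIdeal R := le_antisymm (IsLocalRing.le_maximalIdeal this.ne_top) hle
          exact hnotmin (this ▸ hImin)
      · intro I hI h1 _
        rcases Finset.mem_insert.1 hI with rfl | hI
        · exact absurd rfl h1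
        · exact (hfin.mem_toFinset.1 hI).1.1
    obtain ⟨a, ha⟩ : ∃ a : Fin (n + 1) → R, ∑ j, a j * x j = y := by
      rw [← hx] at hym
      exact Ideal.mem_span_range_iff_exists_fun.1 hym
    have : ∃ i, IsUnit (a i) := by
      by_contra! hcon
      refine hy.1 (ha ▸ Ideal.sum_mem _ fun j _ => ?_)
      rw [pow_two]
      refine Ideal.mul_mem_mul (by simpa using hcon j) ?_
      rw [← hx]; exact Ideal.subset_span ⟨j, rfl⟩
    obtain ⟨i, hi⟩ := this
    have hprime := isPrime_span_singleton_of_isUnit_coeff IH hdim hx i hym ha.symm hi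
    obtain ⟨P, hP, hPy⟩ := Ideal.exists_minimalPrimes_le (bot_le : ⊥ ≤ Ideal.span {y})
    have hPp := hP.1.1
    have hPbot : P = ⊥ := by
      refine Submodule.eq_bot_of_le_smul_of_le_jacobson_bot (maximalIdeal R) _
        (IsNoetherian.noetherian _) ?_ (IsLocalRing.jacobson_eq_maximalIdeal ⊥ bot_ne_top).ge
      intro p hp
      obtain ⟨b, rfl⟩ := Ideal.mem_span_singleton'.1 (hPy hp)
      have hb : b ∈ P := (hPp.mem_or_mem hp).resolve_right (hy.2 P hP)
      rw [mul_comm, smul_eq_mul]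
      exact Ideal.mul_mem_mul hym hb
    rw [hPbot] at hPp
    exact IsDomain.of_bot_isPrime R

/-- The elements of a regular system of parameters are prime. -/
theorem prime_of_span_range_eq_maximalIdeal {R : Type u} [CommRing R] [IsLocalRing R]
    [IsNoetherianRing R] {n : ℕ} {x : Fin n → R} (hdim : (n : WithBot ℕ∞) ≤ ringKrullDim R)
    (hx : Ideal.span (Set.range x) = maximalIdeal R) (i : Fin n) : Prime (x i) := by
  have hxi : x i ≠ 0 := by
    intro h0
    have := mem_maximalIdeal_of_sum_mem_sq hdim hx (a := Pi.single i 1) (by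
      simp [Pi.single_apply, h0]) i
    simp at this
  rw [← Ideal.span_singleton_prime hxi]
  obtain _ | n := n
  · exact i.elim0
  refine isPrime_span_singleton_of_isUnit_coeff (isDomain_of_span_range_eq_maximalIdeal n)
    hdim hx i (y := x i) ?_ (a := Pi.single i 1) ?_ (by simp)
  · rw [← hx]; exact Ideal.subset_span ⟨i, rfl⟩
  · simp [Pi.single_apply]

/-- If a product of elements `g α`, none of which is in `𝔪²`, agrees up to a unit with a product
of distinct members of a regular system of parameters, then the `g α` that are not units are
themselves, up to units, distinct members of it; in particular they are independent
in `𝔪 / 𝔪²`. -/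
theorem mem_maximalIdeal_of_associated_prod {R : Type u} [CommRing R] [IsLocalRing R]
    [IsNoetherianRing R] {n : ℕ} {x : Fin n → R} (hdim : (n : WithBot ℕ∞) ≤ ringKrullDim R)
    (hx : Ideal.span (Set.range x) = maximalIdeal R) {ι : Type*} [Fintype ι] {g : ι → R}
    {r : Finset (Fin n)} (hgx : Associated (∏ α, g α) (∏ i ∈ r, x i))
    (hg2 : ∀ α, g α ∉ maximalIdeal R ^ 2) {c : ι → R} {A : Finset ι}
    (hA : ∀ α ∈ A, g α ∈ maximalIdeal R)
    (hc : ∑ α ∈ A, c α * g α ∈ maximalIdeal R ^ 2) : ∀ α ∈ A, c α ∈ maximalIdeal R := by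
  classical
  have hdom := isDomain_of_span_range_eq_maximalIdeal n R x hdim hx
  have hp := prime_of_span_range_eq_maximalIdeal hdim hx
  have hxm (i : Fin n) : x i ∈ maximalIdeal R := by rw [← hx]; exact Ideal.subset_span ⟨i, rfl⟩
  -- the prime `x i` divides some factor, and the cofactor is a unit as `g α ∉ 𝔪²`
  have h1 : ∀ i : r, ∃ α, ∃ u : Rˣ, g α = u * x i := by
    intro i
    have hdvd : x i ∣ ∏ α, g α := (Finset.dvd_prod_of_mem x i.2).trans hgx.symm.dvd
    obtain ⟨α, -, v, hv⟩ := (hp i).exists_mem_finset_dvd hdvd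
    have hunit : IsUnit v := by
      by_contra h
      refine hg2 α ?_
      rw [hv, pow_two]
      exact Ideal.mul_mem_mul (hxm i) (by simpa using h)
    obtain ⟨u, rfl⟩ := hunit
    exact ⟨α, u, by rw [hv, mul_comm]⟩
  choose a u hau using h1
  -- two parameters cannot be associated to the same factor, as they are independent
  have hinj : Function.Injective a := by
    intro i j hij
    by_contra hne
    have h2 : ∑ k, (Pi.single (i : Fin n) (u i : R) - Pi.single (j : Fin n) (u j : R) : Fin n → R) k
        * x k ∈ maximalIdeal R ^ 2 := by
      have : ∑ k, (Pi.single (i : Fin n) (u i : R) - Pi.single (j : Fin n) (u j : R) : Fin n → R) k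
          * x k = 0 := by
        simp [sub_mul, Finset.sum_sub_distrib, Pi.single_apply, ← hau, hij]
      rw [this]; exact Ideal.zero_mem _
    have h3 := mem_maximalIdeal_of_sum_mem_sq hdim hx h2 i
    have hne' : (i : Fin n) ≠ j := fun h => hne (Subtype.ext h)
    simp [hne'] at h3
  -- every other factor divides a unit, by cancellation of the product of the `x i`
  have hcov : ∀ α, α ∉ Set.range a → IsUnit (g α) := by
    intro α hα
    set B : Finset ι := Finset.univ.image a with hB
    have hprod : ∏ α ∈ B, g α = (∏ i, (u i : R)) * ∏ i ∈ r, x i := by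
      rw [hB, Finset.prod_image hinj.injOn]
      simp only [hau, Finset.prod_mul_distrib]
      rw [← Finset.prod_coe_sort r]
    have hr0 : ∏ i ∈ r, x i ≠ 0 := Finset.prod_ne_zero_iff.2 fun i _ => (hp i).ne_zero
    obtain ⟨w, hw⟩ := hgx
    rw [← Finset.prod_mul_prod_compl B g, hprod] at hw
    have hw' : ((∏ i, (u i : R)) * (∏ α ∈ Bᶜ, g α) * w) * ∏ i ∈ r, x i = 1 * ∏ i ∈ r, x i := by
      rw [one_mul]; conv_rhs => rw [← hw]
      ring
    have h4 := mul_right_cancel₀ hr0 hw'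
    have h5 : IsUnit (∏ α ∈ Bᶜ, g α) :=
      IsUnit.of_mul_eq_one ((∏ i, (u i : R)) * w) (by rw [← h4]; ring)
    refine isUnit_of_dvd_unit (Finset.dvd_prod_of_mem g ?_) h5
    simpa [hB] using hα
  have hAr : ∀ α ∈ A, α ∈ Set.range a := fun α hα => by
    by_contra h
    exact (mem_maximalIdeal _).1 (hA α hα) (hcov α h)
  let b : Fin n → R := fun i => if h : i ∈ r then (if a ⟨i, h⟩ ∈ A then c (a ⟨i, h⟩) * u ⟨i, h⟩
    else 0) else 0
  have hsum : ∑ i, b i * x i = ∑ α ∈ A, c α * g α := by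
    have h6 : ∑ i, b i * x i = ∑ i : r, if a i ∈ A then c (a i) * g (a i) else 0 := by
      rw [← Finset.sum_subset (Finset.subset_univ r), ← Finset.sum_coe_sort r]
      · refine Finset.sum_congr rfl fun i _ => ?_
        simp only [b, i.2, dif_pos, Subtype.coe_eta]
        split_ifs <;> simp [hau, mul_assoc]
      · intro i _ hi
        simp [b, hi]
    rw [h6, ← Finset.sum_filter]
    refine Finset.sum_bij (fun i _ => a i) ?_ (fun i _ j _ h => hinj h) ?_ (fun _ _ => rfl)
    · intro i hi; exact (Finset.mem_filter.1 hi).2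
    · intro α hα
      obtain ⟨i, rfl⟩ := hAr α hα
      exact ⟨i, by simpa using hα, rfl⟩
  intro α hα
  obtain ⟨i, rfl⟩ := hAr α hα
  have h7 := mem_maximalIdeal_of_sum_mem_sq hdim hx (hsum ▸ hc) i
  simp only [b, i.2, dif_pos, Subtype.coe_eta, hα, if_true] at h7
  exact ((inferInstance : (maximalIdeal R).IsPrime).mem_or_mem h7).resolve_right (by simp)

end Regular

/-! ### Tangent vectors at rational points -/

section Tangent

variable {F : Type u} [Field F] {A : Type u} [CommRing A] [Algebra F A]

/-- A tangent vector at the rational point `e` of `Spec A`, as a point derivation. -/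
def IsTangent (e : A →ₐ[F] F) (D : A →ₗ[F] F) : Prop :=
  ∀ a b, D (a * b) = e a * D b + e b * D a

theorem IsTangent.map_one {e : A →ₐ[F] F} {D : A →ₗ[F] F} (hD : IsTangent e D) : D 1 = 0 := by
  have := hD 1 1
  simpa using this

theorem exists_dual_family {V : Type*} [AddCommGroup V] [Module F V] {κ : Type*} {v : κ → V}
    (hv : LinearIndependent F v) [DecidableEq κ] :
    ∃ φ : κ → V →ₗ[F] F, ∀ i j, φ i (v j) = if i = j then 1 else 0 := by
  obtain ⟨g, hg⟩ := (Finsupp.linearCombination F v).exists_leftInverse_of_injective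
    (LinearMap.ker_eq_bot.2 hv)
  refine ⟨fun i => Finsupp.lapply i ∘ₗ g, fun i j => ?_⟩
  have h := LinearMap.congr_fun hg (Finsupp.single j 1)
  simp only [LinearMap.comp_apply, Finsupp.linearCombination_single, one_smul,
    LinearMap.id_apply] at h
  simp [h, Finsupp.single_apply, eq_comm]

/-- Functions vanishing at the point `e` that are independent modulo the square of its ideal
admit a dual family of tangent vectors. -/
theorem exists_isTangent_dual (e : A →ₐ[F] F) {ι : Type*} [Fintype ι] [DecidableEq ι] {f : ι → A}
    (hf : ∀ α, e (f α) = 0)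
    (hind : ∀ c : ι → F, ∑ α, c α • f α ∈ RingHom.ker e ^ 2 → c = 0) :
    ∃ D : ι → A →ₗ[F] F, (∀ α, IsTangent e (D α)) ∧ ∀ α β, D α (f β) = if α = β then 1 else 0 := by
  let q : A →ₐ[F] A ⧸ (RingHom.ker e ^ 2) := Ideal.Quotient.mkₐ F _
  have hq (a : A) : q a = 0 ↔ a ∈ RingHom.ker e ^ 2 := Ideal.Quotient.eq_zero_iff_mem
  let v : Option ι → A ⧸ (RingHom.ker e ^ 2) := fun o => o.elim (q 1) fun α => q (f α)
  have hv : LinearIndependent F v := by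
    rw [Fintype.linearIndependent_iff]
    intro c hc
    rw [Fintype.sum_option] at hc
    simp only [v, Option.elim, ← map_smul, ← map_sum, ← map_add, hq] at hc
    have h0 : c none = 0 := by
      have := Ideal.pow_le_self two_ne_zero hc
      simpa [RingHom.mem_ker, hf] using this
    rw [h0, zero_smul, zero_add] at hc
    have := hind _ hc
    rintro (_ | α)
    · exact h0
    · exact congr_fun this α
  obtain ⟨φ, hφ⟩ := exists_dual_family hv
  refine ⟨fun α => φ (some α) ∘ₗ q.toLinearMap, fun α a b => ?_, fun α β => ?_⟩
  · have h1 : φ (some α) (q 1) = 0 := by simpa [v] using hφ (some α) none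
    have h2 : q ((a - algebraMap F A (e a)) * (b - algebraMap F A (e b))) = 0 := by
      rw [hq, pow_two]
      exact Ideal.mul_mem_mul (by simp) (by simp)
    have h3 : (a - algebraMap F A (e a)) * (b - algebraMap F A (e b)) =
        a * b - e a • b - e b • a + (e a * e b) • (1 : A) := by
      simp only [Algebra.smul_def, map_mul]; ring
    rw [h3] at h2
    have h4 := congr_arg (φ (some α)) h2
    simp only [map_add, map_sub, map_smul, h1, map_zero, smul_zero, add_zero] at h4
    simp only [LinearMap.comp_apply, AlgHom.toLinearMap_apply]
    linear_combination h4
  · simpa [v] using hφ (some α) (some β)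

/-- If the hypersurface `f = 0` is smooth, but `f` vanishes to order two at the rational point `e`,
then `f` vanishes in a neighbourhood of `e`: a section of `A/f² → A/f` provides a derivation
`A → fA/f²A` mapping `f` to its class. -/
theorem exists_mul_eq_zero_of_mem_ker_sq (e : A →ₐ[F] F) (f : A)
    [Algebra.FormallySmooth F (A ⧸ Ideal.span {f})] (hf : f ∈ RingHom.ker e ^ 2) :
    ∃ a, e a = 1 ∧ a * f = 0 := by
  have hfe : f ∈ RingHom.ker e := Ideal.pow_le_self two_ne_zero hf
  have hle : Ideal.span {f ^ 2} ≤ Ideal.span {f} := by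
    rw [Ideal.span_singleton_le_span_singleton]; exact dvd_pow_self f two_ne_zero
  let mk : A →ₐ[F] A ⧸ Ideal.span {f ^ 2} := Ideal.Quotient.mkₐ F _
  let g : (A ⧸ Ideal.span {f ^ 2}) →ₐ[F] A ⧸ Ideal.span {f} := Ideal.Quotient.factorₐ F hle
  have hmk : Function.Surjective mk := Ideal.Quotient.mk_surjective
  have hg : Function.Surjective g := Ideal.Quotient.factor_surjective hle
  have hgmk (a : A) : g (mk a) = Ideal.Quotient.mk _ a := rfl
  have hker (z) (hz : g z = 0) : ∃ t, z = mk f * t := by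
    obtain ⟨a, rfl⟩ := hmk z
    rw [hgmk, Ideal.Quotient.eq_zero_iff_mem, Ideal.mem_span_singleton'] at hz
    obtain ⟨t, rfl⟩ := hz
    exact ⟨mk t, by rw [← map_mul, mul_comm]⟩
  have hff : mk f * mk f = 0 := by
    rw [← map_mul, ← pow_two]
    exact Ideal.Quotient.eq_zero_iff_mem.2 (Ideal.mem_span_singleton_self _)
  have hnil : IsNilpotent (RingHom.ker (g : (A ⧸ Ideal.span {f ^ 2}) →+* A ⧸ Ideal.span {f})) := by
    refine ⟨2, (sq _).trans (eq_bot_iff.2 (Ideal.mul_le.2 ?_))⟩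
    intro z hz w hw
    obtain ⟨t, rfl⟩ := hker z hz
    obtain ⟨s, rfl⟩ := hker w hw
    rw [Ideal.mem_bot]
    linear_combination (t * s) * hff
  let σ := Algebra.FormallySmooth.liftOfSurjective (AlgHom.id F (A ⧸ Ideal.span {f})) g hg hnil
  have hσ (z) : g (σ z) = z :=
    Algebra.FormallySmooth.liftOfSurjective_apply (AlgHom.id F (A ⧸ Ideal.span {f})) g hg hnil z
  let h : A →ₐ[F] A ⧸ Ideal.span {f ^ 2} := σ.comp (Ideal.Quotient.mkₐ F _)
  -- `mk - h` is a derivation with values in the ideal generated by `f`, and `h f = 0`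
  have hD (a : A) : ∃ t, mk a - h a = mk f * t := hker _ (by
    rw [map_sub, hgmk]
    change _ - g (σ _) = 0
    rw [hσ]; exact sub_self _)
  -- it maps the square of the ideal of `e` to the product of that ideal with `(f)`
  set K : Ideal (A ⧸ Ideal.span {f ^ 2}) :=
    (RingHom.ker e * Ideal.span {f}).map (Ideal.Quotient.mk (Ideal.span {f ^ 2})) with hK
  have hmemK {a t} (ha : a ∈ RingHom.ker e) : mk a * (mk f * t) ∈ K := by
    rw [← mul_assoc, ← map_mul]
    exact Ideal.mul_mem_right _ _ (Ideal.mem_map_of_mem _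
      (Ideal.mul_mem_mul ha (Ideal.mem_span_singleton_self f)))
  have hDK : ∀ p ∈ RingHom.ker e ^ 2, mk p - h p ∈ K := by
    intro p hp
    rw [pow_two] at hp
    refine Submodule.mul_induction_on hp (fun a ha b hb => ?_) (fun a b ha hb => ?_)
    · obtain ⟨t, ht⟩ := hD a
      obtain ⟨s, hs⟩ := hD b
      have : mk (a * b) - h (a * b) = mk a * (mk f * s) + mk b * (mk f * t) := by
        rw [map_mul, map_mul]
        have h1 : h a = mk a - mk f * t := by rw [← ht]; ring
        have h2 : h b = mk b - mk f * s := by rw [← hs]; ring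
        rw [h1, h2]
        linear_combination (-(t * s)) * hff
      rw [this]
      exact Ideal.add_mem _ (hmemK ha) (hmemK hb)
    · have : mk (a + b) - h (a + b) = (mk a - h a) + (mk b - h b) := by
        rw [map_add, map_add]; ring
      rw [this]; exact Ideal.add_mem _ ha hb
  have hfK : mk f ∈ K := by
    have h1 := hDK f hf
    have h2 : h f = 0 := by
      change σ (Ideal.Quotient.mk _ f) = 0
      rw [Ideal.Quotient.eq_zero_iff_mem.2 (Ideal.mem_span_singleton_self f), map_zero]
    rwa [h2, sub_zero] at h1
  rw [hK] at hfK
  obtain ⟨p, hp, hpf⟩ := (Ideal.mem_map_iff_of_surjective _ Ideal.Quotient.mk_surjective).1 hfK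
  have h3 : p - f ∈ Ideal.span {f ^ 2} := Ideal.Quotient.eq.1 hpf
  obtain ⟨a, ha, rfl⟩ := Ideal.mem_mul_span_singleton.1 hp
  obtain ⟨b, hb⟩ := Ideal.mem_span_singleton'.1 h3
  refine ⟨1 - a + b * f, ?_, ?_⟩
  · simp only [RingHom.mem_ker] at ha hfe
    have ha' : e a = 0 := ha
    have hf' : e f = 0 := hfe
    simp [ha', hf']
  · linear_combination hb

theorem isNilpotent_of_mul_eq_zero {R : Type*} [CommRing R] (I : Ideal R)
    (h : ∀ z ∈ I, ∀ w ∈ I, z * w = 0) : IsNilpotent I := by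
  refine ⟨2, ?_⟩
  rw [pow_two]
  exact eq_bot_iff.2 (Ideal.mul_le.2 fun z hz w hw => h z hz w hw)

/-- A function with non-zero derivative along some tangent vector does not vanish to order two
after pull-back along a formally smooth map: the tangent vector lifts, over the residue field. -/
theorem algebraMap_notMem_sq_of_isTangent {e : A →ₐ[F] F} {D : A →ₗ[F] F} (hD : IsTangent e D)
    {R : Type u} [CommRing R] [IsLocalRing R] [Algebra A R] [Algebra.FormallySmooth A R]
    (hker : ∀ a, e a = 0 → algebraMap A R a ∈ IsLocalRing.maximalIdeal R) {f : A}
    (hDf : D f ≠ 0) : algebraMap A R f ∉ IsLocalRing.maximalIdeal R ^ 2 := by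
  let j : F →+* IsLocalRing.ResidueField R :=
    (IsLocalRing.residue R).comp ((algebraMap A R).comp (algebraMap F A))
  have hj (a : A) : IsLocalRing.residue R (algebraMap A R a) = j (e a) := by
    have h1 : e (a - algebraMap F A (e a)) = 0 := by simp
    have h2 := hker _ h1
    rw [← IsLocalRing.residue_eq_zero_iff, map_sub, map_sub, sub_eq_zero] at h2
    exact h2
  -- the tangent vector, as a homomorphism to the dual numbers over the residue field
  let ψ : A →+* DualNumber (IsLocalRing.ResidueField R) :=
    { toFun := fun a => TrivSqZeroExt.inl (j (e a)) + TrivSqZeroExt.inr (j (D a))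
      map_one' := by simp [hD.map_one]
      map_zero' := by simp
      map_add' := fun a b => by
        simp only [map_add, TrivSqZeroExt.inl_add, TrivSqZeroExt.inr_add]
        ext <;> simp
      map_mul' := fun a b => by
        ext
        · simp
        · simp [hD a b, mul_comm, add_comm] }
  let _ : Algebra A (DualNumber (IsLocalRing.ResidueField R)) := ψ.toAlgebra
  let p : DualNumber (IsLocalRing.ResidueField R) →ₐ[A] IsLocalRing.ResidueField R :=
    { toRingHom := (TrivSqZeroExt.fstHom (IsLocalRing.ResidueField R) _ _ :
        DualNumber (IsLocalRing.ResidueField R) →ₐ[IsLocalRing.ResidueField R] _)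
      commutes' := fun a => by
        change (ψ a).fst = IsLocalRing.residue R (algebraMap A R a)
        rw [hj]; simp [ψ] }
  have hp : Function.Surjective p := fun z => ⟨TrivSqZeroExt.inl z, rfl⟩
  have hnil : IsNilpotent (RingHom.ker
      (p : DualNumber (IsLocalRing.ResidueField R) →+* IsLocalRing.ResidueField R)) := by
    refine isNilpotent_of_mul_eq_zero _ fun z hz w hw => ?_
    have hz' : z.fst = 0 := hz
    have hw' : w.fst = 0 := hw
    ext <;> simp [hz', hw']
  let res : R →ₐ[A] IsLocalRing.ResidueField R :=
    IsScalarTower.toAlgHom A R (IsLocalRing.ResidueField R)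
  -- its lift to `R` kills the square of the maximal ideal
  let θ := Algebra.FormallySmooth.liftOfSurjective res p hp hnil
  have hθ (z : R) : (θ z).fst = IsLocalRing.residue R z :=
    Algebra.FormallySmooth.liftOfSurjective_apply res p hp hnil z
  intro hmem
  have h1 : ∀ z ∈ IsLocalRing.maximalIdeal R ^ 2, θ z = 0 := by
    intro z hz
    rw [pow_two] at hz
    refine Submodule.mul_induction_on hz (fun a ha b hb => ?_) (fun a b ha hb => ?_)
    · have ha' : (θ a).fst = 0 := by rw [hθ, IsLocalRing.residue_eq_zero_iff]; exact ha
      have hb' : (θ b).fst = 0 := by rw [hθ, IsLocalRing.residue_eq_zero_iff]; exact hb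
      rw [map_mul]
      ext <;> simp [ha', hb']
    · rw [map_add, ha, hb, add_zero]
  have h2 : θ (algebraMap A R f) = ψ f := θ.commutes f
  have h3 := h1 _ hmem
  rw [h2] at h3
  have h4 := congr_arg TrivSqZeroExt.snd h3
  simp only [ψ, RingHom.coe_mk, MonoidHom.coe_mk, OneHom.coe_mk, TrivSqZeroExt.snd_add,
    TrivSqZeroExt.snd_inl, TrivSqZeroExt.snd_inr, zero_add, TrivSqZeroExt.snd_zero] at h4
  have h5 : j (D f) = 0 := h4
  exact hDf ((map_eq_zero j).1 h5)

/-- Top forms can be evaluated at a family of tangent vectors. -/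
theorem exists_eval_form (e : A →ₐ[F] F) {d : ℕ} {D : Fin d → A →ₗ[F] F}
    (hD : ∀ i, IsTangent e (D i)) :
    ∃ ev : (⋀[A]^d Ω[A⁄F]) →+ F, (∀ a η, ev (a • η) = e a * ev η) ∧ ∀ h : Fin d → A,
      ev (exteriorPower.ιMulti A d fun j => KaehlerDifferential.D F A (h j)) =
        (Matrix.of fun j i => D i (h j)).det := by
  let _ : Module A F := Module.compHom F (e : A →+* F)
  have hsmul (a : A) (t : F) : a • t = e a * t := rfl
  have _ : IsScalarTower F A F := ⟨fun c a t => by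
    rw [hsmul, hsmul, map_smul, smul_eq_mul, smul_eq_mul, mul_assoc]⟩
  let δ (i : Fin d) : Derivation F A F := Derivation.mk' (D i) fun a b => by
    rw [hsmul, hsmul, hD i a b]
  let ℓ : Ω[A⁄F] →ₗ[A] (Fin d → F) := LinearMap.pi fun i => (δ i).liftKaehlerDifferential
  let det : (Fin d → F) [⋀^Fin d]→ₗ[A] F :=
    { toFun := fun M => Matrix.det (Matrix.of M)
      map_update_add' := fun {inst} M i x y => by
        obtain rfl : inst = instDecidableEqFin d := Subsingleton.elim _ _
        exact (Matrix.detRowAlternating (n := Fin d) (R := F)).map_update_add M i x y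
      map_update_smul' := fun {inst} M i c x => by
        obtain rfl : inst = instDecidableEqFin d := Subsingleton.elim _ _
        exact (Matrix.detRowAlternating (n := Fin d) (R := F)).map_update_smul M i (e c) x
      map_eq_zero_of_eq' := fun M i j h hij =>
        (Matrix.detRowAlternating (n := Fin d) (R := F)).map_eq_zero_of_eq M h hij }
  refine ⟨(exteriorPower.alternatingMapLinearEquiv (det.compLinearMap ℓ)).toAddMonoidHom,
    fun a η => ?_, fun h => ?_⟩
  · exact map_smul (exteriorPower.alternatingMapLinearEquiv (det.compLinearMap ℓ)) a η
  · change exteriorPower.alternatingMapLinearEquiv (det.compLinearMap ℓ) _ = _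
    rw [exteriorPower.alternatingMapLinearEquiv_apply_ιMulti]
    change Matrix.det _ = Matrix.det _
    congr 1
    ext j i
    simp [ℓ, δ]

end Tangent

/-! ### Values of regular functions at rational points -/

section Values

variable {F : Type u} [Field F] {X : Scheme.{u}} [X.Over (Spec (.of F))]

/-- The point of the scheme underlying a rational point. -/
def Points.pt (x : Points F X) : X := x.hom (IsLocalRing.closedPoint F)

theorem mem_ratPoints {V : X.Opens} {x : Points F X} : x ∈ ratPoints F V ↔ x.pt ∈ V := by
  constructor
  · intro h
    exact h (Set.mem_univ (IsLocalRing.closedPoint F))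
  · intro h y _
    have : y = IsLocalRing.closedPoint F := Subsingleton.elim (α := PrimeSpectrum F) _ _
    rw [this]
    exact h

theorem ratPoints_mono {V W : X.Opens} (h : W ≤ V) : ratPoints F W ⊆ ratPoints F V :=
  fun _ hx => mem_ratPoints.2 (h (mem_ratPoints.1 hx))

theorem ratPoints_inf (V W : X.Opens) :
    ratPoints F (V ⊓ W) = ratPoints F V ∩ ratPoints F W := by
  ext x
  simp only [Set.mem_inter_iff, mem_ratPoints]
  rfl

theorem value_eq {V : X.Opens} {x : Points F X} (hx : ⊤ ≤ x.hom ⁻¹ᵁ V) (f : Γ(X, V)) :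
    value f x = (x.hom.appLE V ⊤ hx ≫ (Scheme.ΓSpecIso (.of F)).hom).hom f := dif_pos hx

/-- Evaluation at a rational point of `V`. -/
def evalHom {V : X.Opens} {x : Points F X} (hx : x ∈ ratPoints F V) : Γ(X, V) →ₐ[F] F :=
  have hx' : ⊤ ≤ x.hom ⁻¹ᵁ V := hx
  { (x.hom.appLE V ⊤ hx' ≫ (Scheme.ΓSpecIso (.of F)).hom).hom with
    commutes' := fun c => by
      have h2 : (X ↘ Spec (.of F)).appTop ≫ x.hom.appLE ⊤ ⊤ le_top = 𝟙 _ := by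
        have h3 := x.hom.appLE_eq_app (U := ⊤)
        have h4 : (X ↘ Spec (.of F)).appTop ≫ x.hom.appTop = 𝟙 _ := by
          rw [← Scheme.Hom.comp_appTop, x.isSection, Scheme.Hom.id_appTop]
        exact h3 ▸ h4
      have h : ((Scheme.ΓSpecIso (.of F)).inv ≫ (X ↘ Spec (.of F)).appTop ≫
          X.presheaf.map (homOfLE (le_top : V ≤ ⊤)).op) ≫
          (x.hom.appLE V ⊤ hx' ≫ (Scheme.ΓSpecIso (.of F)).hom) = 𝟙 _ := by
        rw [Category.assoc, Category.assoc, Scheme.Hom.map_appLE_assoc, reassoc_of% h2,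
          Iso.inv_hom_id]
      exact congr($(h).hom c) }

theorem evalHom_apply {V : X.Opens} {x : Points F X} (hx : x ∈ ratPoints F V) (f : Γ(X, V)) :
    evalHom hx f = value f x := (value_eq hx f).symm

theorem value_resFun {V W : X.Opens} (h : W ≤ V) (f : Γ(X, V)) {x : Points F X}
    (hx : x ∈ ratPoints F W) : value (resFun h f) x = value f x := by
  have hx' : ⊤ ≤ x.hom ⁻¹ᵁ W := hx
  rw [value_eq hx', value_eq (hx'.trans fun _ hy => h hy)]
  change (X.presheaf.map (homOfLE h).op ≫ x.hom.appLE W ⊤ hx' ≫ _).hom f = _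
  rw [Scheme.Hom.map_appLE_assoc]

theorem mem_ratPoints_basicOpen {V : X.Opens} (f : Γ(X, V)) {x : Points F X} :
    x ∈ ratPoints F (X.basicOpen f) ↔ x ∈ ratPoints F V ∧ value f x ≠ 0 := by
  by_cases hx : x ∈ ratPoints F V
  · rw [and_iff_right hx, value_eq hx]
    have h1 := Scheme.basicOpen_appLE x.hom ⊤ V hx f
    rw [top_inf_eq] at h1
    change ⊤ ≤ x.hom ⁻¹ᵁ (X.basicOpen f) ↔ _
    rw [← h1, CommRingCat.comp_apply]
    set g := x.hom.appLE V ⊤ hx f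
    have h2 : g = (Scheme.ΓSpecIso (.of F)).inv ((Scheme.ΓSpecIso (.of F)).hom g) :=
      (congr($((Scheme.ΓSpecIso (.of F)).hom_inv_id).hom g)).symm
    constructor
    · intro h h0
      rw [h2, h0, map_zero, Scheme.basicOpen_zero] at h
      exact h (Set.mem_univ (IsLocalRing.closedPoint F))
    · intro h
      have : IsUnit ((Scheme.ΓSpecIso (.of F)).hom g) := IsUnit.mk0 (G₀ := F) _ h
      have := this.map (Scheme.ΓSpecIso (.of F)).inv.hom
      rw [← h2] at this
      rw [Scheme.basicOpen_of_isUnit _ this]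
  · refine iff_of_false (fun h => hx (ratPoints_mono (X.basicOpen_le f) h)) fun h => hx h.1

theorem hom_eq_SpecMap_evalHom {V : X.Opens} (hV : IsAffineOpen V) {x : Points F X}
    (hx : x ∈ ratPoints F V) :
    x.hom = Spec.map (CommRingCat.ofHom (evalHom hx).toRingHom) ≫ hV.fromSpec := by
  have hx' : ⊤ ≤ x.hom ⁻¹ᵁ V := hx
  have h := hV.SpecMap_appLE_fromSpec x.hom (isAffineOpen_top _) hx'
  have h2 : CommRingCat.ofHom (evalHom hx).toRingHom =
    x.hom.appLE V ⊤ hx' ≫ (Scheme.ΓSpecIso (.of F)).hom := rfl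
  rw [h2, Spec.map_comp, Category.assoc, h, IsAffineOpen.fromSpec_top, Scheme.isoSpec_Spec_inv,
    ← Category.assoc, ← Spec.map_comp, Iso.inv_hom_id, Spec.map_id, Category.id_comp]

theorem fromSpec_over {V : X.Opens} (hV : IsAffineOpen V) :
    hV.fromSpec ≫ (X ↘ Spec (.of F)) =
      Spec.map (CommRingCat.ofHom (algebraMap F Γ(X, V))) := by
  have h := (isAffineOpen_top (Spec (.of F))).SpecMap_appLE_fromSpec (X ↘ Spec (.of F)) hV le_top
  have h2 : CommRingCat.ofHom (algebraMap F Γ(X, V)) =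
    (Scheme.ΓSpecIso (.of F)).inv ≫ (X ↘ Spec (.of F)).appLE ⊤ V le_top := rfl
  rw [h2, Spec.map_comp, ← h, IsAffineOpen.fromSpec_top, Scheme.isoSpec_Spec_inv]

theorem exists_point_of_algHom {V : X.Opens} (hV : IsAffineOpen V) (e : Γ(X, V) →ₐ[F] F) :
    ∃ x : Points F X, ∃ hx : x ∈ ratPoints F V, evalHom hx = e := by
  let x : Points F X := ⟨Spec.map (CommRingCat.ofHom e.toRingHom) ≫ hV.fromSpec, by
    rw [Category.assoc, fromSpec_over, ← Spec.map_comp, ← CommRingCat.ofHom_comp]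
    have : e.toRingHom.comp (algebraMap F Γ(X, V)) = RingHom.id F := e.comp_algebraMap
    rw [this]; exact Spec.map_id _⟩
  have hx : x ∈ ratPoints F V := by
    rw [mem_ratPoints]
    have : x.pt ∈ Set.range hV.fromSpec :=
      ⟨Spec.map (CommRingCat.ofHom e.toRingHom) (IsLocalRing.closedPoint F), rfl⟩
    rwa [hV.range_fromSpec] at this
  refine ⟨x, hx, ?_⟩
  have h := hom_eq_SpecMap_evalHom hV hx
  rw [cancel_mono hV.fromSpec] at h
  have := Spec.map_injective h
  ext f
  exact congr($(this).hom f).symm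

theorem ext_of_value_eq {V : X.Opens} (hV : IsAffineOpen V) {x y : Points F X}
    (hx : x ∈ ratPoints F V) (hy : y ∈ ratPoints F V)
    (h : ∀ f : Γ(X, V), value f x = value f y) : x = y := by
  have h1 : evalHom hx = evalHom hy := by
    ext f
    rw [evalHom_apply, evalHom_apply, h]
  have h2 := hom_eq_SpecMap_evalHom hV hx
  rw [h1, ← hom_eq_SpecMap_evalHom hV hy] at h2
  cases x; cases y
  cases h2; rfl

end Values

/-! ### Frames and equations of divisors -/

section Frames

variable {X : Scheme.{u}}

theorem resFun_resFun {V W Z : X.Opens} (h : W ≤ V) (h' : Z ≤ W) (f : Γ(X, V)) :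
    resFun h' (resFun h f) = resFun (h'.trans h) f := by
  change (X.presheaf.map _ ≫ X.presheaf.map _).hom f = _
  rw [← Functor.map_comp]; rfl

theorem resFun_mul {V W : X.Opens} (h : W ≤ V) (f g : Γ(X, V)) :
    resFun h (f * g) = resFun h f * resFun h g := map_mul (X.presheaf.map (homOfLE h).op).hom f g

theorem IsUnit.resFun {V W : X.Opens} (h : W ≤ V) {f : Γ(X, V)} (hf : IsUnit f) :
    IsUnit (LocalIntegral.resFun h f) := hf.map (X.presheaf.map (homOfLE h).op).hom

theorem isUnit_resFun_basicOpen {V W : X.Opens} (f : Γ(X, V)) (h : W ≤ X.basicOpen f) :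
    IsUnit (resFun (h.trans (X.basicOpen_le f)) f) := by
  rw [← resFun_resFun (X.basicOpen_le f) h]
  exact IsUnit.resFun _ (RingedSpace.isUnit_res_basicOpen _ f)

theorem le_basicOpen_of_isUnit {V W : X.Opens} (h : W ≤ V) {f : Γ(X, V)}
    (hf : IsUnit (resFun h f)) : W ≤ X.basicOpen f := by
  have h1 := X.basicOpen_of_isUnit hf
  have h2 : X.basicOpen (resFun h f) = W ⊓ X.basicOpen f := X.basicOpen_res f (homOfLE h).op
  rw [h1] at h2
  exact inf_eq_left.1 h2.symm

theorem exists_resFun_eq_pow_mul {V : X.Opens} (hV : IsAffineOpen V) (g : Γ(X, V))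
    (f : Γ(X, X.basicOpen g)) :
    ∃ (a : Γ(X, V)) (n : ℕ), resFun (X.basicOpen_le g) a = resFun (X.basicOpen_le g) g ^ n * f := by
  have := hV.isLocalization_basicOpen g
  obtain ⟨n, a, ha⟩ := IsLocalization.Away.surj g f
  exact ⟨a, n, by rw [mul_comm]; exact ha.symm⟩

variable {L : X.Modules}

theorem resSec_resSec {V W Z : X.Opens} (h : W ≤ V) (h' : Z ≤ W) (s : Γ(L, V)) :
    resSec L h' (resSec L h s) = resSec L (h'.trans h) s := by
  change (L.presheaf.map _ ≫ L.presheaf.map _) s = _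
  rw [← Functor.map_comp]; rfl

theorem resSec_smul {V W : X.Opens} (h : W ≤ V) (f : Γ(X, V)) (s : Γ(L, V)) :
    resSec L h (f • s) = resFun h f • resSec L h s := Scheme.Modules.map_smul L (homOfLE h) f s

theorem resSec_self {V : X.Opens} (s : Γ(L, V)) : resSec L le_rfl s = s := by
  change L.presheaf.map (𝟙 _) s = s
  rw [CategoryTheory.Functor.map_id]; rfl

theorem IsFrame.res {V W : X.Opens} {e : Γ(L, V)} (he : IsFrame L V e) (h : W ≤ V) :
    IsFrame L W (resSec L h e) := fun Z hZ => by
  rw [resSec_resSec]; exact he Z _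

theorem IsFrame.exists_eq_smul {V : X.Opens} {e : Γ(L, V)} (he : IsFrame L V e) (t : Γ(L, V)) :
    ∃ a : Γ(X, V), t = a • e := by
  obtain ⟨a, ha⟩ := (he V le_rfl).2 t
  rw [resSec_self] at ha
  exact ⟨a, ha.symm⟩

theorem IsFrame.smul_inj {V : X.Opens} {e : Γ(L, V)} (he : IsFrame L V e) {a b : Γ(X, V)}
    (h : a • e = b • e) : a = b :=
  (he V le_rfl).1 (by simpa only [resSec_self] using h)

theorem IsFrame.smul {V : X.Opens} {e : Γ(L, V)} (he : IsFrame L V e) {f : Γ(X, V)}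
    (hf : IsUnit f) : IsFrame L V (f • e) := fun W h => by
  simp only [resSec_smul, ← mul_smul]
  obtain ⟨u, hu⟩ := IsUnit.resFun h hf
  rw [← hu]
  exact (he W h).comp (Units.mulRight u).bijective

theorem IsFrame.exists_isUnit {V : X.Opens} {e e' : Γ(L, V)} (he : IsFrame L V e)
    (he' : IsFrame L V e') : ∃ u : Γ(X, V), IsUnit u ∧ e' = u • e := by
  obtain ⟨a, ha⟩ := he.exists_eq_smul e'
  obtain ⟨b, hb⟩ := he'.exists_eq_smul e
  refine ⟨a, IsUnit.of_mul_eq_one b (he.smul_inj ?_), ha⟩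
  rw [one_smul, mul_comm, mul_smul, ← ha, ← hb]

variable {s : Γ(L, (⊤ : X.Opens))}

theorem IsLocalEquation.res {V W : X.Opens} {e : Γ(L, V)} {f : Γ(X, V)}
    (h : IsLocalEquation L s V e f) (hWV : W ≤ V) :
    IsLocalEquation L s W (resSec L hWV e) (resFun hWV f) :=
  ⟨h.1.res hWV, by rw [← resSec_smul, ← h.2, resSec_resSec]⟩

/-- Where `s` is a frame, it differs from any other frame by a unit. -/
theorem IsLocalEquation.nonvanishing_inf {V : X.Opens} {e : Γ(L, V)} {f : Γ(X, V)}
    (h : IsLocalEquation L s V e f) : nonvanishing L s ⊓ V = X.basicOpen f := by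
  apply le_antisymm
  · rintro p ⟨hp, hpV⟩
    obtain ⟨W, hW, hpW⟩ := Opens.mem_sSup.1 hp
    change IsFrame L W _ at hW
    have h1 := hW.res (inf_le_right : V ⊓ W ≤ W)
    have h2 := h.res (inf_le_left : V ⊓ W ≤ V)
    rw [resSec_resSec] at h1
    obtain ⟨u, hu, hu'⟩ := h2.1.exists_isUnit h1
    rw [h2.2] at hu'
    have h3 := h2.1.smul_inj hu'
    rw [← h3] at hu
    exact le_basicOpen_of_isUnit inf_le_left hu ⟨hpV, hpW⟩
  · refine le_inf ?_ (X.basicOpen_le f)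
    refine le_sSup ?_
    have h1 := h.res (X.basicOpen_le f)
    change IsFrame L _ _
    rw [h1.2]
    exact h1.1.smul (isUnit_resFun_basicOpen f le_rfl)

theorem germ_resFun {V W : X.Opens} (h : W ≤ V) {p : X} (hp : p ∈ W) (f : Γ(X, V)) :
    X.presheaf.germ W p hp (resFun h f) = X.presheaf.germ V p (h hp) f :=
  X.presheaf.germ_res_apply (homOfLE h) p hp f

/-- Two equations of the same divisor differ by a unit near each point. -/
theorem IsLocalEquation.associated_germ {V V' : X.Opens} {e : Γ(L, V)} {f : Γ(X, V)}
    {e' : Γ(L, V')} {f' : Γ(X, V')}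
    (h : IsLocalEquation L s V e f) (h' : IsLocalEquation L s V' e' f') {p : X}
    (hp : p ∈ V) (hp' : p ∈ V') :
    Associated (X.presheaf.germ V p hp f) (X.presheaf.germ V' p hp' f') := by
  have h1 := h.res (inf_le_left : V ⊓ V' ≤ V)
  have h2 := h'.res (inf_le_right : V ⊓ V' ≤ V')
  obtain ⟨u, hu, hu'⟩ := h2.1.exists_isUnit h1.1
  have h3 := h1.2.symm.trans h2.2
  rw [hu', ← mul_smul] at h3
  have h4 := h2.1.smul_inj h3
  have hpp : p ∈ V ⊓ V' := ⟨hp, hp'⟩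
  rw [← germ_resFun inf_le_left hpp f, ← germ_resFun inf_le_right hpp f', ← h4, map_mul]
  exact associated_mul_unit_right _ _ (hu.map (X.presheaf.germ (V ⊓ V') p hpp).hom)

theorem IsLocalEquation.divIdeal_eq {V : X.Opens} {e : Γ(L, V)} {f : Γ(X, V)}
    (h : IsLocalEquation L s V e f) {p : X} (hp : p ∈ V) :
    divIdeal L s p = Ideal.span {X.presheaf.germ V p hp f} := by
  apply le_antisymm
  · refine Ideal.span_le.2 ?_
    rintro a ⟨V', hp', e', f', h', rfl⟩
    rw [SetLike.mem_coe, Ideal.mem_span_singleton]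
    exact (h.associated_germ h' hp hp').dvd
  · rw [Ideal.span_singleton_le_iff_mem]
    exact Ideal.subset_span ⟨V, hp, e, f, h, rfl⟩

end Frames

/-! ### The topology on the set of rational points -/

section Topology

open _root_.Filter _root_.Topology

variable {F : Type u} [NormedField F] {X : Scheme.{u}} [X.Over (Spec (.of F))]

theorem isOpen_value_mem {V : X.Opens} (f : Γ(X, V)) {O : Set F} (hO : IsOpen O) :
    IsOpen {x : Points F X | x ∈ ratPoints F V ∧ value f x ∈ O} :=
  isOpen_generateFrom_of_mem ⟨V, f, O, hO, rfl⟩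

theorem isOpen_ratPoints (V : X.Opens) : IsOpen (ratPoints F V) := by
  convert isOpen_value_mem (0 : Γ(X, V)) isOpen_univ using 1
  simp

theorem continuousOn_value {V : X.Opens} (f : Γ(X, V)) :
    ContinuousOn (value f : Points F X → F) (ratPoints F V) :=
  (continuousOn_open_iff (isOpen_ratPoints V)).2 fun _ hO => isOpen_value_mem f hO

/-- Convergence to a rational point of an affine open set is tested on regular functions. -/
theorem tendsto_of_tendsto_value {V : X.Opens} (hV : IsAffineOpen V) {x : Points F X}
    (hx : x ∈ ratPoints F V) {α : Type*} {l : Filter α} {y : α → Points F X}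
    (hy : ∀ᶠ a in l, y a ∈ ratPoints F V)
    (h : ∀ f : Γ(X, V), Tendsto (fun a => value f (y a)) l (𝓝 (value f x))) :
    Tendsto y l (𝓝 x) := by
  refine tendsto_nhds_generateFrom_iff.2 ?_
  rintro B ⟨V', f, O, hO, rfl⟩ ⟨hx', hxO⟩
  obtain ⟨g, hgV', hpg⟩ := hV.exists_basicOpen_le ⟨x.pt, mem_ratPoints.1 hx'⟩ (mem_ratPoints.1 hx)
  obtain ⟨a, n, ha⟩ := exists_resFun_eq_pow_mul hV g (resFun hgV' f)
  have key {z : Points F X} (hz : z ∈ ratPoints F (X.basicOpen g)) :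
      value f z = value a z / value g z ^ n := by
    have h0 := (mem_ratPoints_basicOpen g).1 hz
    have h1 := congr_arg (evalHom hz) ha
    rw [map_mul, map_pow, evalHom_apply, evalHom_apply, evalHom_apply, value_resFun _ _ hz,
      value_resFun _ _ hz, value_resFun _ _ hz] at h1
    rw [h1, mul_div_cancel_left₀ _ (pow_ne_zero _ h0.2)]
  have hxg : x ∈ ratPoints F (X.basicOpen g) := mem_ratPoints.2 hpg
  have hg0 := ((mem_ratPoints_basicOpen g).1 hxg).2
  have hlim : Tendsto (fun i => value a (y i) / value g (y i) ^ n) l (𝓝 (value f x)) := by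
    rw [key hxg]
    exact (h a).div ((h g).pow n) (pow_ne_zero _ hg0)
  filter_upwards [hy, (h g).eventually_ne hg0, hlim.eventually (hO.mem_nhds hxO)] with i h1 h2 h3
  have hi : y i ∈ ratPoints F (X.basicOpen g) := (mem_ratPoints_basicOpen g).2 ⟨h1, h2⟩
  refine ⟨ratPoints_mono hgV' hi, ?_⟩
  rw [key hi]; exact h3

end Topology

/-! ### Compactness of the set of rational points -/

section EvalAt

variable {X : Scheme.{u}}

/-- The ring homomorphism `Γ(X, V) → R` defined by an `R`-valued point of `V`. -/
def evalAt {R : Type u} [CommRing R] (j : Spec (.of R) ⟶ X) {V : X.Opens} (h : ⊤ ≤ j ⁻¹ᵁ V) :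
    Γ(X, V) →+* R :=
  (j.appLE V ⊤ h ≫ (Scheme.ΓSpecIso (.of R)).hom).hom

variable {R S : Type u} [CommRing R] [CommRing S]

theorem evalAt_resFun {j : Spec (.of R) ⟶ X} {V W : X.Opens} (h : W ≤ V) (hW : ⊤ ≤ j ⁻¹ᵁ W)
    (hV : ⊤ ≤ j ⁻¹ᵁ V) (f : Γ(X, V)) : evalAt j hW (resFun h f) = evalAt j hV f := by
  change (X.presheaf.map (homOfLE h).op ≫ j.appLE W ⊤ hW ≫ _).hom f = _
  rw [Scheme.Hom.map_appLE_assoc]; rfl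

theorem evalAt_comp {j : Spec (.of R) ⟶ X} {V : X.Opens} (hV : ⊤ ≤ j ⁻¹ᵁ V) (ψ : R →+* S)
    (hV' : ⊤ ≤ (Spec.map (CommRingCat.ofHom ψ) ≫ j) ⁻¹ᵁ V) :
    evalAt _ hV' = ψ.comp (evalAt j hV) := by
  have h1 := Scheme.Hom.appLE_comp_appLE (Spec.map (CommRingCat.ofHom ψ)) j V ⊤ ⊤ hV le_top
  have h2 : (Spec.map (CommRingCat.ofHom ψ)).appLE ⊤ ⊤ le_top =
    (Spec.map (CommRingCat.ofHom ψ)).appTop := Scheme.Hom.appLE_eq_app _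
  ext f
  change ((Spec.map (CommRingCat.ofHom ψ) ≫ j).appLE V ⊤ hV' ≫ _).hom f =
    ((j.appLE V ⊤ hV ≫ (Scheme.ΓSpecIso (.of R)).hom) ≫ CommRingCat.ofHom ψ).hom f
  rw [← h1, h2, Category.assoc, Scheme.ΓSpecIso_naturality, Category.assoc]

theorem eq_SpecMap_evalAt {V : X.Opens} (hV : IsAffineOpen V) {j : Spec (.of R) ⟶ X}
    (hj : ⊤ ≤ j ⁻¹ᵁ V) : j = Spec.map (CommRingCat.ofHom (evalAt j hj)) ≫ hV.fromSpec := by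
  have h := hV.SpecMap_appLE_fromSpec j (isAffineOpen_top _) hj
  have h2 : CommRingCat.ofHom (evalAt j hj) =
    j.appLE V ⊤ hj ≫ (Scheme.ΓSpecIso (.of R)).hom := rfl
  rw [h2, Spec.map_comp, Category.assoc, h, IsAffineOpen.fromSpec_top, Scheme.isoSpec_Spec_inv,
    ← Category.assoc, ← Spec.map_comp, Iso.inv_hom_id, Spec.map_id, Category.id_comp]

theorem top_le_preimage_fromSpec {V : X.Opens} (hV : IsAffineOpen V) (φ : Γ(X, V) →+* R) :
    ⊤ ≤ (Spec.map (CommRingCat.ofHom φ) ≫ hV.fromSpec) ⁻¹ᵁ V := by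
  intro y _
  have : hV.fromSpec (Spec.map (CommRingCat.ofHom φ) y) ∈ Set.range hV.fromSpec := ⟨_, rfl⟩
  rwa [hV.range_fromSpec] at this

theorem evalAt_fromSpec {V : X.Opens} (hV : IsAffineOpen V) (φ : Γ(X, V) →+* R)
    (h : ⊤ ≤ (Spec.map (CommRingCat.ofHom φ) ≫ hV.fromSpec) ⁻¹ᵁ V) : evalAt _ h = φ := by
  have h1 := eq_SpecMap_evalAt hV h
  rw [cancel_mono hV.fromSpec] at h1
  have := Spec.map_injective h1
  ext f
  exact congr($(this).hom f).symm

end EvalAt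

section StandardPart

open _root_.Filter _root_.Topology

variable {F : Type u} [NormedField F] {α : Type u} (𝒰 : Ultrafilter α)

/-- The ring of bounded elements of an ultrapower of a normed field. -/
def boundedGerms : ValuationSubring (Germ (𝒰 : Filter α) F) where
  carrier := {z | ∃ (g : α → F) (C : ℝ), z = ↑g ∧ ∀ᶠ a in 𝒰, ‖g a‖ ≤ C}
  mul_mem' := by
    rintro _ _ ⟨g, C, rfl, hg⟩ ⟨g', C', rfl, hg'⟩
    refine ⟨g * g', C * C', rfl, ?_⟩
    filter_upwards [hg, hg'] with a h h'
    exact (norm_mul_le _ _).trans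
      (mul_le_mul h h' (norm_nonneg _) ((norm_nonneg _).trans h))
  one_mem' := ⟨1, 1, rfl, by simp⟩
  add_mem' := by
    rintro _ _ ⟨g, C, rfl, hg⟩ ⟨g', C', rfl, hg'⟩
    refine ⟨g + g', C + C', rfl, ?_⟩
    filter_upwards [hg, hg'] with a h h'
    exact (norm_add_le _ _).trans (add_le_add h h')
  zero_mem' := ⟨0, 0, rfl, by simp⟩
  neg_mem' := by
    rintro _ ⟨g, C, rfl, hg⟩
    exact ⟨-g, C, rfl, by simpa using hg⟩
  mem_or_inv_mem' := by
    intro z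
    induction z using Germ.inductionOn with | _ g
    rcases 𝒰.eventually_or.1 (Eventually.of_forall fun a => le_total ‖g a‖ 1) with h | h
    · exact Or.inl ⟨g, 1, rfl, h⟩
    · refine Or.inr ⟨g⁻¹, 1, rfl, ?_⟩
      filter_upwards [h] with a ha
      rw [Pi.inv_apply, norm_inv]
      exact inv_le_one_of_one_le₀ ha

/-- The embedding of the constants into the ring of bounded elements of an ultrapower. -/
def constGerm : F →+* boundedGerms (F := F) 𝒰 where
  toFun c := ⟨((fun _ => c : α → F) : Germ (𝒰 : Filter α) F), fun _ => c, ‖c‖, rfl, by simp⟩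
  map_one' := rfl
  map_zero' := rfl
  map_add' _ _ := rfl
  map_mul' _ _ := rfl

/-- A bounded function has a limit along an ultrafilter, as closed balls are compact; this limit
only depends on the germ of the function, and is compatible with sums and products. -/
theorem exists_standardPart [ProperSpace F] : ∃ st : boundedGerms (F := F) 𝒰 →+* F,
    (∀ c, st (constGerm 𝒰 c) = c) ∧
    ∀ (z : boundedGerms (F := F) 𝒰) (g : α → F), (z : Germ (𝒰 : Filter α) F) = ↑g →
      Tendsto g 𝒰 (𝓝 (st z)) := by
  have h1 (z : boundedGerms (F := F) 𝒰) : ∃ c, ∀ g : α → F, (z : Germ (𝒰 : Filter α) F) = ↑g →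
      Tendsto g 𝒰 (𝓝 c) := by
    obtain ⟨z, g, C, rfl, hg⟩ := z
    obtain ⟨c, _, hc⟩ := (isCompact_closedBall (0 : F) C).ultrafilter_le_nhds (𝒰.map g)
      (le_principal_iff.2 (by
        change ∀ᶠ a in 𝒰, g a ∈ Metric.closedBall 0 C
        simpa using hg))
    refine ⟨c, fun g' hg' => ?_⟩
    have h2 : g =ᶠ[𝒰] g' := Germ.coe_eq.1 hg'
    exact Tendsto.congr' h2 hc
  choose st hst using h1
  have key (z : boundedGerms (F := F) 𝒰) (g : α → F) (hz : (z : Germ (𝒰 : Filter α) F) = ↑g)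
      (c : F) (hc : Tendsto g 𝒰 (𝓝 c)) : st z = c := tendsto_nhds_unique (hst z g hz) hc
  have rep (z : boundedGerms (F := F) 𝒰) : ∃ g : α → F, (z : Germ (𝒰 : Filter α) F) = ↑g := by
    obtain ⟨z, g, C, rfl, hg⟩ := z
    exact ⟨g, rfl⟩
  refine ⟨{ toFun := st, map_one' := ?_, map_zero' := ?_, map_add' := ?_, map_mul' := ?_ },
    fun c => ?_, hst⟩
  · exact key 1 1 rfl 1 tendsto_const_nhds
  · intro z w
    obtain ⟨g, hg⟩ := rep z
    obtain ⟨g', hg'⟩ := rep w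
    refine key (z * w) (g * g') ?_ _ ((hst z g hg).mul (hst w g' hg'))
    change (z : Germ (𝒰 : Filter α) F) * w = _
    rw [hg, hg']; rfl
  · exact key 0 0 rfl 0 tendsto_const_nhds
  · intro z w
    obtain ⟨g, hg⟩ := rep z
    obtain ⟨g', hg'⟩ := rep w
    refine key (z + w) (g + g') ?_ _ ((hst z g hg).add (hst w g' hg'))
    change (z : Germ (𝒰 : Filter α) F) + w = _
    rw [hg, hg']; rfl
  · exact key _ (fun _ => c) rfl c tendsto_const_nhds

end StandardPart

section Compact

open _root_.Filter _root_.Topology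

variable {F : Type u} [NormedField F] {X : Scheme.{u}} [X.Over (Spec (.of F))]

/-- The rational points of a proper scheme over a locally compact field form a compact space: the
valuative criterion, applied to the ring of bounded elements of an ultrapower of `F`, provides
limits of ultrafilters. -/
theorem isCompact_univ_points [ProperSpace F] [IsProper (X ↘ Spec (.of F))] :
    IsCompact (Set.univ : Set (Points F X)) := by
  refine isCompact_iff_ultrafilter_le_nhds.2 fun 𝒰 _ => ?_
  simp only [Set.mem_univ, true_and]
  have hcpt : CompactSpace X := by
    have := QuasiCompact.compactSpace_of_compactSpace (X ↘ Spec (.of F))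
    exact this
  -- an affine open set containing almost all the points
  obtain ⟨V, hV, hV𝒰⟩ : ∃ V : X.Opens, IsAffineOpen V ∧ ∀ᶠ y in (𝒰 : Filter (Points F X)),
      y ∈ ratPoints F V := by
    obtain ⟨t, ht⟩ := isCompact_univ.elim_finite_subcover (fun V : X.affineOpens => (V : Set X))
      (fun V => V.1.isOpen) (fun p _ => by
        have h : p ∈ (⨆ V : X.affineOpens, V.1) := by
          rw [iSup_affineOpens_eq_top]; trivial
        obtain ⟨V, hV⟩ := Opens.mem_iSup.1 h
        exact Set.mem_iUnion.2 ⟨V, hV⟩)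
    have h1 : (⋃ V ∈ t, ratPoints F V.1) ∈ (𝒰 : Filter (Points F X)) := by
      refine Filter.mem_of_superset Filter.univ_mem fun y _ => ?_
      have := ht (Set.mem_univ y.pt)
      simp only [Set.mem_iUnion] at this ⊢
      obtain ⟨V, hVt, hV⟩ := this
      exact ⟨V, hVt, mem_ratPoints.2 hV⟩
    obtain ⟨V, hVt, hV⟩ := (Ultrafilter.finite_biUnion_mem_iff t.finite_toSet).1 h1
    exact ⟨V.1, V.2, hV⟩
  let K := Germ (𝒰 : Filter (Points F X)) F
  let O := boundedGerms (F := F) 𝒰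
  obtain ⟨st, hst, hlim⟩ := exists_standardPart (F := F) 𝒰
  -- the `K`-valued point of `V` whose coordinates are the germs of those of the points
  let φ : Γ(X, V) →+* K :=
    { toFun := fun f => ((value f : Points F X → F) : K)
      map_one' := by
        refine Germ.coe_eq.2 ?_
        filter_upwards [hV𝒰] with y hy
        rw [← evalHom_apply hy, map_one]
      map_zero' := by
        refine Germ.coe_eq.2 ?_
        filter_upwards [hV𝒰] with y hy
        rw [← evalHom_apply hy, map_zero]
      map_add' := fun f g => by
        refine Germ.coe_eq.2 ?_
        filter_upwards [hV𝒰] with y hy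
        rw [← evalHom_apply hy, map_add, evalHom_apply, evalHom_apply]
      map_mul' := fun f g => by
        refine Germ.coe_eq.2 ?_
        filter_upwards [hV𝒰] with y hy
        rw [← evalHom_apply hy, map_mul, evalHom_apply, evalHom_apply] }
  let j : Spec (.of K) ⟶ X := Spec.map (CommRingCat.ofHom φ) ≫ hV.fromSpec
  have hsq : CommSq j (Spec.map (CommRingCat.ofHom (algebraMap O K))) (X ↘ Spec (.of F))
      (Spec.map (CommRingCat.ofHom (constGerm 𝒰))) := ⟨by
    rw [Category.assoc, fromSpec_over, ← Spec.map_comp, ← Spec.map_comp, ← CommRingCat.ofHom_comp,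
      ← CommRingCat.ofHom_comp]
    congr 2
    ext c
    refine Germ.coe_eq.2 ?_
    filter_upwards [hV𝒰] with y hy
    rw [← evalHom_apply hy]
    exact (evalHom hy).commutes c⟩
  have hval : ValuativeCriterion.Existence (X ↘ Spec (.of F)) := by
    have h2 : UniversallyClosed (X ↘ Spec (.of F)) := inferInstance
    rw [UniversallyClosed.eq_valuativeCriterion] at h2
    exact h2.1
  -- its extension to an `O`-valued point, whose standard part `x` is the limit sought
  obtain ⟨l, hl₁, hl₂⟩ := (hval { R := O, K := K, commSq := hsq, .. }).exists_lift
  dsimp only at l hl₁ hl₂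
  let x : Points F X := ⟨Spec.map (CommRingCat.ofHom st) ≫ l, by
    rw [Category.assoc, hl₂, ← Spec.map_comp, ← CommRingCat.ofHom_comp]
    have : st.comp (constGerm 𝒰) = RingHom.id F := RingHom.ext hst
    rw [this]; exact Spec.map_id _⟩
  refine ⟨x, ?_⟩
  obtain ⟨V', hV', hxV', -⟩ := exists_isAffineOpen_mem_and_subset (x := x.pt) (U := ⊤) trivial
  have hx : x ∈ ratPoints F V' := mem_ratPoints.2 hxV'
  have hlV' : ⊤ ≤ l ⁻¹ᵁ V' := by
    have _ : IsLocalHom st := IsLocalHom.of_surjective st fun c => ⟨_, hst c⟩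
    have h1 : Spec.map (CommRingCat.ofHom st) (IsLocalRing.closedPoint F) =
      IsLocalRing.closedPoint O := IsLocalRing.comap_closedPoint st
    have h2 : l (IsLocalRing.closedPoint O) ∈ V' := h1 ▸ hxV'
    exact (Scheme.preimage_eq_top_of_closedPoint_mem l h2).ge
  have hjV : ⊤ ≤ j ⁻¹ᵁ V := top_le_preimage_fromSpec hV φ
  have hjl : j = Spec.map (CommRingCat.ofHom (algebraMap O K)) ≫ l := hl₁.symm
  have hjV' : ⊤ ≤ j ⁻¹ᵁ V' := by
    rw [hjl]
    exact fun y _ => hlV' trivial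
  -- the `K`-valued point lies in `V ∩ V'`, hence so do almost all of the points
  let q : X := j (IsLocalRing.closedPoint K)
  obtain ⟨g, hgV', hqg⟩ := hV.exists_basicOpen_le (V := V')
    ⟨q, hjV' (Set.mem_univ (IsLocalRing.closedPoint K))⟩
    (hjV (Set.mem_univ (IsLocalRing.closedPoint K)))
  have hjg : ⊤ ≤ j ⁻¹ᵁ (X.basicOpen g) := by
    intro y _
    have : y = IsLocalRing.closedPoint K := Subsingleton.elim (α := PrimeSpectrum K) _ _
    rw [this]
    exact hqg
  have hg0 : φ g ≠ 0 := by
    have h1 := (isUnit_resFun_basicOpen g le_rfl).map (evalAt j hjg)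
    rw [evalAt_resFun _ hjg hjV, evalAt_fromSpec] at h1
    exact h1.ne_zero
  have hg𝒰 : ∀ᶠ y in (𝒰 : Filter (Points F X)), value g y ≠ 0 := by
    refine Ultrafilter.eventually_not.2 fun h => hg0 ?_
    exact Germ.coe_eq.2 h
  refine tendsto_of_tendsto_value (y := id) (l := (𝒰 : Filter (Points F X))) hV' hx ?_ fun f => ?_
  · filter_upwards [hV𝒰, hg𝒰] with y h1 h2
    exact ratPoints_mono hgV' ((mem_ratPoints_basicOpen g).2 ⟨h1, h2⟩)
  · have h1 : value f x = st (evalAt l hlV' f) := by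
      rw [← evalHom_apply hx]
      exact congr($(evalAt_comp hlV' st hx) f)
    rw [h1]
    refine hlim _ _ ?_
    have h2 : ((evalAt l hlV' f : O) : K) = evalAt j hjV' f := by
      have := evalAt_comp hlV' (algebraMap O K) (by rw [← hjl]; exact hjV')
      have h4 (j' : Spec (.of K) ⟶ X) (h : j' = j) (hj' : ⊤ ≤ j' ⁻¹ᵁ V') :
          evalAt j' hj' f = evalAt j hjV' f := by subst h; rfl
      rw [← h4 _ hl₁ (by rw [hl₁]; exact hjV'), this]
      rfl
    rw [h2]
    obtain ⟨a, n, ha⟩ := exists_resFun_eq_pow_mul hV g (resFun hgV' f)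
    have h3 := congr_arg (evalAt j hjg) ha
    rw [map_mul, map_pow, evalAt_resFun _ hjg hjV, evalAt_resFun _ hjg hjV, evalAt_fromSpec,
      evalAt_resFun _ hjg hjV'] at h3
    refine mul_left_cancel₀ (pow_ne_zero n hg0) (h3.symm.trans ?_)
    refine Germ.coe_eq.2 ?_
    filter_upwards [hV𝒰, hg𝒰] with y hy1 hy2
    have hy := (mem_ratPoints_basicOpen g).2 ⟨hy1, hy2⟩
    have h1 := congr_arg (evalHom hy) ha
    rwa [map_mul, map_pow, evalHom_apply, evalHom_apply, evalHom_apply, value_resFun _ _ hy,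
      value_resFun _ _ hy, value_resFun _ _ hy] at h1

end Compact

/-! ### Top forms and tangent frames -/

section TangentFrames

variable {F : Type u} [Field F] {A : Type u} [CommRing A] [Algebra F A]

/-- A tangent vector at a rational point is a linear functional on differential forms. -/
theorem IsTangent.exists_linear {e : A →ₐ[F] F} {D : A →ₗ[F] F} (hD : IsTangent e D) :
    ∃ ℓ : Ω[A⁄F] →+ F, (∀ a η, ℓ (a • η) = e a * ℓ η) ∧
      ∀ a, ℓ (KaehlerDifferential.D F A a) = D a := by
  let _ : Module A F := Module.compHom F (e : A →+* F)
  have hsmul (a : A) (t : F) : a • t = e a * t := rfl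
  have _ : IsScalarTower F A F := ⟨fun c a t => by
    rw [hsmul, hsmul, map_smul, smul_eq_mul, smul_eq_mul, mul_assoc]⟩
  let δ : Derivation F A F := Derivation.mk' D fun a b => by
    rw [hsmul, hsmul, hD a b]
  exact ⟨δ.liftKaehlerDifferential.toAddMonoidHom,
    fun a η => map_smul δ.liftKaehlerDifferential a η, fun a => by simp [δ]⟩

/-- The coordinates of the differential of a function on a basis `dh₁, …, dh_d` of the
differential forms are the partial derivatives; at a rational point they are a basis of the
space of tangent vectors, dual to `h₁, …, h_d`. -/
theorem exists_tangent_frame {d : ℕ} {h : Fin d → A} (b : Module.Basis (Fin d) A Ω[A⁄F])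
    (hb : ∀ i, b i = KaehlerDifferential.D F A (h i)) (e : A →ₐ[F] F) :
    ∃ E : Fin d → A →ₗ[F] F, (∀ i, IsTangent e (E i)) ∧
      (∀ i j, E i (h j) = if i = j then 1 else 0) ∧
      ∀ D : A →ₗ[F] F, IsTangent e D → ∀ a, D a = ∑ j, E j a * D (h j) := by
  classical
  refine ⟨fun i =>
    { toFun := fun a => e (b.repr (KaehlerDifferential.D F A a) i)
      map_add' := fun a a' => by simp
      map_smul' := fun c a => by
        rw [Derivation.map_smul, RingHom.id_apply,
          ← algebraMap_smul A c (KaehlerDifferential.D F A a), map_smul, Finsupp.smul_apply,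
          smul_eq_mul, map_mul, e.commutes]; rfl },
    fun i a a' => ?_, fun i j => ?_, fun D hD a => ?_⟩
  · change e (b.repr (KaehlerDifferential.D F A (a * a')) i) = _
    rw [Derivation.leibniz, map_add, map_smul, map_smul, Finsupp.add_apply, Finsupp.smul_apply,
      Finsupp.smul_apply, smul_eq_mul, smul_eq_mul, map_add, map_mul, map_mul]
    rfl
  · change e (b.repr (KaehlerDifferential.D F A (h j)) i) = _
    rw [← hb, b.repr_self, Finsupp.single_apply]
    simp [eq_comm, apply_ite e]
  · obtain ⟨ℓ, hℓ, hℓD⟩ := hD.exists_linear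
    rw [← hℓD, ← b.sum_repr (KaehlerDifferential.D F A a), map_sum]
    refine Finset.sum_congr rfl fun j _ => ?_
    rw [hℓ, hb, hℓD]
    rfl

/-- A generator of the top forms does not vanish on a frame of tangent vectors. -/
theorem exists_eval_form_ne_zero {d : ℕ} {h : Fin d → A} {e : A →ₐ[F] F}
    {E : Fin d → A →ₗ[F] F} (hE : ∀ i, IsTangent e (E i))
    (hEh : ∀ i j, E i (h j) = if i = j then 1 else 0)
    {η : ⋀[A]^d Ω[A⁄F]} (hη : Submodule.span A {η} = ⊤) :
    ∃ ev : (⋀[A]^d Ω[A⁄F]) →+ F, (∀ a η, ev (a • η) = e a * ev η) ∧ ev η ≠ 0 ∧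
      ∀ x : Fin d → A, ev (exteriorPower.ιMulti A d fun j => KaehlerDifferential.D F A (x j)) =
        (Matrix.of fun j i => E i (x j)).det := by
  obtain ⟨ev, hev, hevD⟩ := exists_eval_form e hE
  have h1 : (exteriorPower.ιMulti A d fun i => KaehlerDifferential.D F A (h i)) ∈
    Submodule.span A {η} := by
    rw [hη]; trivial
  obtain ⟨a, ha⟩ := Submodule.mem_span_singleton.1 h1
  have h2 := congr_arg ev ha
  rw [hev, hevD] at h2
  have h3 : (Matrix.of fun j i => E i (h j)) = 1 := by
    ext j i
    simp [hEh, Matrix.one_apply, eq_comm]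
  rw [h3, Matrix.det_one] at h2
  exact ⟨ev, hev, right_ne_zero_of_mul (h2.trans_ne one_ne_zero), hevD⟩

/-- If `dx₁ ∧ ⋯ ∧ dx_d` generates the top forms near a rational point, then the functions
`x₁, …, x_d` separate the tangent vectors there. -/
theorem eq_zero_of_span_wedge {d : ℕ} {h x : Fin d → A} (b : Module.Basis (Fin d) A Ω[A⁄F])
    (hb : ∀ i, b i = KaehlerDifferential.D F A (h i)) (e : A →ₐ[F] F)
    {η : ⋀[A]^d Ω[A⁄F]} (hη : Submodule.span A {η} = ⊤) {a : A} (ha : e a ≠ 0)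
    (hx : (exteriorPower.ιMulti A d fun i => KaehlerDifferential.D F A (x i)) = a • η)
    {D : A →ₗ[F] F} (hD : IsTangent e D) (hDx : ∀ i, D (x i) = 0) : D = 0 := by
  obtain ⟨E, hE, hEh, hED⟩ := exists_tangent_frame b hb e
  obtain ⟨ev, hev, hev0, hevD⟩ := exists_eval_form_ne_zero hE hEh hη
  have hdet : (Matrix.of fun j i => E i (x j)).det ≠ 0 := by
    rw [← hevD, hx, hev]
    exact mul_ne_zero ha hev0
  have h1 : (Matrix.of fun j i => E i (x j)).mulVec (fun j => D (h j)) = 0 := by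
    ext k
    rw [Matrix.mulVec, dotProduct, Pi.zero_apply, ← hDx k, hED D hD]
    rfl
  have h2 := Matrix.eq_zero_of_mulVec_eq_zero hdet h1
  ext a
  rw [hED D hD]
  simp [fun j => show D (h j) = 0 from congr_fun h2 j]

/-- Functions with independent differentials at a rational point belong to a system of functions
`x₁, …, x_d` with independent differentials. -/
theorem exists_completion {d : ℕ} {h : Fin d → A} (b : Module.Basis (Fin d) A Ω[A⁄F])
    (hb : ∀ i, b i = KaehlerDifferential.D F A (h i)) (e : A →ₐ[F] F)
    {η : ⋀[A]^d Ω[A⁄F]} (hη : Submodule.span A {η} = ⊤) {J : Type*} [Fintype J] [DecidableEq J]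
    {f : J → A} {D : J → A →ₗ[F] F} (hD : ∀ α, IsTangent e (D α))
    (hDf : ∀ α β, D α (f β) = if α = β then 1 else 0) :
    ∃ (x : Fin d → A) (i : J → Fin d), Function.Injective i ∧ (∀ α, x (i α) = f α) ∧
      ∃ a : A, e a ≠ 0 ∧
        (exteriorPower.ιMulti A d fun j => KaehlerDifferential.D F A (x j)) = a • η := by
  obtain ⟨E, hE, hEh, hED⟩ := exists_tangent_frame b hb e
  have hind : LinearIndependent F fun β (j : Fin d) => E j (f β) := by
    rw [Fintype.linearIndependent_iff]
    intro c hc β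
    have h1 : ∑ j, (∑ γ, c γ • fun j => E j (f γ)) j * D β (h j) = 0 := by
      rw [hc]; simp
    have h2 : ∑ j, (∑ γ, c γ • fun j => E j (f γ)) j * D β (h j) = ∑ γ, c γ * D β (f γ) := by
      simp only [Finset.sum_apply, Pi.smul_apply, smul_eq_mul, Finset.sum_mul]
      rw [Finset.sum_comm]
      refine Finset.sum_congr rfl fun γ _ => ?_
      rw [hED _ (hD β), Finset.mul_sum]
      exact Finset.sum_congr rfl fun j _ => mul_assoc _ _ _
    rw [h2] at h1
    simpa [hDf] using h1
  -- complete the gradients of the `f β` to a basis; the new vectors are the gradients of linear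
  -- combinations of `h₁, …, h_d`
  let B := Module.Basis.sumExtend hind
  have _ : Finite (J ⊕ Module.Basis.sumExtendIndex hind) := Module.Finite.finite_basis B
  let _ : Fintype (J ⊕ Module.Basis.sumExtendIndex hind) := Fintype.ofFinite _
  have hcard : Fintype.card (J ⊕ Module.Basis.sumExtendIndex hind) = d := by
    rw [← Module.finrank_eq_card_basis B, Module.finrank_fin_fun]
  let σ : (J ⊕ Module.Basis.sumExtendIndex hind) ≃ Fin d := Fintype.equivFinOfCardEq hcard
  let y : (J ⊕ Module.Basis.sumExtendIndex hind) → A :=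
    Sum.elim f fun t => ∑ j, (B (Sum.inr t) j) • h j
  have hy (t) : (fun j => E j (y t)) = B t := by
    rcases t with β | t
    · simp only [y, Sum.elim_inl, B, Module.Basis.sumExtend, Module.Basis.reindex_apply,
        Module.Basis.extend_apply_self]
      rfl
    · ext j
      simp [y, hEh]
  obtain ⟨ev, hev, hevD⟩ := exists_eval_form e hE
  have h1 : (exteriorPower.ιMulti A d fun i => KaehlerDifferential.D F A (y (σ.symm i))) ∈
    Submodule.span A {η} := by rw [hη]; trivial
  obtain ⟨a, ha⟩ := Submodule.mem_span_singleton.1 h1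
  refine ⟨fun i => y (σ.symm i), fun β => σ (Sum.inl β), σ.injective.comp Sum.inl_injective,
    fun β => by simp [y], a, fun ha0 => ?_, ha.symm⟩
  have h2 := congr_arg ev ha
  rw [hev, hevD, ha0, zero_mul] at h2
  have h3 : LinearIndependent F (Matrix.of fun j i => E i (y (σ.symm j))).row := by
    have : (Matrix.of fun j i => E i (y (σ.symm j))).row = (B.reindex σ) := by
      ext1 j
      rw [Module.Basis.reindex_apply, ← hy]; rfl
    rw [this]
    exact (B.reindex σ).linearIndependent
  rw [Matrix.linearIndependent_rows_iff_isUnit, Matrix.isUnit_iff_isUnit_det, ← h2] at h3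
  exact not_isUnit_zero h3

/-- A standard smooth algebra of relative dimension `d` has a basis of differentials. -/
theorem exists_basis_differentials (d : ℕ)
    [Algebra.IsStandardSmoothOfRelativeDimension d F A] [Nontrivial A] :
    ∃ (h : Fin d → A) (b : Module.Basis (Fin d) A Ω[A⁄F]),
      ∀ i, b i = KaehlerDifferential.D F A (h i) := by
  obtain ⟨ι, σ, _, _, P, hP⟩ :=
    ‹Algebra.IsStandardSmoothOfRelativeDimension d F A›.out
  let b := P.basisKaehler
  let _ : Fintype ι := Fintype.ofFinite ι
  let _ := Fintype.ofFinite ((Set.range P.map)ᶜ : Set _)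
  have hcard : Fintype.card ((Set.range P.map)ᶜ : Set _) = d := by
    have h1 := P.rank_kaehlerDifferential
    rw [rank_eq_card_basis b, hP] at h1
    exact_mod_cast h1
  let τ := Fintype.equivFinOfCardEq hcard
  exact ⟨fun i => P.val (τ.symm i), b.reindex τ, fun i => by
    rw [Module.Basis.reindex_apply, P.basisKaehler_apply]⟩

variable {B : Type u} [CommRing B] [Algebra F B]

theorem formsMap_smul (d : ℕ) (φ : A →ₐ[F] B) (a : A) (η : ⋀[A]^d Ω[A⁄F]) :
    formsMap d φ (a • η) = φ a • formsMap d φ η := by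
  let _ := φ.toRingHom.toAlgebra
  have _ : IsScalarTower F A B := IsScalarTower.of_algebraMap_eq fun x => (φ.commutes x).symm
  refine (map_smul (exteriorPower.alternatingMapLinearEquiv _) a η).trans ?_
  exact algebra_compatible_smul B a _

theorem formsMap_ιMulti (d : ℕ) (φ : A →ₐ[F] B) (x : Fin d → A) :
    formsMap d φ (exteriorPower.ιMulti A d fun i => KaehlerDifferential.D F A (x i)) =
      exteriorPower.ιMulti B d fun i => KaehlerDifferential.D F B (φ (x i)) := by
  let _ := φ.toRingHom.toAlgebra
  have _ : IsScalarTower F A B := IsScalarTower.of_algebraMap_eq fun x => (φ.commutes x).symm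
  refine (exteriorPower.alternatingMapLinearEquiv_apply_ιMulti _ _).trans ?_
  change exteriorPower.ιMulti B d (fun i => KaehlerDifferential.map F F A B _) = _
  congr 1
  ext1 i
  rw [KaehlerDifferential.map_D]; rfl

theorem formsMap_comp (d : ℕ) {C : Type u} [CommRing C] [Algebra F C] (φ : A →ₐ[F] B)
    (ψ : B →ₐ[F] C) (η : ⋀[A]^d Ω[A⁄F]) :
    formsMap d ψ (formsMap d φ η) = formsMap d (ψ.comp φ) η := by
  have h1 := exteriorPower.ιMulti_span_of_span A d Ω[A⁄F]
    (KaehlerDifferential.span_range_derivation F A)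
  have h2 : η ∈ Submodule.span A (exteriorPower.ιMulti A d ''
      {a | Set.range a ⊆ Set.range (KaehlerDifferential.D F A)}) := by rw [h1]; trivial
  refine Submodule.span_induction ?_ ?_ ?_ ?_ h2
  · rintro _ ⟨y, hy, rfl⟩
    choose a ha using fun i => hy (Set.mem_range_self i)
    obtain rfl : (fun i => KaehlerDifferential.D F A (a i)) = y := funext ha
    rw [formsMap_ιMulti, formsMap_ιMulti, formsMap_ιMulti]
    rfl
  · simp only [map_zero]
  · intro x y _ _ hx hy
    rw [map_add, map_add, map_add, hx, hy]
  · intro a x _ hx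
    rw [formsMap_smul, formsMap_smul, formsMap_smul, hx]
    rfl

/-- A generator of the top forms remains one after localization. -/
theorem span_formsMap_eq_top (d : ℕ) (φ : A →ₐ[F] B) (M : Submonoid A)
    (hφ : letI := φ.toRingHom.toAlgebra; IsLocalization M B) {η : ⋀[A]^d Ω[A⁄F]}
    (hη : Submodule.span A {η} = ⊤) : Submodule.span B {formsMap d φ η} = ⊤ := by
  let _ := φ.toRingHom.toAlgebra
  have _ : IsScalarTower F A B := IsScalarTower.of_algebraMap_eq fun x => (φ.commutes x).symm
  have h1 := KaehlerDifferential.span_range_map_derivation_of_isLocalization F A B M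
  have h2 := exteriorPower.ιMulti_span_of_span B d Ω[B⁄F] h1
  rw [eq_top_iff, ← h2, Submodule.span_le]
  rintro _ ⟨y, hy, rfl⟩
  have h3 (i : Fin d) : ∃ a, y i = KaehlerDifferential.D F B (φ a) := by
    obtain ⟨a, ha⟩ := hy (Set.mem_range_self i)
    refine ⟨a, ha.symm.trans ?_⟩
    rw [Function.comp_apply, KaehlerDifferential.map_D]; rfl
  choose a ha using h3
  have h4 : (exteriorPower.ιMulti A d fun i => KaehlerDifferential.D F A (a i)) ∈
    Submodule.span A {η} := by rw [hη]; trivial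
  obtain ⟨c, hc⟩ := Submodule.mem_span_singleton.1 h4
  have h5 := congr_arg (formsMap d φ) hc
  rw [formsMap_smul, formsMap_ιMulti] at h5
  rw [funext ha]
  exact Submodule.mem_span_singleton.2 ⟨_, h5⟩

end TangentFrames

/-! ### Analytic charts from algebraic coordinates -/

section Charts

open _root_.Filter _root_.Topology

variable {F : Type u} [NontriviallyNormedField F] [CompleteSpace F]
  {A : Type u} [CommRing A] [Algebra F A]
  {ι σ : Type} [Fintype ι] [Fintype σ] {val : ι → A} {rel : σ → MvPolynomial ι F}

theorem hasStrictFDerivAt_eval (r : MvPolynomial ι F) (y : ι → F) :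
    HasStrictFDerivAt (fun y : ι → F => MvPolynomial.eval y r)
      (fderiv F (fun y : ι → F => MvPolynomial.eval y r) y) y :=
  (AnalyticOnNhd.eval_mvPolynomial r y (Set.mem_univ y)).hasStrictFDerivAt

omit [CompleteSpace F] [Fintype ι] [Fintype σ] in
/-- A solution of the equations defining an algebra is a rational point. -/
theorem exists_algHom_of_eval_eq_zero
    (hsurj : Function.Surjective (MvPolynomial.aeval (R := F) val))
    (hker : ∀ r, MvPolynomial.aeval val r = 0 → r ∈ Ideal.span (Set.range rel))
    {y : ι → F} (hy : ∀ j, MvPolynomial.eval y (rel j) = 0) :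
    ∃ e : A →ₐ[F] F, ∀ r, e (MvPolynomial.aeval val r) = MvPolynomial.eval y r := by
  have h1 : ∀ r ∈ RingHom.ker (MvPolynomial.aeval (R := F) val), MvPolynomial.aeval y r = 0 := by
    intro r hr
    have h2 : Ideal.span (Set.range rel) ≤ RingHom.ker (MvPolynomial.aeval (R := F) y) := by
      rw [Ideal.span_le]
      rintro _ ⟨j, rfl⟩
      exact hy j
    exact h2 (hker r hr)
  let e := (Ideal.Quotient.liftₐ (RingHom.ker (MvPolynomial.aeval (R := F) val))
    (MvPolynomial.aeval (R := F) y) h1).comp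
      (Ideal.quotientKerAlgEquivOfSurjective hsurj).symm.toAlgHom
  refine ⟨e, fun r => ?_⟩
  have h2 : (Ideal.quotientKerAlgEquivOfSurjective hsurj).symm (MvPolynomial.aeval val r) =
      Ideal.Quotient.mk _ r := by
    rw [AlgEquiv.symm_apply_eq]
    rfl
  change Ideal.Quotient.liftₐ _ _ h1 ((Ideal.quotientKerAlgEquivOfSurjective hsurj).symm _) = _
  rw [h2]
  rfl

omit [Fintype σ] in
/-- A solution of the linearized equations is a tangent vector. -/
theorem exists_isTangent_of_fderiv_eq_zero {s : A → MvPolynomial ι F}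
    (hs : ∀ a, MvPolynomial.aeval val (s a) = a)
    (hker : ∀ r, MvPolynomial.aeval val r = 0 → r ∈ Ideal.span (Set.range rel))
    {y : ι → F} (hy : ∀ j, MvPolynomial.eval y (rel j) = 0) {e : A →ₐ[F] F}
    (he : ∀ r, e (MvPolynomial.aeval val r) = MvPolynomial.eval y r) {v : ι → F}
    (hv : ∀ j, fderiv F (fun y : ι → F => MvPolynomial.eval y (rel j)) y v = 0) :
    ∃ D : A →ₗ[F] F, IsTangent e D ∧ ∀ r, D (MvPolynomial.aeval val r) =
      fderiv F (fun y : ι → F => MvPolynomial.eval y r) y v := by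
  have hdiff (r : MvPolynomial ι F) :
      DifferentiableAt F (fun y : ι → F => MvPolynomial.eval y r) y :=
    (hasStrictFDerivAt_eval r y).differentiableAt
  let δ (r : MvPolynomial ι F) : F := fderiv F (fun y : ι → F => MvPolynomial.eval y r) y v
  have hadd (r t) : δ (r + t) = δ r + δ t := by
    simp only [δ, map_add]
    rw [fderiv_fun_add (hdiff r) (hdiff t)]; rfl
  have hmul (r t) : δ (r * t) = MvPolynomial.eval y r * δ t + MvPolynomial.eval y t * δ r := by
    simp only [δ, map_mul]
    rw [fderiv_fun_mul (hdiff r) (hdiff t)]; rfl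
  have hC (c : F) : δ (MvPolynomial.C c) = 0 := by
    simp [δ]
  have hideal : ∀ r ∈ Ideal.span (Set.range rel), MvPolynomial.eval y r = 0 ∧ δ r = 0 := by
    intro r hr
    refine Submodule.span_induction ?_ ?_ ?_ ?_ hr
    · rintro _ ⟨j, rfl⟩
      exact ⟨hy j, hv j⟩
    · exact ⟨map_zero _, by rw [← MvPolynomial.C_0]; exact hC 0⟩
    · rintro a b _ _ ⟨ha, ha'⟩ ⟨hb, hb'⟩
      exact ⟨by rw [map_add, ha, hb, add_zero], by rw [hadd, ha', hb', add_zero]⟩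
    · rintro c a _ ⟨ha, ha'⟩
      exact ⟨by rw [smul_eq_mul, map_mul, ha, mul_zero], by
        rw [smul_eq_mul, hmul, ha, ha', zero_mul, mul_zero, add_zero]⟩
  have hwd (r t) (h : MvPolynomial.aeval val r = MvPolynomial.aeval val t) : δ r = δ t := by
    have h1 : MvPolynomial.aeval val (r - t) = 0 := by rw [map_sub, h, sub_self]
    have h2 := (hideal _ (hker _ h1)).2
    have h3 := hadd (r - t) t
    rw [sub_add_cancel, h2, zero_add] at h3
    exact h3
  refine ⟨{ toFun := fun a => δ (s a), map_add' := fun a b => ?_, map_smul' := fun c a => ?_ },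
    fun a b => ?_, fun r => ?_⟩
  · rw [← hadd]
    exact hwd _ _ (by rw [map_add, hs, hs, hs])
  · have h1 : δ (s (c • a)) = δ (MvPolynomial.C c * s a) := hwd _ _ (by
      rw [map_mul, hs, hs, MvPolynomial.aeval_C, Algebra.smul_def])
    rw [h1, hmul, hC, mul_zero, add_zero, MvPolynomial.eval_C]; rfl
  · have h1 : δ (s (a * b)) = δ (s a * s b) := hwd _ _ (by rw [map_mul, hs, hs, hs])
    change δ (s (a * b)) = e a * δ (s b) + e b * δ (s a)
    rw [h1, hmul, ← he, ← he, hs, hs]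
  · exact hwd _ _ (hs _)

variable {X : Scheme.{u}} [X.Over (Spec (.of F))]

/-- Functions `x₁, …, x_d` whose differentials separate the tangent vectors at a rational point `p`
are local analytic coordinates near `p`, by the inverse function theorem. -/
theorem exists_chart {W : X.Opens} (hW : IsAffineOpen W) (d : ℕ)
    [Algebra.IsStandardSmoothOfRelativeDimension d F Γ(X, W)] {p : Points F X}
    (hp : p ∈ ratPoints F W) {x : Fin d → Γ(X, W)}
    (hx : ∀ D, IsTangent (evalHom hp) D → (∀ i, D (x i) = 0) → D = 0) :
    ∃ E : OpenPartialHomeomorph (Points F X) (Fin d → F), p ∈ E.source ∧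
      E.source ⊆ ratPoints F W ∧ (∀ q ∈ E.source, E q = fun i => value (x i) q) ∧
      ∀ h : Γ(X, W), ∃ A : (Fin d → F) →L[F] F,
        HasStrictFDerivAt (fun y => value h (E.symm y)) A (E p) := by
  classical
  obtain ⟨ι, σ, _, _, P, hP⟩ :=
    ‹Algebra.IsStandardSmoothOfRelativeDimension d F Γ(X, W)›.out
  let _ := Fintype.ofFinite ι
  let _ := Fintype.ofFinite σ
  have hle : Nat.card σ ≤ Nat.card ι := P.card_relations_le_card_vars_of_isFinite
  have hcard : Fintype.card ι = d + Fintype.card σ := by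
    have h1 : Nat.card ι - Nat.card σ = d := hP
    rw [← Nat.card_eq_fintype_card, ← Nat.card_eq_fintype_card]
    omega
  let rel : σ → MvPolynomial ι F := P.relation
  let s : Γ(X, W) → MvPolynomial ι F := P.σ
  have hs (a) : MvPolynomial.aeval P.val (s a) = a := P.aeval_val_σ a
  have hrel (j) : MvPolynomial.aeval P.val (rel j) = 0 := P.aeval_val_relation j
  have hker (r : MvPolynomial ι F) (hr : MvPolynomial.aeval P.val r = 0) :
      r ∈ Ideal.span (Set.range rel) := by
    have h1 := P.span_range_relation_eq_ker
    rw [P.ker_eq_ker_aeval_val] at h1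
    exact h1.ge hr
  have hsurj : Function.Surjective (MvPolynomial.aeval (R := F) P.val) := fun a => ⟨s a, hs a⟩
  -- the embedding of the points of `W` into affine space
  let em (q : Points F X) : ι → F := fun i => value (P.val i) q
  have hem {q : Points F X} (hq : q ∈ ratPoints F W) (r : MvPolynomial ι F) :
      value (MvPolynomial.aeval P.val r) q = MvPolynomial.eval (em q) r := by
    have h1 : (evalHom hq).comp (MvPolynomial.aeval P.val) = MvPolynomial.aeval (em q) := by
      ext i
      simp [em, evalHom_apply]
    rw [← evalHom_apply hq]
    exact congr($h1 r)
  have hemrel {q : Points F X} (hq : q ∈ ratPoints F W) (j) :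
      MvPolynomial.eval (em q) (rel j) = 0 := by
    rw [← hem hq, hrel, ← evalHom_apply hq, map_zero]
  -- the coordinates and the relations together define a local homeomorphism of affine space; the
  -- rational points are the zeros of the relations
  let y₀ := em p
  let Φ : (ι → F) → (Fin d → F) × (σ → F) := fun y =>
    (fun k => MvPolynomial.eval y (s (x k)), fun j => MvPolynomial.eval y (rel j))
  let Φ' : (ι → F) →L[F] (Fin d → F) × (σ → F) :=
    (ContinuousLinearMap.pi fun k =>
      fderiv F (fun y : ι → F => MvPolynomial.eval y (s (x k))) y₀).prod
    (ContinuousLinearMap.pi fun j => fderiv F (fun y : ι → F => MvPolynomial.eval y (rel j)) y₀)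
  have hΦ : HasStrictFDerivAt Φ Φ' y₀ :=
    (hasStrictFDerivAt_pi.2 fun k => hasStrictFDerivAt_eval _ _).prodMk
      (hasStrictFDerivAt_pi.2 fun j => hasStrictFDerivAt_eval _ _)
  -- a vector killed by the derivative is a tangent vector on which the coordinates vanish
  have hinj : Function.Injective (Φ' : (ι → F) →ₗ[F] (Fin d → F) × (σ → F)) := by
    rw [← LinearMap.ker_eq_bot, LinearMap.ker_eq_bot']
    intro v hv
    obtain ⟨D, hD, hDr⟩ := exists_isTangent_of_fderiv_eq_zero (e := evalHom hp) (v := v) hs hker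
      (hemrel hp) (fun r => by rw [evalHom_apply, hem hp]) fun j =>
        congr_fun (congr_arg Prod.snd hv) j
    have hD0 := hx D hD fun k => by
      have := hDr (s (x k))
      rw [hs] at this
      rw [this]
      exact congr_fun (congr_arg Prod.fst hv) k
    ext i
    have h1 := hDr (MvPolynomial.X i)
    rw [hD0] at h1
    have h2 : HasFDerivAt (fun y : ι → F => MvPolynomial.eval y (MvPolynomial.X i))
        (ContinuousLinearMap.proj (R := F) (φ := fun _ : ι => F) i) y₀ := by
      simp only [MvPolynomial.eval_X]
      exact hasFDerivAt_apply i y₀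
    rw [h2.fderiv] at h1
    exact h1.symm
  let eΦ : (ι → F) ≃L[F] (Fin d → F) × (σ → F) :=
    (LinearEquiv.ofInjectiveOfFinrankEq _ hinj (by simp [hcard])).toContinuousLinearEquiv
  have heΦ : (eΦ : (ι → F) →L[F] (Fin d → F) × (σ → F)) = Φ' := by
    ext1 v
    exact LinearMap.congr_fun (LinearEquiv.coe_ofInjectiveOfFinrankEq _ hinj (by simp [hcard])) v
  rw [← heΦ] at hΦ
  let Ψ := hΦ.toOpenPartialHomeomorph Φ
  have hΨ (y) : Ψ y = Φ y := rfl
  have hinv (z : Fin d → F) : ∃ q : Points F X, (z, 0) ∈ Ψ.target → q ∈ ratPoints F W ∧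
      em q = Ψ.symm (z, 0) := by
    by_cases hz : (z, 0) ∈ Ψ.target
    · have h1 : Φ (Ψ.symm (z, 0)) = (z, 0) := Ψ.right_inv hz
      obtain ⟨e, he⟩ := exists_algHom_of_eval_eq_zero hsurj hker
        (y := Ψ.symm (z, 0)) fun j => congr_fun (congr_arg Prod.snd h1) j
      obtain ⟨q, hq, hqe⟩ := exists_point_of_algHom hW e
      refine ⟨q, fun _ => ⟨hq, ?_⟩⟩
      ext i
      have := he (MvPolynomial.X i)
      rw [MvPolynomial.aeval_X, MvPolynomial.eval_X, ← hqe, evalHom_apply] at this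
      exact this
    · exact ⟨p, fun h => absurd h hz⟩
  choose inv hinv using hinv
  have hΦem {q : Points F X} (hq : q ∈ ratPoints F W) : Φ (em q) = (fun k => value (x k) q, 0) := by
    refine Prod.ext (funext fun k => ?_) (funext fun j => hemrel hq j)
    change MvPolynomial.eval (em q) (s (x k)) = _
    rw [← hem hq, hs]
  have hemcont : ContinuousOn em (ratPoints F W) :=
    continuousOn_pi.2 fun i => continuousOn_value _
  have hinvval {z : Fin d → F} (hz : (z, 0) ∈ Ψ.target) (h : Γ(X, W)) :
      value h (inv z) = MvPolynomial.eval (Ψ.symm (z, 0)) (s h) := by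
    obtain ⟨h1, h2⟩ := hinv z hz
    rw [← h2, ← hem h1, hs]
  have hz0 : Continuous fun z : Fin d → F => (z, (0 : σ → F)) := by fun_prop
  let E : OpenPartialHomeomorph (Points F X) (Fin d → F) :=
    { toFun := fun q k => value (x k) q
      invFun := inv
      source := ratPoints F W ∩ em ⁻¹' Ψ.source
      target := {z | (z, 0) ∈ Ψ.target}
      map_source' := fun q hq => by
        have h1 := Ψ.map_source hq.2
        rw [hΨ, hΦem hq.1] at h1
        exact h1
      map_target' := fun z hz => ⟨(hinv z hz).1, by
        rw [Set.mem_preimage, (hinv z hz).2]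
        exact Ψ.map_target hz⟩
      left_inv' := fun q hq => by
        have h1 := Ψ.map_source hq.2
        have h2 := Ψ.left_inv hq.2
        rw [hΨ, hΦem hq.1] at h1 h2
        obtain ⟨h3, h4⟩ := hinv _ h1
        refine ext_of_value_eq hW h3 hq.1 fun f => ?_
        rw [hinvval h1, h2, ← hem hq.1, hs]
      right_inv' := fun z hz => by
        obtain ⟨h1, h2⟩ := hinv z hz
        have h3 := hΦem h1
        have h4 : Φ (Ψ.symm (z, 0)) = (z, 0) := Ψ.right_inv hz
        rw [h2, h4] at h3
        exact (congr_arg Prod.fst h3).symm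
      open_source := hemcont.isOpen_inter_preimage (isOpen_ratPoints W) Ψ.open_source
      open_target := Ψ.open_target.preimage hz0
      continuousOn_toFun := (continuousOn_pi.2 fun k => continuousOn_value _).mono
        Set.inter_subset_left
      continuousOn_invFun := fun z hz => by
        refine tendsto_of_tendsto_value hW (hinv z hz).1 ?_ fun f => ?_
        · filter_upwards [self_mem_nhdsWithin] with z' hz'
          exact (hinv z' hz').1
        · rw [hinvval hz]
          have h1 : Tendsto (fun z' : Fin d → F => MvPolynomial.eval (Ψ.symm (z', 0)) (s f)) (𝓝 z)
              (𝓝 (MvPolynomial.eval (Ψ.symm (z, 0)) (s f))) := by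
            have h2 : ContinuousAt (fun z' : Fin d → F => Ψ.symm (z', 0)) z :=
              ContinuousAt.comp (f := fun z' : Fin d → F => (z', (0 : σ → F)))
                (Ψ.continuousAt_symm hz) hz0.continuousAt
            exact ((hasStrictFDerivAt_eval (s f) _).hasFDerivAt.continuousAt.tendsto).comp h2
          refine (h1.mono_left nhdsWithin_le_nhds).congr' ?_
          filter_upwards [self_mem_nhdsWithin] with z' hz'
          rw [hinvval hz'] }
  have hpE : p ∈ E.source := ⟨hp, hΦ.mem_toOpenPartialHomeomorph_source⟩
  refine ⟨E, hpE, Set.inter_subset_left, fun q _ => rfl, fun h => ?_⟩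
  have h0 : Φ y₀ = (E p, 0) := hΦem hp
  have h1 : HasStrictFDerivAt Ψ.symm (eΦ.symm : (Fin d → F) × (σ → F) →L[F] (ι → F)) (E p, 0) := by
    rw [← h0]; exact hΦ.to_localInverse
  have h2 : HasStrictFDerivAt (fun z : Fin d → F => (z, (0 : σ → F)))
    ((ContinuousLinearMap.id F (Fin d → F)).prod 0) (E p) :=
    (hasStrictFDerivAt_id (E p)).prodMk (hasStrictFDerivAt_const _ _)
  have h3 := HasStrictFDerivAt.comp (E p) (hasStrictFDerivAt_eval (s h) _)
    (HasStrictFDerivAt.comp (E p) h1 h2)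
  refine ⟨_, h3.congr_of_eventuallyEq ?_⟩
  filter_upwards [E.open_target.mem_nhds (E.map_source hpE)] with z hz
  exact (hinvval hz h).symm

end Charts

/-! ### Comparison of the measures defined by two systems of coordinates -/

section Restriction

variable {F : Type u} [Field F] {X : Scheme.{u}} [X.Over (Spec (.of F))]

theorem resAlg_apply {V W : X.Opens} (h : W ≤ V) (f : Γ(X, V)) :
    resAlg (F := F) h f = resFun h f := rfl

theorem formsMap_wedge {d : ℕ} {V W : X.Opens} (h : W ≤ V) (x : Fin d → Γ(X, V)) :
    formsMap d (resAlg (F := F) h) (wedge F x) = wedge F fun i => resFun h (x i) :=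
  formsMap_ιMulti d (resAlg h) x

theorem span_formsMap_resAlg {d : ℕ} {V W : X.Opens} (hV : IsAffineOpen V) (h : W ≤ V)
    {g : Γ(X, V)} (hg : W = X.basicOpen g) {η : Forms F d V}
    (hη : Submodule.span Γ(X, V) {η} = ⊤) :
    Submodule.span Γ(X, W) {formsMap d (resAlg (F := F) h) η} = ⊤ := by
  subst hg
  exact span_formsMap_eq_top d (resAlg h) (Submonoid.powers g) (hV.isLocalization_basicOpen g) hη

theorem span_wedge_res {d : ℕ} {V W : X.Opens} (hV : IsAffineOpen V) (h : W ≤ V)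
    {g : Γ(X, V)} (hg : W = X.basicOpen g) {x : Fin d → Γ(X, V)}
    (hx : Submodule.span Γ(X, V) {wedge F x} = ⊤) :
    Submodule.span Γ(X, W) {wedge F fun i => resFun h (x i)} = ⊤ := by
  rw [← formsMap_wedge]
  exact span_formsMap_resAlg hV h hg hx

/-- A smooth scheme of dimension `d` over a field has a basis of affine open sets whose algebras are
standard smooth. -/
theorem exists_basicOpen_isStandardSmooth (d : ℕ)
    [SmoothOfRelativeDimension d (X ↘ Spec (.of F))] {V : X.Opens} (hV : IsAffineOpen V)
    {p : X} (hp : p ∈ V) : ∃ g : Γ(X, V), p ∈ X.basicOpen g ∧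
      Algebra.IsStandardSmoothOfRelativeDimension d F Γ(X, X.basicOpen g) := by
  obtain ⟨U₀, hU₀, V₀, hV₀, hpV₀, e, hsm⟩ :=
    SmoothOfRelativeDimension.exists_isStandardSmoothOfRelativeDimension (n := d)
      (f := X ↘ Spec (.of F)) p
  obtain ⟨g, g₀, hg, hpg⟩ := exists_basicOpen_le_affine_inter hV hV₀ p ⟨hp, hpV₀⟩
  refine ⟨g, hpg, ?_⟩
  have hU₀' : U₀ = ⊤ := by
    refine top_le_iff.1 fun y _ => ?_
    have : y = (X ↘ Spec (.of F)) p := Subsingleton.elim (α := PrimeSpectrum F) _ _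
    rw [this]
    exact e hpV₀
  subst hU₀'
  have hle : X.basicOpen g ≤ V₀ := hg.trans_le (X.basicOpen_le g₀)
  have h1 : RingHom.IsStandardSmoothOfRelativeDimension 0
      (X.presheaf.map (homOfLE hle).op).hom := by
    have key : ∀ (W : X.Opens) (hW : W = X.basicOpen g₀) (hWV : W ≤ V₀),
        RingHom.IsStandardSmoothOfRelativeDimension 0 (X.presheaf.map (homOfLE hWV).op).hom := by
      rintro W rfl hWV
      have := hV₀.isLocalization_basicOpen g₀
      exact RingHom.IsStandardSmoothOfRelativeDimension.algebraMap_isLocalizationAway g₀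
    exact key _ hg hle
  have h2 := (h1.comp hsm).comp (RingHom.IsStandardSmoothOfRelativeDimension.equiv
    (Scheme.ΓSpecIso (.of F)).symm.commRingCatIsoToRingEquiv)
  rw [add_zero, zero_add] at h2
  rw [← RingHom.isStandardSmoothOfRelativeDimension_algebraMap]
  have h3 : (X ↘ Spec (.of F)).appLE ⊤ V₀ e ≫ X.presheaf.map (homOfLE hle).op =
      (X ↘ Spec (.of F)).appTop ≫ X.presheaf.map (homOfLE le_top).op :=
    Scheme.Hom.appLE_map _ _ _
  have h4 : (Scheme.ΓSpecIso (.of F)).inv ≫ (X ↘ Spec (.of F)).appLE ⊤ V₀ e ≫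
      X.presheaf.map (homOfLE hle).op =
      CommRingCat.ofHom (algebraMap F Γ(X, X.basicOpen g)) := by rw [h3]; rfl
  have h5 : algebraMap F Γ(X, X.basicOpen g) = ((Scheme.ΓSpecIso (.of F)).inv ≫
      (X ↘ Spec (.of F)).appLE ⊤ V₀ e ≫ X.presheaf.map (homOfLE hle).op).hom := by
    rw [h4]; rfl
  rw [h5]
  exact h2

end Restriction

section Transition

open _root_.Filter _root_.Topology

variable {F : Type u} [NontriviallyNormedField F] [CompleteSpace F] {X : Scheme.{u}}
  [X.Over (Spec (.of F))] {d : ℕ} {U : X.Opens} {ω : DForm F d U}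

/-- The change of coordinates is strictly differentiable, and its Jacobian determinant is the
quotient of the coefficients of the form: both sides compare `dx₁ ∧ ⋯ ∧ dx_d` and
`dx'₁ ∧ ⋯ ∧ dx'_d` on the tangent vectors given by the second system of coordinates. -/
theorem Coordinates.exists_transition [SmoothOfRelativeDimension d (X ↘ Spec (.of F))]
    (c c' : Coordinates ω) {x : Points F X} (hx : x ∈ c.chart.source) (hx' : x ∈ c'.chart.source) :
    ∃ A : (Fin d → F) →L[F] (Fin d → F),
      HasStrictFDerivAt (fun y => c.chart (c'.chart.symm y)) A (c'.chart x) ∧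
      value c'.g x = value c.g x * LinearMap.det A.toLinearMap := by
  have hxV := mem_ratPoints.1 (c.source_subset hx)
  have hxV' := mem_ratPoints.1 (c'.source_subset hx')
  obtain ⟨f, f', hff', hpf⟩ := exists_basicOpen_le_affine_inter c.isAffineOpen c'.isAffineOpen x.pt
    ⟨hxV, hxV'⟩
  set W₀ := X.basicOpen f
  have hW₀ : IsAffineOpen W₀ := c.isAffineOpen.basicOpen f
  obtain ⟨g, hpg, hsm⟩ := exists_basicOpen_isStandardSmooth (F := F) d hW₀ hpf
  set W := X.basicOpen g with hWg
  have hW : IsAffineOpen W := hW₀.basicOpen g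
  have hWW₀ : W ≤ W₀ := X.basicOpen_le g
  have hW₀V : W₀ ≤ c.V := X.basicOpen_le f
  have hW₀V' : W₀ ≤ c'.V := hff'.trans_le (X.basicOpen_le f')
  have hWV := hWW₀.trans hW₀V
  have hWV' := hWW₀.trans hW₀V'
  have hxW : x ∈ ratPoints F W := mem_ratPoints.2 hpg
  have hne : Nontrivial Γ(X, W) := (evalHom hxW).toRingHom.domain_nontrivial
  have hspan' : Submodule.span Γ(X, W) {wedge F fun i => resFun hWV' (c'.x i)} = ⊤ := by
    have := span_wedge_res hW₀ hWW₀ hWg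
      (span_wedge_res c'.isAffineOpen hW₀V' hff' c'.span_wedge)
    simpa only [resFun_resFun] using this
  obtain ⟨h, b, hb⟩ := exists_basis_differentials (F := F) (A := Γ(X, W)) d
  obtain ⟨E, hxE, hEW, hE, hEd⟩ := exists_chart hW d hxW (x := fun i => resFun hWV' (c'.x i))
    fun D hD hDx => eq_zero_of_span_wedge b hb (evalHom hxW) hspan' (a := 1)
      (by rw [map_one]; exact one_ne_zero) (one_smul _ _).symm hD hDx
  choose T hT using hEd
  -- the tangent vectors of the second system of coordinates
  let D (i : Fin d) : Γ(X, W) →ₗ[F] F :=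
    { toFun := fun h => T h (Pi.single i 1)
      map_add' := fun h h' => by
        have h1 : HasStrictFDerivAt (fun y => value (h + h') (E.symm y)) (T h + T h') (E x) := by
          refine ((hT h).add (hT h')).congr_of_eventuallyEq ?_
          filter_upwards [E.open_target.mem_nhds (E.map_source hxE)] with y hy
          have hy' := hEW (E.map_target hy)
          simp only [Pi.add_apply, ← evalHom_apply hy', map_add]
        rw [(hT _).hasFDerivAt.unique h1.hasFDerivAt]; rfl
      map_smul' := fun a h => by
        have h1 : HasStrictFDerivAt (fun y => value (a • h) (E.symm y)) (a • T h) (E x) := by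
          refine ((hT h).const_smul a).congr_of_eventuallyEq ?_
          filter_upwards [E.open_target.mem_nhds (E.map_source hxE)] with y hy
          have hy' := hEW (E.map_target hy)
          simp only [Pi.smul_apply, ← evalHom_apply hy', map_smul]
        rw [(hT _).hasFDerivAt.unique h1.hasFDerivAt]; rfl }
  have hD (i) : IsTangent (evalHom hxW) (D i) := fun h h' => by
    have h1 := ((hT h).mul (hT h')).congr_of_eventuallyEq (f₁ :=
      fun y => value (h * h') (E.symm y)) (by
        filter_upwards [E.open_target.mem_nhds (E.map_source hxE)] with y hy
        have hy' := hEW (E.map_target hy)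
        simp only [Pi.mul_apply, ← evalHom_apply hy', map_mul])
    change T (h * h') _ = _ * T h' _ + _ * T h _
    rw [(hT _).hasFDerivAt.unique h1.hasFDerivAt, E.left_inv hxE, evalHom_apply, evalHom_apply]
    rfl
  have hDx' (i j) : D i (resFun hWV' (c'.x j)) = if i = j then 1 else 0 := by
    have h1 : HasStrictFDerivAt (fun y => value (resFun hWV' (c'.x j)) (E.symm y))
        (ContinuousLinearMap.proj (R := F) (φ := fun _ : Fin d => F) j) (E x) := by
      refine (hasStrictFDerivAt_apply j (E x)).congr_of_eventuallyEq ?_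
      filter_upwards [E.open_target.mem_nhds (E.map_source hxE)] with y hy
      have h2 := congr_fun (hE _ (E.map_target hy)) j
      rwa [E.right_inv hy] at h2
    change T _ _ = _
    rw [(hT _).hasFDerivAt.unique h1.hasFDerivAt]
    simp [Pi.single_apply, eq_comm]
  -- the two charts
  let A : (Fin d → F) →L[F] (Fin d → F) :=
    ContinuousLinearMap.pi fun j => T (resFun hWV (c.x j))
  have hEx : E x = c'.chart x := by
    rw [hE x hxE, c'.chart_apply x hx']
    ext i
    exact value_resFun _ _ hxW
  have hnear : ∀ᶠ y in 𝓝 (c'.chart x), y ∈ E.target ∧ E.symm y ∈ c.chart.source ∧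
      E.symm y ∈ c'.chart.source := by
    rw [← hEx]
    have h1 : Tendsto E.symm (𝓝 (E x)) (𝓝 x) := by
      have := E.continuousAt_symm (E.map_source hxE)
      rwa [ContinuousAt, E.left_inv hxE] at this
    have h2 : ∀ᶠ y in 𝓝 (E x), y ∈ E.target := E.open_target.mem_nhds (E.map_source hxE)
    exact h2.and ((h1.eventually (c.chart.open_source.mem_nhds hx)).and
        (h1.eventually (c'.chart.open_source.mem_nhds hx')))
  refine ⟨A, ?_, ?_⟩
  · rw [← hEx] at hnear ⊢
    refine (hasStrictFDerivAt_pi.2 fun j => hT (resFun hWV (c.x j))).congr_of_eventuallyEq ?_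
    filter_upwards [hnear] with y hy
    obtain ⟨hy1, hy2, hy3⟩ := hy
    have hyW := hEW (E.map_target hy1)
    have h1 : c'.chart (E.symm y) = y := by
      rw [c'.chart_apply _ hy3]
      conv_rhs => rw [← E.right_inv hy1, hE _ (E.map_target hy1)]
      ext i
      exact (value_resFun _ _ hyW).symm
    have h2 : c'.chart.symm y = E.symm y := by
      conv_lhs => rw [← h1]
      exact c'.chart.left_inv hy3
    rw [h2, c.chart_apply _ hy2]
    ext j
    exact value_resFun _ _ hyW
  · obtain ⟨ev, hev, hevD⟩ := exists_eval_form (evalHom hxW) hD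
    have h1 : resFun hWV c.g • wedge F (fun i => resFun hWV (c.x i)) =
        resFun hWV' c'.g • wedge F (fun i => resFun hWV' (c'.x i)) := by
      have h2 := ω.map_val c.V W c.isAffineOpen hW c.le hWV
      have h3 := ω.map_val c'.V W c'.isAffineOpen hW c'.le hWV'
      rw [c.val_eq, formsMap_smul, formsMap_wedge] at h2
      rw [c'.val_eq, formsMap_smul, formsMap_wedge] at h3
      exact h2.trans h3.symm
    have h2 := congr_arg ev h1
    rw [hev, hev, wedge, wedge, hevD, hevD, evalHom_apply, evalHom_apply, value_resFun _ _ hxW,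
      value_resFun _ _ hxW] at h2
    have h3 : (Matrix.of fun j i => D i (resFun hWV' (c'.x j))) = 1 := by
      ext j i
      rw [Matrix.of_apply, hDx', Matrix.one_apply]
      simp [eq_comm]
    have h4 : (Matrix.of fun j i => D i (resFun hWV (c.x j))) =
        LinearMap.toMatrix' A.toLinearMap := by
      ext j i
      rw [LinearMap.toMatrix'_apply]
      rfl
    rw [h3, Matrix.det_one, mul_one, h4, LinearMap.det_toMatrix'] at h2
    exact h2.symm

variable [ProperSpace F] [MeasurableSpace F] [BorelSpace F]

/-- The measures defined by two systems of coordinates agree on the common domain up to a bounded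
factor. The bound is uniform in the two systems, of which there may be uncountably many. -/
theorem HasHaarScaling.exists_coordinates_measure_le {m : ℕ} {μ : Measure F} [μ.IsAddHaarMeasure]
    (hμ : HasHaarScaling m μ) [SmoothOfRelativeDimension d (X ↘ Spec (.of F))]
    [SecondCountableTopology (Points F X)]
    (hω : ∀ c : Coordinates ω, ∀ x ∈ ratPoints F c.V, value c.g x ≠ 0) :
    ∃ C : ENNReal, C ≠ 0 ∧ C ≠ ⊤ ∧ ∀ c c' : Coordinates ω, ∀ S ⊆ c.chart.source ∩ c'.chart.source,
      MeasurableSet S → c.measure m μ S ≤ C * c'.measure m μ S := by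
  obtain ⟨C, hC0, hC, h⟩ := hμ.exists_chartMeasure_le d
  refine ⟨C, hC0, hC, fun c c' S hS hSm => ?_⟩
  have hcont (c : Coordinates ω) : ContinuousOn (fun x => ‖value c.g x‖ ^ m) c.chart.source :=
    (((continuousOn_value c.g).mono c.source_subset).norm).pow m
  refine h c.chart c'.chart _ _ (hcont c) (hcont c')
    (fun x hx => pow_pos (norm_pos_iff.2 (hω c x (c.source_subset hx))) m) (fun x hx => ?_) S hS hSm
  obtain ⟨A, hA, hA'⟩ := c.exists_transition c' hx.1 hx.2
  have h0 := hω c' x (c'.source_subset hx.2)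
  rw [hA'] at h0
  exact ⟨A, hA, right_ne_zero_of_mul h0, by rw [hA', norm_mul, mul_pow]⟩

end Transition

/-! ### Normal crossings at a rational point -/

section NormalCrossings

/-- The map from the regular functions near `φ w` to the local ring of an étale neighbourhood is
formally smooth. -/
theorem formallySmooth_germ_stalkMap {W X : Scheme.{u}} (φ : W ⟶ X) [Etale φ] {V : X.Opens}
    (hV : IsAffineOpen V) (w : W) (hw : φ w ∈ V) :
    letI := (X.presheaf.germ V (φ w) hw ≫ φ.stalkMap w).hom.toAlgebra
    Algebra.FormallySmooth Γ(X, V) (W.presheaf.stalk w) := by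
  let _ := (X.presheaf.germ V (φ w) hw ≫ φ.stalkMap w).hom.toAlgebra
  obtain ⟨W', hW', hwW', hle⟩ := exists_isAffineOpen_mem_and_subset (x := w) (U := φ ⁻¹ᵁ V) hw
  have h1 := φ.etale_appLE hV hW' hle
  let _ := (φ.appLE V W' hle).hom.toAlgebra
  have h2 : Algebra.Etale Γ(X, V) Γ(W, W') := h1
  let _ : Algebra Γ(W, W') (W.presheaf.stalk w) := (W.presheaf.germ W' w hwW').hom.toAlgebra
  have h3 : IsLocalization.AtPrime (W.presheaf.stalk w)
    (hW'.primeIdealOf ⟨w, hwW'⟩).asIdeal := hW'.isLocalization_stalk ⟨w, hwW'⟩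
  have h4 : Algebra.FormallySmooth Γ(W, W') (W.presheaf.stalk w) :=
    Algebra.FormallySmooth.of_isLocalization (hW'.primeIdealOf ⟨w, hwW'⟩).asIdeal.primeCompl
  have h5 : IsScalarTower Γ(X, V) Γ(W, W') (W.presheaf.stalk w) := by
    refine IsScalarTower.of_algebraMap_eq' ?_
    have h6 : X.presheaf.germ V (φ w) hw ≫ φ.stalkMap w =
        φ.appLE V W' hle ≫ W.presheaf.germ W' w hwW' := by
      have h7 : φ.appLE V W' hle = φ.app V ≫ W.presheaf.map (homOfLE hle).op := rfl
      rw [Scheme.Hom.germ_stalkMap, h7, Category.assoc]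
      exact congrArg (φ.app V ≫ ·) (W.presheaf.germ_res (homOfLE hle) w hwW').symm
    exact congrArg CommRingCat.Hom.hom h6
  exact Algebra.FormallySmooth.comp Γ(X, V) Γ(W, W') (W.presheaf.stalk w)

variable {F : Type u} [Field F] {X : Scheme.{u}} [X.Over (Spec (.of F))]

theorem isUnit_germ_iff {V : X.Opens} {p : Points F X} (hp : p ∈ ratPoints F V) {q : X}
    (hq : q = p.pt) (hqV : q ∈ V) (f : Γ(X, V)) :
    IsUnit (X.presheaf.germ V q hqV f) ↔ value f p ≠ 0 := by
  subst hq
  rw [← X.mem_basicOpen f p.pt hqV, ← mem_ratPoints, mem_ratPoints_basicOpen, and_iff_right hp]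

/-- At a rational point, the equations of the components of a divisor with smooth components and
normal crossings have independent differentials. -/
theorem exists_isTangent_of_hasNormalCrossings [LocallyOfFiniteType (X ↘ Spec (.of F))]
    {ι : Type v} [Fintype ι] {L : ι → X.Modules} {s : ∀ α, Γ(L α, (⊤ : X.Opens))}
    (hsmooth : ∀ α, IsSmoothDivisor F (L α) (s α)) (hnc : HasNormalCrossings L s)
    {V : X.Opens} (hV : IsAffineOpen V) {e : ∀ α, Γ(L α, V)} {f : ι → Γ(X, V)}
    (hf : ∀ α, IsLocalEquation (L α) (s α) V (e α) (f α)) {p : Points F X}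
    (hp : p ∈ ratPoints F V) {J : Finset ι} (hJ : ∀ α, α ∈ J ↔ value (f α) p = 0)
    [DecidableEq J] :
    ∃ D : J → Γ(X, V) →ₗ[F] F, (∀ α, IsTangent (evalHom hp) (D α)) ∧
      ∀ α β : J, D α (f β) = if α = β then 1 else 0 := by
  obtain ⟨W, φ, _, w, hw, n, x, ⟨hdim, hspan⟩, r, hprod⟩ := hnc p.pt
  have hwV : φ w ∈ V := hw ▸ mem_ratPoints.1 hp
  have hX : IsLocallyNoetherian X := LocallyOfFiniteType.isLocallyNoetherian (X ↘ Spec (.of F))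
  have hWn : IsLocallyNoetherian W := LocallyOfFiniteType.isLocallyNoetherian φ
  let R := W.presheaf.stalk w
  let ψ : Γ(X, V) →+* R := (X.presheaf.germ V (φ w) hwV ≫ φ.stalkMap w).hom
  let _ : Algebra Γ(X, V) R := ψ.toAlgebra
  have hfs : Algebra.FormallySmooth Γ(X, V) R := formallySmooth_germ_stalkMap φ hV w hwV
  have hunit (a : Γ(X, V)) : IsUnit (ψ a) ↔ value a p ≠ 0 := by
    rw [← isUnit_germ_iff hp hw hwV]
    exact isUnit_map_iff (φ.stalkMap w).hom _
  have hmem (a : Γ(X, V)) : ψ a ∈ IsLocalRing.maximalIdeal R ↔ value a p = 0 := by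
    rw [IsLocalRing.mem_maximalIdeal, mem_nonunits_iff, hunit, not_not]
  have hdom : IsDomain R := isDomain_of_span_range_eq_maximalIdeal n R x hdim.ge hspan
  -- `R` is the local ring of an étale neighbourhood, where the equation of the sum is a product of
  -- distinct parameters
  have hass : Associated (∏ α, ψ (f α)) (∏ i ∈ r, x i) := by
    rw [← Ideal.span_singleton_eq_span_singleton, ← hprod]
    have h1 (α : ι) : divIdeal (L α) (s α) (φ w) =
      Ideal.span {X.presheaf.germ V (φ w) hwV (f α)} := (hf α).divIdeal_eq hwV
    simp only [h1]
    rw [Ideal.prod_span_singleton, Ideal.map_span, Set.image_singleton, map_prod]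
    rfl
  have hne : ∏ α, ψ (f α) ≠ 0 := by
    rw [hass.ne_zero_iff, Finset.prod_ne_zero_iff]
    exact fun i _ => (prime_of_span_range_eq_maximalIdeal hdim.ge hspan i).ne_zero
  -- smoothness of the component: otherwise `f α` would vanish near the point, but the product
  -- of the equations is not zero
  have hsq (α : ι) : ψ (f α) ∉ IsLocalRing.maximalIdeal R ^ 2 := by
    by_cases hα : value (f α) p = 0
    · have hfα : f α ∉ RingHom.ker (evalHom hp) ^ 2 := by
        intro h
        have := hsmooth α V hV (e α) (f α) (hf α)
        obtain ⟨a, ha, ha0⟩ := exists_mul_eq_zero_of_mem_ker_sq (evalHom hp) (f α) h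
        have hu : IsUnit (ψ a) := by
          rw [hunit, ← evalHom_apply hp, ha]; exact one_ne_zero
        have h2 : ψ a * ψ (f α) = 0 := by rw [← map_mul, ha0, map_zero]
        exact Finset.prod_ne_zero_iff.1 hne α (Finset.mem_univ α) (hu.mul_right_eq_zero.1 h2)
      obtain ⟨D, hD, hDf⟩ := exists_isTangent_dual (evalHom hp) (ι := Unit) (f := fun _ => f α)
        (fun _ => by rw [evalHom_apply, hα]) (fun c hc => by
          rw [Fintype.sum_unique] at hc
          ext u
          by_contra h0
          refine hfα ?_
          have := (RingHom.ker (evalHom hp) ^ 2).smul_of_tower_mem (c default)⁻¹ hc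
          rwa [smul_smul, inv_mul_cancel₀ h0, one_smul] at this)
      refine algebraMap_notMem_sq_of_isTangent (hD ()) (R := R) (fun a ha => ?_)
        (f := f α) (by rw [hDf () ()]; simp)
      rw [evalHom_apply] at ha
      exact (hmem a).2 ha
    · intro h
      exact hα ((hmem _).1 (Ideal.pow_le_self two_ne_zero h))
  refine exists_isTangent_dual (evalHom hp) (f := fun α : J => f α)
    (fun α => by rw [evalHom_apply, (hJ α).1 α.2]) fun c hc => ?_
  -- a relation modulo the square of the ideal of `p` becomes one modulo the square of `𝔪` in `R`
  classical
  let c' : ι → Γ(X, V) := fun α => if h : α ∈ J then algebraMap F _ (c ⟨α, h⟩) else 0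
  have h1 : ∑ α ∈ J, ψ (c' α) * ψ (f α) ∈ IsLocalRing.maximalIdeal R ^ 2 := by
    have h2 : ∑ α ∈ J, ψ (c' α) * ψ (f α) = ψ (∑ α : J, c α • f α) := by
      rw [map_sum, ← Finset.sum_coe_sort]
      refine Finset.sum_congr rfl fun α _ => ?_
      rw [← map_mul, Algebra.smul_def]
      simp [c']
    rw [h2]
    have h3 : Ideal.map ψ (RingHom.ker (evalHom hp) ^ 2) ≤ IsLocalRing.maximalIdeal R ^ 2 := by
      rw [Ideal.map_pow]
      refine Ideal.pow_right_mono (Ideal.map_le_iff_le_comap.2 fun a ha => ?_) 2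
      rw [Ideal.mem_comap, hmem, ← evalHom_apply hp]
      exact ha
    exact h3 (Ideal.mem_map_of_mem ψ hc)
  have h2 := mem_maximalIdeal_of_associated_prod hdim.ge hspan hass hsq
    (c := fun α => ψ (c' α)) (fun α hα => (hmem _).2 ((hJ α).1 hα)) h1
  ext α
  have h3 := (hmem _).1 (h2 α α.2)
  rw [← evalHom_apply hp] at h3
  simpa [c'] using h3

end NormalCrossings

/-! ### Local equations of the divisor of a form -/

section DivisorChart

variable {F : Type u} [Field F] {X : Scheme.{u}} [X.Over (Spec (.of F))] {d : ℕ} {U : X.Opens}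
  {ω : DForm F d U} {ι : Type v} [Fintype ι] {L : ι → X.Modules}
  {s : ∀ α, Γ(L α, (⊤ : X.Opens))} {m : ι → ℤ}

theorem IsLocalEquation.value_ne_zero_iff {L : X.Modules} {s : Γ(L, (⊤ : X.Opens))} {V : X.Opens}
    {e : Γ(L, V)} {f : Γ(X, V)} (h : IsLocalEquation L s V e f) {x : Points F X}
    (hx : x ∈ ratPoints F V) : value f x ≠ 0 ↔ x ∈ ratPoints F (nonvanishing L s) := by
  have h1 := mem_ratPoints_basicOpen f (x := x)
  rw [and_iff_right hx, ← h.nonvanishing_inf, ratPoints_inf] at h1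
  rw [← h1]
  exact and_iff_left hx

variable (ω L s m) in
/-- The data witnessing, on the affine open set `V`, that the divisor of `ω` is `∑ m_α div(s_α)`:
frames `e_α`, equations `f_α` and a generator `η` of `Ω^d` such that `ω = (∏ f_α ^ m_α) η`. -/
structure IsDivisorChart (V : X.Opens) (e : ∀ α, Γ(L α, V)) (f : ι → Γ(X, V))
    (η : Forms F d V) : Prop where
  isLocalEquation : ∀ α, IsLocalEquation (L α) (s α) V (e α) (f α)
  span_eq_top : Submodule.span Γ(X, V) {η} = ⊤
  smul_val_eq : ∀ (W : X.Opens) (hW : IsAffineOpen W) (hWV : W ≤ V) (hWU : W ≤ U),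
    (∏ α, resFun hWV (f α) ^ (-m α).toNat) • ω.val W hW hWU =
      (∏ α, resFun hWV (f α) ^ (m α).toNat) • formsMap d (resAlg (F := F) hWV) η

theorem IsDivisorChart.res {V W : X.Opens} {e : ∀ α, Γ(L α, V)} {f : ι → Γ(X, V)}
    {η : Forms F d V} (h : IsDivisorChart ω L s m V e f η) (hV : IsAffineOpen V) (hWV : W ≤ V)
    {g : Γ(X, V)} (hg : W = X.basicOpen g) :
    IsDivisorChart ω L s m W (fun α => resSec (L α) hWV (e α)) (fun α => resFun hWV (f α))
      (formsMap d (resAlg (F := F) hWV) η) where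
  isLocalEquation α := (h.isLocalEquation α).res hWV
  span_eq_top := span_formsMap_resAlg hV hWV hg h.span_eq_top
  smul_val_eq Z hZ hZW hZU := by
    have h1 := h.smul_val_eq Z hZ (hZW.trans hWV) hZU
    have h2 : (resAlg (F := F) hZW).comp (resAlg hWV) = resAlg (hZW.trans hWV) :=
      AlgHom.ext fun f => resFun_resFun hWV hZW f
    simpa only [resFun_resFun, formsMap_comp, h2] using h1

/-- Arbitrarily small standard smooth affine open sets carry equations of the divisor of `ω`. -/
theorem DForm.HasDivisor.exists_isDivisorChart (hω : ω.HasDivisor L s m)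
    [SmoothOfRelativeDimension d (X ↘ Spec (.of F))] {p : X} {Z : X.Opens} (hp : p ∈ Z) :
    ∃ V ≤ Z, p ∈ V ∧ IsAffineOpen V ∧ Algebra.IsStandardSmoothOfRelativeDimension d F Γ(X, V) ∧
      ∃ (e : ∀ α, Γ(L α, V)) (f : ι → Γ(X, V)) (η : Forms F d V),
        IsDivisorChart ω L s m V e f η := by
  obtain ⟨V₀, hpV₀, hV₀, e, f, η, hf, hη, hrel⟩ := hω p
  obtain ⟨g, hgZ, hpg⟩ := hV₀.exists_basicOpen_le ⟨p, hp⟩ hpV₀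
  have hV₁ := hV₀.basicOpen g
  obtain ⟨g', hpg', hsm⟩ := exists_basicOpen_isStandardSmooth (F := F) d hV₁ hpg
  exact ⟨X.basicOpen g', (X.basicOpen_le g').trans hgZ, hpg', hV₁.basicOpen g', hsm, _, _, _,
    (IsDivisorChart.res ⟨hf, hη, hrel⟩ hV₀ (X.basicOpen_le g) rfl).res hV₁ (X.basicOpen_le g') rfl⟩

/-- The form is, up to powers of the equations `f_α`, a generator of `Ω^d`, and the `f_α` do not
vanish on `U`. -/
theorem IsDivisorChart.value_ne_zero {V : X.Opens} {e : ∀ α, Γ(L α, V)} {f : ι → Γ(X, V)}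
    {η : Forms F d V} (h : IsDivisorChart ω L s m V e f η) (hV : IsAffineOpen V) (hVU : V ≤ U)
    [Algebra.IsStandardSmoothOfRelativeDimension d F Γ(X, V)]
    (hU : ∀ α, U ≤ nonvanishing (L α) (s α)) {g : Γ(X, V)} {w : Forms F d V}
    (hg : ω.val V hV hVU = g • w) {p : Points F X} (hp : p ∈ ratPoints F V) :
    value g p ≠ 0 := by
  have hne : Nontrivial Γ(X, V) := (evalHom hp).toRingHom.domain_nontrivial
  obtain ⟨y, b, hb⟩ := exists_basis_differentials (F := F) (A := Γ(X, V)) d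
  obtain ⟨E, hE, hEy, -⟩ := exists_tangent_frame b hb (evalHom hp)
  have hη := span_formsMap_resAlg hV le_rfl (X.basicOpen_of_isUnit isUnit_one).symm h.span_eq_top
  obtain ⟨ev, hev, hev0, -⟩ := exists_eval_form_ne_zero hE hEy hη
  intro h0
  have h1 : ev (ω.val V hV hVU) = 0 := by
    rw [hg, hev, evalHom_apply, h0, zero_mul]
  have h2 := (hev _ _).symm.trans
    ((congr_arg ev (h.smul_val_eq V hV le_rfl hVU)).symm.trans (hev _ _))
  rw [h1, mul_zero] at h2
  have h3 := (mul_eq_zero.1 h2).resolve_right hev0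
  rw [map_prod, Finset.prod_eq_zero_iff] at h3
  obtain ⟨α, -, hα⟩ := h3
  rw [map_pow, evalHom_apply, value_resFun _ _ hp] at hα
  exact ((h.isLocalEquation α).value_ne_zero_iff hp).2
    (ratPoints_mono (hVU.trans (hU α)) hp) (eq_zero_of_pow_eq_zero hα)

/-- A form whose divisor is supported outside of `U` does not vanish on `U`. -/
theorem DForm.HasDivisor.value_ne_zero (hω : ω.HasDivisor L s m)
    [SmoothOfRelativeDimension d (X ↘ Spec (.of F))] (hU : ∀ α, U ≤ nonvanishing (L α) (s α))
    {V : X.Opens} (hV : IsAffineOpen V) (hVU : V ≤ U) {g : Γ(X, V)} {w : Forms F d V}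
    (hg : ω.val V hV hVU = g • w) {p : Points F X} (hp : p ∈ ratPoints F V) :
    value g p ≠ 0 := by
  obtain ⟨W, hWV, hpW, hW, hsm, e, f, η, h⟩ :=
    hω.exists_isDivisorChart (mem_ratPoints.1 hp)
  have h1 := ω.map_val V W hV hW hVU hWV
  rw [hg, formsMap_smul] at h1
  have h2 := h.value_ne_zero hW (hWV.trans hVU) hU h1.symm (mem_ratPoints.2 hpW)
  rwa [resAlg_apply, value_resFun _ _ (mem_ratPoints.2 hpW)] at h2

end DivisorChart

/-! ### The integral near a rational point -/

section AdaptedCoordinates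

variable {F : Type u} [NormedField F] {X : Scheme.{u}} [X.Over (Spec (.of F))]

theorem value_mul {V : X.Opens} (f g : Γ(X, V)) {x : Points F X} (hx : x ∈ ratPoints F V) :
    value (f * g) x = value f x * value g x := by
  simp only [← evalHom_apply hx, map_mul]

theorem value_prod_pow {V : X.Opens} {ι : Type*} [Fintype ι] (f : ι → Γ(X, V)) (n : ι → ℕ)
    {x : Points F X} (hx : x ∈ ratPoints F V) :
    value (∏ α, f α ^ n α) x = ∏ α, value (f α) x ^ n α := by
  simp only [← evalHom_apply hx, map_prod, map_pow]

theorem Metric.norm_eq_mul {L : X.Modules} (metric : Metric F L) {s : Γ(L, (⊤ : X.Opens))}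
    {V : X.Opens} {e : Γ(L, V)} {f : Γ(X, V)} (h : IsLocalEquation L s V e f) {x : Points F X}
    (hx : x ∈ ratPoints F V) : metric.norm ⊤ s x = ‖value f x‖ * metric.norm V e x := by
  rw [← metric.norm_res ⊤ V le_top s x hx, h.2, metric.norm_smul V f e x hx]

theorem Metric.norm_pos_of_mem_nonvanishing {L : X.Modules} (metric : Metric F L)
    {s : Γ(L, (⊤ : X.Opens))} {x : Points F X} (hx : x ∈ ratPoints F (nonvanishing L s)) :
    0 < metric.norm ⊤ s x := by
  obtain ⟨V, hV, hxV⟩ := Opens.mem_sSup.1 (mem_ratPoints.1 hx)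
  rw [← metric.norm_res ⊤ V le_top s x (mem_ratPoints.2 hxV)]
  exact metric.norm_pos V _ hV x (mem_ratPoints.2 hxV)

theorem Metric.continuous_norm_top {L : X.Modules} (metric : Metric F L)
    (s : Γ(L, (⊤ : X.Opens))) : Continuous (metric.norm ⊤ s) := by
  rw [← continuousOn_univ]
  exact (metric.continuousOn ⊤ s).mono fun x _ => mem_ratPoints.2 trivial

variable {d : ℕ} {U : X.Opens} {ω : DForm F d U} {ι : Type v} [Fintype ι] {L : ι → X.Modules}
  {s : ∀ α, Γ(L α, (⊤ : X.Opens))} {lam : ι → ℤ}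

theorem eq_units_mul_smul {R M : Type*} [CommRing R] [AddCommGroup M] [Module R M] {A u : Rˣ}
    {B : R} {w w' η : M} (hrel : (A : R) • w' = B • η) (hw : w = (u : R) • η) :
    w' = ((↑A⁻¹ : R) * B * (↑u⁻¹ : R)) • w := by
  rw [hw, smul_smul, mul_assoc, mul_assoc, Units.inv_mul, mul_one, mul_smul, ← hrel, smul_smul,
    Units.inv_mul, one_smul]

/-- Positive and negative powers of the equations, kept apart in the definition of the divisor of a
form, are brought together in the absolute value of the coefficient. -/
theorem norm_value_coefficient {V W : X.Opens} (hWV : W ≤ V) {f : ι → Γ(X, V)} {a : Γ(X, V)}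
    {A u : Γ(X, W)ˣ} (hA : (A : Γ(X, W)) = ∏ α, resFun hWV (f α) ^ (lam α).toNat)
    (hu : (u : Γ(X, W)) = resFun hWV a) (hf : ∀ α, IsUnit (resFun hWV (f α))) {q : Points F X}
    (hq : q ∈ ratPoints F W) :
    ‖value ((↑A⁻¹ : Γ(X, W)) * (∏ α, resFun hWV (f α) ^ (-lam α).toNat) * (↑u⁻¹ : Γ(X, W))) q‖ =
      ‖value a q‖⁻¹ * ∏ α, ‖value (f α) q‖ ^ (-lam α) := by
  have hA' : value (↑A⁻¹ : Γ(X, W)) q * ∏ α, value (f α) q ^ (lam α).toNat = 1 := by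
    have h1 : value ((↑A⁻¹ : Γ(X, W)) * (A : Γ(X, W))) q = 1 := by
      rw [Units.inv_mul, ← evalHom_apply hq, map_one]
    rw [value_mul _ _ hq, hA, value_prod_pow _ _ hq] at h1
    simpa only [value_resFun _ _ hq] using h1
  have hu' : value (↑u⁻¹ : Γ(X, W)) q * value a q = 1 := by
    have h1 : value ((↑u⁻¹ : Γ(X, W)) * (u : Γ(X, W))) q = 1 := by
      rw [Units.inv_mul, ← evalHom_apply hq, map_one]
    rwa [value_mul _ _ hq, hu, value_resFun _ _ hq] at h1
  rw [value_mul _ _ hq, value_mul _ _ hq, eq_inv_of_mul_eq_one_left hA',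
    eq_inv_of_mul_eq_one_left hu', value_prod_pow _ _ hq]
  simp only [value_resFun _ _ hq]
  rw [norm_mul, norm_mul, norm_inv, norm_inv, norm_prod, norm_prod, mul_comm,
    ← Finset.prod_inv_distrib, ← Finset.prod_mul_distrib]
  congr 1
  refine Finset.prod_congr rfl fun α _ => ?_
  have h0 : ‖value (f α) q‖ ≠ 0 := by
    have := ((hf α).map (evalHom hq)).ne_zero
    rwa [evalHom_apply, value_resFun _ _ hq, ← norm_ne_zero_iff] at this
  rw [norm_pow, norm_pow, ← zpow_natCast, ← zpow_natCast, ← zpow_neg, ← zpow_add₀ h0]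
  congr 1
  omega

/-- If `dx₁ ∧ ⋯ ∧ dx_d = a η`, then `dx₁ ∧ ⋯ ∧ dx_d` generates `Ω^d` where `a` does not vanish, and
the coefficient of `ω` with respect to it is `a⁻¹ ∏ f_α ^ (-λ_α)`. -/
theorem IsDivisorChart.exists_coefficient {V : X.Opens} {e : ∀ α, Γ(L α, V)}
    {f : ι → Γ(X, V)} {η : Forms F d V} (h : IsDivisorChart ω L s (fun α => -lam α) V e f η)
    (hV : IsAffineOpen V) {x : Fin d → Γ(X, V)} {a : Γ(X, V)} (hx : wedge F x = a • η)
    {W : X.Opens} (hW : IsAffineOpen W) (hWV : W ≤ V) (hWU : W ≤ U)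
    (hWa : W = X.basicOpen (a * ∏ α, f α)) :
    Submodule.span Γ(X, W) {wedge F fun i => resFun hWV (x i)} = ⊤ ∧
      ∃ g : Γ(X, W), ω.val W hW hWU = g • wedge F (fun i => resFun hWV (x i)) ∧
        ∀ q ∈ ratPoints F W,
          ‖value g q‖ = ‖value a q‖⁻¹ * ∏ α, ‖value (f α) q‖ ^ (-lam α) := by
  have hη := span_formsMap_resAlg hV hWV hWa h.span_eq_top
  have hunit : IsUnit (resFun hWV (a * ∏ α, f α)) := isUnit_resFun_basicOpen _ hWa.le
  have hprod : resFun hWV (∏ α, f α) = ∏ α, resFun hWV (f α) :=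
    map_prod (X.presheaf.map (homOfLE hWV).op).hom _ _
  rw [resFun_mul, hprod, IsUnit.mul_iff, IsUnit.prod_univ_iff] at hunit
  obtain ⟨⟨u, hu⟩, hf⟩ := hunit
  have hA : IsUnit (∏ α, resFun hWV (f α) ^ (- -lam α).toNat) :=
    IsUnit.prod_univ_iff.2 fun α => (hf α).pow _
  obtain ⟨A, hA⟩ := hA
  have hw : wedge F (fun i => resFun hWV (x i)) =
      (u : Γ(X, W)) • formsMap d (resAlg (F := F) hWV) η := by
    rw [hu, ← formsMap_wedge, hx]
    exact formsMap_smul d (resAlg hWV) a η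
  have hrel := h.smul_val_eq W hW hWV hWU
  rw [← hA] at hrel
  refine ⟨?_, _, eq_units_mul_smul (M := Forms F d W) hrel hw, fun q hq =>
    norm_value_coefficient hWV (by simpa only [neg_neg] using hA) hu hf hq⟩
  rw [hw]
  exact (Submodule.span_singleton_smul_eq u.isUnit _).trans hη

end AdaptedCoordinates

section LocalIntegrability

open _root_.Metric Set Filter Topology ENNReal NNReal

/-- Factors bounded from above and from below by positive constants do not affect convergence. -/
theorem setLIntegral_lt_top_iff_of_eq_mul {α : Type*} [MeasurableSpace α] {μ : Measure α}
    {T : Set α} (hT : MeasurableSet T) {f g : α → ℝ≥0∞} {w : α → ℝ} {c C : ℝ} (hc : 0 < c)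
    (hf : ∀ x ∈ T, f x = ENNReal.ofReal (w x) * g x) (hw : ∀ x ∈ T, c ≤ w x ∧ w x ≤ C) :
    ∫⁻ x in T, f x ∂μ < ∞ ↔ ∫⁻ x in T, g x ∂μ < ∞ := by
  have h0 : ENNReal.ofReal c ≠ 0 := (ENNReal.ofReal_pos.2 hc).ne'
  constructor
  · intro h
    have h1 : ∫⁻ x in T, g x ∂μ ≤ ∫⁻ x in T, (ENNReal.ofReal c)⁻¹ * f x ∂μ := by
      refine setLIntegral_mono' hT fun x hx => ?_
      rw [hf x hx, ← mul_assoc]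
      refine le_mul_of_one_le_left' ?_
      rw [← ENNReal.inv_mul_cancel h0 ENNReal.ofReal_ne_top]
      exact mul_le_mul_right (ENNReal.ofReal_le_ofReal (hw x hx).1) _
    rw [lintegral_const_mul' _ _ (ENNReal.inv_ne_top.2 h0)] at h1
    exact h1.trans_lt (ENNReal.mul_lt_top (ENNReal.inv_lt_top.2 (pos_iff_ne_zero.2 h0)) h)
  · intro h
    have h1 : ∫⁻ x in T, f x ∂μ ≤ ∫⁻ x in T, ENNReal.ofReal C * g x ∂μ := by
      refine setLIntegral_mono' hT fun x hx => ?_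
      rw [hf x hx]
      exact mul_le_mul_left (ENNReal.ofReal_le_ofReal (hw x hx).2) _
    rw [lintegral_const_mul' _ _ ENNReal.ofReal_ne_top] at h1
    exact h1.trans_lt (ENNReal.mul_lt_top ENNReal.ofReal_lt_top h)

/-- The exponents combine: `‖g‖^m ∏ ‖s_α‖^(m r_α)` is a product of powers of the absolute values of
the equations `f_α` and of positive continuous functions. -/
theorem coefficient_pow_mul_prod_norm_rpow {ι : Type*} [Fintype ι] (m : ℕ) (r : ι → ℝ)
    (lam : ι → ℤ) {t : ℝ} {f n : ι → ℝ} (hf : ∀ α, 0 < f α) (hn : ∀ α, 0 < n α) :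
    (t⁻¹ * ∏ α, f α ^ (-lam α)) ^ m * ∏ α, (f α * n α) ^ ((m : ℝ) * r α) =
      t⁻¹ ^ m * (∏ α, n α ^ ((m : ℝ) * r α)) * ∏ α, f α ^ ((m : ℝ) * (r α - lam α)) := by
  rw [mul_pow, mul_assoc, mul_assoc, ← Finset.prod_pow, ← Finset.prod_mul_distrib,
    ← Finset.prod_mul_distrib]
  congr 1
  refine Finset.prod_congr rfl fun α _ => ?_
  rw [Real.mul_rpow (hf α).le (hn α).le, ← Real.rpow_intCast, ← Real.rpow_natCast,
    ← Real.rpow_mul (hf α).le, ← mul_assoc, ← Real.rpow_add (hf α), mul_comm]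
  congr 2
  push_cast
  ring

variable {F : Type u} [NontriviallyNormedField F] {X : Scheme.{u}} [X.Over (Spec (.of F))]
  {d : ℕ} {U : X.Opens} {ω : DForm F d U} {ι : Type v} [Fintype ι] {L : ι → X.Modules}
  {s : ∀ α, Γ(L α, (⊤ : X.Opens))} {lam : ι → ℤ}

/-- Near each rational point, there are local coordinates among which are the equations of the
components of the divisor passing through this point. -/
theorem DForm.HasDivisor.exists_adapted_chart [CompleteSpace F]
    [SmoothOfRelativeDimension d (X ↘ Spec (.of F))] (hω : ω.HasDivisor L s fun α => -lam α)
    (hsmooth : ∀ α, IsSmoothDivisor F (L α) (s α)) (hnc : HasNormalCrossings L s)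
    (p : Points F X) :
    ∃ (V : X.Opens) (e : ∀ α, Γ(L α, V)) (f : ι → Γ(X, V)) (η : Forms F d V), IsAffineOpen V ∧
      IsDivisorChart ω L s (fun α => -lam α) V e f η ∧
      ∃ (J : Finset ι) (x : Fin d → Γ(X, V)) (i : J → Fin d) (a : Γ(X, V)),
        (∀ α, α ∈ J ↔ value (f α) p = 0) ∧ Function.Injective i ∧ (∀ α, x (i α) = f α) ∧
        value a p ≠ 0 ∧ wedge F x = a • η ∧
        ∃ E : OpenPartialHomeomorph (Points F X) (Fin d → F), p ∈ E.source ∧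
          E.source ⊆ ratPoints F V ∧ ∀ q ∈ E.source, E q = fun j => value (x j) q := by
  classical
  obtain ⟨V, -, hpV, hV, hsm, e, f, η, h⟩ := hω.exists_isDivisorChart (Z := ⊤) (p := p.pt) trivial
  have hp : p ∈ ratPoints F V := mem_ratPoints.2 hpV
  have hne : Nontrivial Γ(X, V) := (evalHom hp).toRingHom.domain_nontrivial
  have hJ (α : ι) : α ∈ Finset.univ.filter (fun α => value (f α) p = 0) ↔ value (f α) p = 0 := by
    simp
  have : Smooth (X ↘ Spec (.of F)) := SmoothOfRelativeDimension.smooth d _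
  obtain ⟨D, hD, hDf⟩ :=
    exists_isTangent_of_hasNormalCrossings hsmooth hnc hV h.isLocalEquation hp hJ
  obtain ⟨y, b, hb⟩ := exists_basis_differentials (F := F) (A := Γ(X, V)) d
  obtain ⟨x, i, hi, hxi, a, ha, hx⟩ := exists_completion b hb (evalHom hp) h.span_eq_top hD hDf
  obtain ⟨E, hpE, hEV, hE, -⟩ := exists_chart hV d hp (x := x) fun D hD hDx =>
    eq_zero_of_span_wedge b hb (evalHom hp) h.span_eq_top ha hx hD hDx
  rw [evalHom_apply] at ha
  exact ⟨V, e, f, η, hV, h, _, x, i, a, hJ, hi, hxi, ha, hx, E, hpE, hEV, hE⟩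

/-- A small coordinate ball around `p`, contained in a given neighbourhood of `p`. -/
theorem exists_coordinate_ball {Y : Type*} [TopologicalSpace Y]
    (E : OpenPartialHomeomorph Y (Fin d → F)) {p : Y} (hp : p ∈ E.source) {N : Set Y}
    (hN : N ∈ 𝓝 p) :
    ∃ ε > 0, ∃ B, IsOpen B ∧ p ∈ B ∧ B ⊆ N ∧ B ⊆ E.source ∧
      ∀ y, (y ∈ E.target ∧ E.symm y ∈ B) ↔ y ∈ ball (E p) ε := by
  have h1 : E.target ∩ E.symm ⁻¹' N ∈ 𝓝 (E p) := by
    refine inter_mem (E.open_target.mem_nhds (E.map_source hp)) ?_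
    have := E.continuousAt_symm (E.map_source hp)
    rw [ContinuousAt, E.left_inv hp] at this
    exact this hN
  obtain ⟨ε, hε, h⟩ := Metric.mem_nhds_iff.1 h1
  refine ⟨ε, hε, E.source ∩ E ⁻¹' ball (E p) ε, E.isOpen_inter_preimage isOpen_ball,
    ⟨hp, mem_ball_self hε⟩, fun q hq => ?_, inter_subset_left,
    fun y => ⟨fun hy => ?_, fun hy => ?_⟩⟩
  · have := (h hq.2).2
    rwa [mem_preimage, E.left_inv hq.1] at this
  · have := hy.2.2
    rwa [mem_preimage, E.right_inv hy.1] at this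
  · have h2 := (h hy).1
    exact ⟨h2, E.map_target h2, by rwa [mem_preimage, E.right_inv h2]⟩

variable [ProperSpace F] [MeasurableSpace F] [BorelSpace F] {m : ℕ} {μ : Measure F}
  [μ.IsAddHaarMeasure]

/-- Convergence in a system of coordinates whose image is a ball deprived of some of the coordinate
hyperplanes through its centre, for an integrand that becomes a monomial up to a bounded factor. -/
theorem Coordinates.lintegral_lt_top_iff (hμ : HasHaarScaling m μ) (hm : m ≠ 0) (c : Coordinates ω)
    {J : Finset (Fin d)} {y₀ : Fin d → F} (hy₀ : ∀ j ∈ J, y₀ j = 0) {ε : ℝ} (hε : 0 < ε)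
    (htarget : c.chart.target = {y | y ∈ ball y₀ ε ∧ ∀ j ∈ J, y j ≠ 0}) {G w : Points F X → ℝ}
    (hG : ContinuousOn G c.chart.source) {σ : Fin d → ℝ}
    (hw : ∀ q ∈ c.chart.source,
      ‖value c.g q‖ ^ m * G q = w q * ∏ j ∈ J, ‖c.chart q j‖ ^ σ j) {C₁ C₂ : ℝ} (hC₁ : 0 < C₁)
    (hC : ∀ q ∈ c.chart.source, C₁ ≤ w q ∧ w q ≤ C₂) :
    ∫⁻ q, ENNReal.ofReal (G q) ∂c.measure m μ < ∞ ↔ ∀ j ∈ J, -(m : ℝ) < σ j := by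
  rw [← hμ.lintegral_monomial_lt_top_iff hm hy₀ σ hε, ← htarget]
  have h1 := lintegral_chartMeasure (μ := μ) c.chart (ρ := fun x => ‖value c.g x‖ ^ m)
    ((((continuousOn_value c.g).mono c.source_subset).norm).pow m)
    (ENNReal.continuous_ofReal.comp_continuousOn hG)
  refine (iff_of_eq (congrArg (· < ∞) h1)).trans ?_
  refine setLIntegral_lt_top_iff_of_eq_mul (w := fun y => w (c.chart.symm y))
    c.chart.open_target.measurableSet hC₁ (fun y hy => ?_) (C := C₂)
    fun y hy => hC _ (c.chart.map_target hy)
  have hq := c.chart.map_target hy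
  have h2 := hw _ hq
  rw [c.chart.right_inv hy] at h2
  rw [Function.comp_apply, ← ENNReal.ofReal_mul (by positivity), h2,
    ENNReal.ofReal_mul (hC₁.le.trans (hC _ hq).1), ENNReal.ofReal_prod_of_nonneg]
  exact fun j _ => by positivity

/-- The integral near a rational point `p`: it converges if and only if `r_α > λ_α - 1` for all `α`
such that `div(s_α)` passes through `p`. -/
theorem DForm.HasDivisor.exists_coordinates_lintegral_lt_top_iff (hμ : HasHaarScaling m μ)
    (hm : m ≠ 0) [SmoothOfRelativeDimension d (X ↘ Spec (.of F))]
    (hω : ω.HasDivisor L s fun α => -lam α)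
    (hsmooth : ∀ α, IsSmoothDivisor F (L α) (s α)) (hnc : HasNormalCrossings L s)
    (hU : U = ⨅ α, nonvanishing (L α) (s α)) (metric : ∀ α, Metric F (L α)) (r : ι → ℝ)
    (p : Points F X) :
    ∃ (B : Set (Points F X)) (E : OpenPartialHomeomorph (Points F X) (Fin d → F))
      (c : Coordinates ω), IsOpen B ∧ p ∈ B ∧ B ⊆ E.source ∧
      c.chart.source = B ∩ ratPoints F U ∧
      (∫⁻ x, ENNReal.ofReal (∏ α, (metric α).norm ⊤ (s α) x ^ ((m : ℝ) * r α)) ∂c.measure m μ < ∞ ↔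
        ∀ α, p ∉ ratPoints F (nonvanishing (L α) (s α)) → lam α - 1 < r α) := by
  classical
  obtain ⟨V, e, f, η, hV, h, J, x, i, a, hJ, hi, hxi, ha, hx, E, hpE, hEV, hE⟩ :=
    hω.exists_adapted_chart hsmooth hnc p
  have hpV := hEV hpE
  have hUW : X.basicOpen (a * ∏ α, f α) ≤ U := by
    rw [hU]
    refine le_iInf fun α => ?_
    have h1 : X.basicOpen (a * ∏ α, f α) ≤ X.basicOpen (f α) := by
      rw [← Finset.mul_prod_erase Finset.univ f (Finset.mem_univ α), X.basicOpen_mul,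
        X.basicOpen_mul]
      exact inf_le_right.trans inf_le_left
    rw [← (h.isLocalEquation α).nonvanishing_inf] at h1
    exact h1.trans inf_le_left
  have hmemU (q : Points F X) (hq : q ∈ ratPoints F V) :
      q ∈ ratPoints F U ↔ ∀ α, value (f α) q ≠ 0 := by
    simp only [(h.isLocalEquation _).value_ne_zero_iff hq, mem_ratPoints, hU]
    rw [← SetLike.mem_coe, Opens.coe_iInf, mem_iInter]
    rfl
  -- `ω` has a coefficient with respect to `dx₁ ∧ ⋯ ∧ dx_d` where `a` and all `f α` are invertible
  set W := X.basicOpen (a * ∏ α, f α) with hWdef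
  have hWV : W ≤ V := X.basicOpen_le _
  have hW : IsAffineOpen W := hV.basicOpen _
  obtain ⟨hspan, g, hg, hgnorm⟩ := h.exists_coefficient hV hx hW hWV hUW rfl
  -- the factor which does not vanish at `p`
  let n (α : ι) (q : Points F X) : ℝ := (metric α).norm V (e α) q
  let w (q : Points F X) : ℝ := ‖value a q‖⁻¹ ^ m * (∏ α, n α q ^ ((m : ℝ) * r α)) *
    ∏ α ∈ Jᶜ, ‖value (f α) q‖ ^ ((m : ℝ) * (r α - lam α))
  have hVnhds : ratPoints F V ∈ 𝓝 p := (isOpen_ratPoints V).mem_nhds hpV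
  have hval (b : Γ(X, V)) : ContinuousAt (value b) p := (continuousOn_value b).continuousAt hVnhds
  have hnpos (α : ι) {q : Points F X} (hq : q ∈ ratPoints F V) : 0 < n α q :=
    (metric α).norm_pos V (e α) (h.isLocalEquation α).1 q hq
  have hJc {α : ι} (hα : α ∈ Jᶜ) : value (f α) p ≠ 0 := by
    rwa [Finset.mem_compl, hJ] at hα
  have hwc : ContinuousAt w p := by
    refine ((((hval a).norm.inv₀ (norm_ne_zero_iff.2 ha)).pow m).mul ?_).mul ?_
    · refine tendsto_finsetProd _ fun α _ => ?_
      exact (((metric α).continuousOn V (e α)).continuousAt hVnhds).rpow_const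
        (Or.inl (hnpos α hpV).ne')
    · refine tendsto_finsetProd _ fun α hα => ?_
      exact (hval (f α)).norm.rpow_const (Or.inl (norm_ne_zero_iff.2 (hJc hα)))
  have hwp : 0 < w p := by
    refine mul_pos (mul_pos (pow_pos (inv_pos.2 (norm_pos_iff.2 ha)) m) ?_) ?_
    · exact Finset.prod_pos fun α _ => Real.rpow_pos_of_pos (hnpos α hpV) _
    · exact Finset.prod_pos fun α hα => Real.rpow_pos_of_pos (norm_pos_iff.2 (hJc hα)) _
  have hN : {q | value a q ≠ 0 ∧ (∀ α ∈ Jᶜ, value (f α) q ≠ 0) ∧ w p / 2 ≤ w q ∧ w q ≤ 2 * w p} ∈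
      𝓝 p := by
    refine ((hval a).eventually_ne ha).and (.and ?_ (.and ?_ ?_))
    · exact (Finset.eventually_all _).2 fun α hα => (hval (f α)).eventually_ne (hJc hα)
    · exact hwc.eventually_const_le (by linarith)
    · exact hwc.eventually_le_const (by linarith)
  -- a ball on which this factor is bounded, and on which only the `f α` with `α ∈ J` have zeros
  obtain ⟨ε, hε, B, hB, hpB, hBN, hBE, hball⟩ := exists_coordinate_ball E hpE hN
  have hBW (q : Points F X) (hqB : q ∈ B) (hqU : q ∈ ratPoints F U) : q ∈ ratPoints F W := by
    have hqV := hEV (hBE hqB)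
    rw [hWdef, mem_ratPoints_basicOpen, and_iff_right hqV, ← evalHom_apply hqV, map_mul, map_prod]
    simp only [evalHom_apply]
    exact mul_ne_zero (hBN hqB).1 (Finset.prod_ne_zero_iff.2 fun α _ => (hmemU q hqV).1 hqU α)
  have hBU : IsOpen (B ∩ ratPoints F U) := hB.inter (isOpen_ratPoints U)
  have hsource : (E.restrOpen _ hBU).source = B ∩ ratPoints F U :=
    (E.restrOpen_source _ hBU).trans (inter_eq_right.2 (inter_subset_left.trans hBE))
  let c : Coordinates ω :=
    { V := W
      isAffineOpen := hW
      le := hUW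
      x := fun j => resFun hWV (x j)
      span_wedge := hspan
      chart := E.restrOpen _ hBU
      source_subset := by
        rw [hsource]
        exact fun q hq => hBW q hq.1 hq.2
      chart_apply := fun q hq => by
        rw [hsource] at hq
        refine (hE q (hBE hq.1)).trans (funext fun j => ?_)
        exact (value_resFun hWV _ (hBW q hq.1 hq.2)).symm
      g := g
      val_eq := hg }
  refine ⟨B, E, c, hB, hpB, hBE, hsource, ?_⟩
  -- the exponent of `x (i α) = f α`; the other coordinates do not occur in the monomial
  let σ : Fin d → ℝ := Function.extend i (fun α : J => (m : ℝ) * (r α - lam α)) 0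
  have hσ (α : J) : σ (i α) = (m : ℝ) * (r α - lam α) := hi.extend_apply _ _ α
  have hEi {q : Points F X} (hq : q ∈ E.source) (α : J) : E q (i α) = value (f α) q := by
    rw [hE q hq]
    exact congrArg (value · q) (hxi α)
  have hG : ContinuousOn (fun q => ∏ α, (metric α).norm ⊤ (s α) q ^ ((m : ℝ) * r α))
      c.chart.source := by
    refine continuousOn_finsetProd _ fun α _ =>
      ((metric α).continuous_norm_top (s α)).continuousOn.rpow_const fun q hq => Or.inl ?_
    refine ((metric α).norm_pos_of_mem_nonvanishing ?_).ne'
    rw [hsource] at hq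
    exact ratPoints_mono (hU.trans_le (iInf_le _ α)) hq.2
  have htarget : c.chart.target =
      {y | y ∈ ball (E p) ε ∧ ∀ j ∈ Finset.univ.image i, y j ≠ 0} := by
    ext y
    change (y ∈ E.target ∧ E.symm y ∈ B ∩ ratPoints F U) ↔ _
    rw [mem_inter_iff, ← and_assoc, hball]
    refine and_congr_right fun hy => ?_
    obtain ⟨hyE, hyB⟩ := (hball y).2 hy
    have hyi (α : J) : y (i α) = value (f α) (E.symm y) := by
      rw [← hEi (hBE hyB), E.right_inv hyE]
    rw [hmemU _ (hEV (hBE hyB))]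
    simp only [Finset.mem_image, Finset.mem_univ, true_and, forall_exists_index,
      forall_apply_eq_imp_iff, hyi]
    refine ⟨fun h1 α => h1 α, fun h1 α => ?_⟩
    by_cases hα : α ∈ J
    · exact h1 ⟨α, hα⟩
    · exact (hBN hyB).2.1 α (Finset.mem_compl.2 hα)
  rw [c.lintegral_lt_top_iff hμ hm (σ := σ) (w := w) ?_ hε htarget hG ?_ (half_pos hwp)
    (C₂ := 2 * w p) ?_]
  · simp only [Finset.mem_image, Finset.mem_univ, true_and, forall_exists_index,
      forall_apply_eq_imp_iff, hσ]
    rw [Subtype.forall]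
    refine forall_congr' fun α => ?_
    have hm' : (0 : ℝ) < m := Nat.cast_pos.2 (Nat.pos_of_ne_zero hm)
    have key : -(m : ℝ) < m * (r α - lam α) ↔ lam α - 1 < r α := by
      rw [← sub_pos, ← sub_pos (b := (lam α : ℝ) - 1),
        show (m : ℝ) * (r α - lam α) - -(m : ℝ) = m * (r α - (lam α - 1)) by ring,
        mul_pos_iff_of_pos_left hm']
    rw [← (h.isLocalEquation α).value_ne_zero_iff hpV, not_not]
    exact ⟨fun h1 h2 => key.1 (h1 ((hJ α).2 h2)), fun h1 h2 => key.2 (h1 ((hJ α).1 h2))⟩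
  · simp only [Finset.mem_image, Finset.mem_univ, true_and, forall_exists_index,
      forall_apply_eq_imp_iff]
    intro α
    rw [hEi hpE, ← hJ]
    exact α.2
  · intro q hq
    rw [hsource] at hq
    have hqV := hEV (hBE hq.1)
    have h1 (α : ι) : (metric α).norm ⊤ (s α) q = ‖value (f α) q‖ * n α q :=
      (metric α).norm_eq_mul (h.isLocalEquation α) hqV
    simp only [h1]
    change ‖value g q‖ ^ m * _ = w q * ∏ j ∈ Finset.univ.image i, ‖E q j‖ ^ σ j
    rw [hgnorm q (hBW q hq.1 hq.2), coefficient_pow_mul_prod_norm_rpow m r lam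
      (fun α => norm_pos_iff.2 ((hmemU q hqV).1 hq.2 α)) fun α => hnpos α hqV,
      Finset.prod_image hi.injOn,
      ← Finset.prod_compl_mul_prod J (fun α => ‖value (f α) q‖ ^ ((m : ℝ) * (r α - lam α))),
      ← mul_assoc,
      ← Finset.prod_coe_sort J (fun α => ‖value (f α) q‖ ^ ((m : ℝ) * (r α - lam α)))]
    simp only [hEi (hBE hq.1), hσ]
    rfl
  · intro q hq
    rw [hsource] at hq
    exact (hBN hq.1).2.2

end LocalIntegrability

/-! ### Convergence of the integral over the rational points -/

section Convergence

open _root_.Filter Set Topology ENNReal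

variable {F : Type u} [NontriviallyNormedField F] [ProperSpace F] [MeasurableSpace F] [BorelSpace F]
  {m : ℕ} {μ : Measure F} [μ.IsAddHaarMeasure] {X : Scheme.{u}} [X.Over (Spec (.of F))]
  {d : ℕ} {U : X.Opens} {ω : DForm F d U}

omit [μ.IsAddHaarMeasure] in
theorem Coordinates.measure_restrict_source (c : Coordinates ω) :
    (c.measure m μ).restrict c.chart.source = c.measure m μ :=
  chartMeasure_restrict_source (μ := μ) c.chart fun x => ‖value c.g x‖ ^ m

/-- The measure `dω` is dominated by the sum of finitely many of the measures it is glued from, if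
the domains of the coordinates cover `U(F)`. -/
theorem HasHaarScaling.exists_measure_le (hμ : HasHaarScaling m μ)
    [SmoothOfRelativeDimension d (X ↘ Spec (.of F))] [SecondCountableTopology (Points F X)]
    (hω : ∀ c : Coordinates ω, ∀ x ∈ ratPoints F c.V, value c.g x ≠ 0) {κ : Type*} {t : Finset κ}
    {c : κ → Coordinates ω} (hc : ratPoints F U ⊆ ⋃ i ∈ t, (c i).chart.source) :
    ∃ C : ℝ≥0∞, C ≠ ∞ ∧ ω.measure m μ ≤ C • ∑ i ∈ t, (c i).measure m μ := by
  obtain ⟨C, -, hC, h⟩ := hμ.exists_coordinates_measure_le hω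
  refine ⟨C, hC, iSup_le fun c' => Measure.le_iff.2 fun S hS => ?_⟩
  have hsub : S ∩ c'.chart.source ⊆ ⋃ i ∈ t, S ∩ (c'.chart.source ∩ (c i).chart.source) := by
    rintro x ⟨hxS, hx⟩
    obtain ⟨i, hi, hxi⟩ := mem_iUnion₂.1 (hc (ratPoints_mono c'.le (c'.source_subset hx)))
    exact mem_iUnion₂.2 ⟨i, hi, hxS, hx, hxi⟩
  rw [← c'.measure_restrict_source, Measure.restrict_apply hS, Measure.smul_apply,
    Measure.finsetSum_apply, smul_eq_mul, Finset.mul_sum]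
  refine (measure_mono hsub).trans ((measure_biUnion_finset_le t _).trans ?_)
  refine Finset.sum_le_sum fun i _ => (h c' (c i) _ inter_subset_right ?_).trans ?_
  · exact hS.inter (c'.chart.open_source.inter (c i).chart.open_source).measurableSet
  · exact mul_le_mul_right (measure_mono inter_subset_left) C

variable {ι : Type v} [Fintype ι] {L : ι → X.Modules} {s : ∀ α, Γ(L α, (⊤ : X.Opens))}
  {lam : ι → ℤ}

omit [ProperSpace F] [MeasurableSpace F] [BorelSpace F] in
/-- The integrand is positive and continuous on `U(F)`: real powers of a norm are so where the norm
does not vanish. -/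
theorem integrableOn_iff_lintegral_lt_top [SecondCountableTopology (Points F X)]
    (hU : U = ⨅ α, nonvanishing (L α) (s α)) (metric : ∀ α, Metric F (L α)) (r : ι → ℝ)
    (ν : Measure (Points F X)) :
    IntegrableOn (fun x => ∏ α, (metric α).norm ⊤ (s α) x ^ r α) (ratPoints F U) ν ↔
      ∫⁻ x in ratPoints F U, ENNReal.ofReal (∏ α, (metric α).norm ⊤ (s α) x ^ r α) ∂ν < ∞ := by
  have hpos {x : Points F X} (hx : x ∈ ratPoints F U) (α : ι) : 0 < (metric α).norm ⊤ (s α) x :=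
    (metric α).norm_pos_of_mem_nonvanishing (ratPoints_mono (hU.trans_le (iInf_le _ α)) hx)
  have hmeas := (isOpen_ratPoints (F := F) U).measurableSet
  have h1 : AEStronglyMeasurable (fun x => ∏ α, (metric α).norm ⊤ (s α) x ^ r α)
      (ν.restrict (ratPoints F U)) := by
    refine ContinuousOn.aestronglyMeasurable ?_ hmeas
    exact continuousOn_finsetProd _ fun α _ =>
      ((metric α).continuous_norm_top (s α)).continuousOn.rpow_const fun x hx =>
        Or.inl (hpos hx α).ne'
  rw [IntegrableOn, Integrable, and_iff_right h1, hasFiniteIntegral_iff_ofReal]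
  refine ae_restrict_of_forall_mem hmeas fun x hx => ?_
  exact Finset.prod_nonneg fun α _ => (Real.rpow_pos_of_pos (hpos hx α) _).le

/-- By compactness, the integral converges if and only if it converges near each rational point. -/
theorem HasHaarScaling.integrableOn_prod_norm_iff (hμ : HasHaarScaling m μ) (hm : m ≠ 0)
    [IsProper (X ↘ Spec (.of F))] [SmoothOfRelativeDimension d (X ↘ Spec (.of F))]
    (hω : ω.HasDivisor L s fun α => -lam α)
    (hsmooth : ∀ α, IsSmoothDivisor F (L α) (s α)) (hnc : HasNormalCrossings L s)
    (hU : U = ⨅ α, nonvanishing (L α) (s α)) (metric : ∀ α, Metric F (L α)) (r : ι → ℝ) :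
    IntegrableOn (fun x => ∏ α, (metric α).norm ⊤ (s α) x ^ ((m : ℝ) * r α)) (ratPoints F U)
        (ω.measure m μ) ↔
      ∀ α, (∃ x : Points F X, x ∉ ratPoints F (nonvanishing (L α) (s α))) → lam α - 1 < r α := by
  choose B E c hB hmem hBE hsource hfin using
    hω.exists_coordinates_lintegral_lt_top_iff hμ hm hsmooth hnc hU metric r
  obtain ⟨t, ht⟩ := (isCompact_univ_points (F := F) (X := X)).elim_finite_subcover B hB
    fun x _ => mem_iUnion.2 ⟨x, hmem x⟩
  have hsc : SecondCountableTopology (Points F X) := by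
    have (i : t) : SecondCountableTopology (E i).source := (E i).secondCountableTopology_source
    refine secondCountableTopology_of_countable_cover (U := fun i : t => (E i).source)
      (fun i => (E i).open_source) (univ_subset_iff.1 (ht.trans ?_))
    exact iUnion₂_subset fun p hp => (hBE p).trans (subset_iUnion_of_subset ⟨p, hp⟩ subset_rfl)
  rw [integrableOn_iff_lintegral_lt_top hU]
  set G : Points F X → ℝ≥0∞ :=
    fun x => ENNReal.ofReal (∏ α, (metric α).norm ⊤ (s α) x ^ ((m : ℝ) * r α))
  constructor
  · rintro h α ⟨p, hp⟩
    refine (hfin p).1 (lt_of_le_of_lt ?_ h) α hp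
    rw [← (c p).measure_restrict_source]
    exact lintegral_mono' (Measure.restrict_mono ((hsource p).trans_subset inter_subset_right)
      (le_iSup (fun c : Coordinates ω => c.measure m μ) (c p))) le_rfl
  · intro h
    obtain ⟨C, hC, hle⟩ := hμ.exists_measure_le (c := c) (t := t)
      (fun c x hx => hω.value_ne_zero (fun α => hU.trans_le (iInf_le _ α)) c.isAffineOpen c.le
        c.val_eq hx) fun x hx => by
        obtain ⟨p, hp, hxp⟩ := mem_iUnion₂.1 (ht (mem_univ x))
        exact mem_iUnion₂.2 ⟨p, hp, (hsource p).symm.subset ⟨hxp, hx⟩⟩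
    refine ((setLIntegral_le_lintegral _ _).trans (lintegral_mono' hle le_rfl)).trans_lt ?_
    rw [lintegral_smul_measure, lintegral_finsetSum_measure, smul_eq_mul]
    exact ENNReal.mul_lt_top hC.lt_top
      (ENNReal.sum_lt_top.2 fun p _ => (hfin p).2 fun α hα => h α ⟨p, hα⟩)

end Convergence

end LocalIntegral

end

theorem mainTheorem7
    -- `F` is a finite extension of `k = ℝ` or `k = ℚ_p`, with the extended absolute value
    {k : Type*} [NontriviallyNormedField k] (hk : LocalIntegral.IsRealOrPadic k)
    {F : Type u} [NormedField F] [NormedAlgebra k F] [FiniteDimensional k F]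
    [MeasurableSpace F] [BorelSpace F] (μ : Measure F) [μ.IsAddHaarMeasure]
    -- `X` is proper and smooth of dimension `d` over `F`
    {X : Scheme.{u}} [X.Over (Spec (.of F))] (d : ℕ)
    [IsProper (X ↘ Spec (.of F))] [SmoothOfRelativeDimension d (X ↘ Spec (.of F))]
    -- metrized line bundles with sections
    {ι : Type v} [Fintype ι] (L : ι → X.Modules) (hL : ∀ α, LocalIntegral.IsLineBundle (L α))
    (metric : ∀ α, LocalIntegral.Metric F (L α)) (s : ∀ α, Γ(L α, (⊤ : X.Opens)))
    (hsmooth : ∀ α, LocalIntegral.IsSmoothDivisor F (L α) (s α))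
    (hnc : LocalIntegral.HasNormalCrossings L s)
    -- `U` is the complement of the divisors, `ω` a top form on `U`
    (U : X.Opens) (hU : U = ⨅ α, LocalIntegral.nonvanishing (L α) (s α))
    (ω : LocalIntegral.DForm F d U) (lam : ι → ℤ)
    (hω : ω.HasDivisor L s fun α => -lam α)
    (r : ι → ℝ) :
    IntegrableOn
        (fun x => ∏ α, (metric α).norm ⊤ (s α) x ^ ((Module.finrank k F : ℝ) * r α))
        (LocalIntegral.ratPoints F U) (ω.measure (Module.finrank k F) μ) ↔
      ∀ α, (∃ x : LocalIntegral.Points F X,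
          x ∉ LocalIntegral.ratPoints F (LocalIntegral.nonvanishing (L α) (s α))) →
        r α > lam α - 1 := by
  have : ProperSpace k := hk.properSpace
  have : ProperSpace F := FiniteDimensional.proper k F
  let _ : NontriviallyNormedField F := .ofNormNeOne <| by
    obtain ⟨x, hx⟩ := NormedField.exists_one_lt_norm k
    refine ⟨algebraMap k F x, ?_, ?_⟩
    · rw [← norm_ne_zero_iff, norm_algebraMap']
      exact (zero_lt_one.trans hx).ne'
    · rw [norm_algebraMap']
      exact hx.ne'
  exact (LocalIntegral.hasHaarScaling hk μ).integrableOn_prod_norm_iff Module.finrank_pos.ne' hω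
    hsmooth hnc hU metric r
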